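/- Let $\mathcal S_\infty$ be the group of permutations of $\{1,2,3,\dots\}$ fixing all but finitely many numbers, let $\ell(w)$ be the number of inversions of $w$, and let $\mathfrak S_w\in\mathbb Z[x_1,x_2,\dots]$ be the Schubert polynomial of $w\in\mathcal S_\infty$. The structure constants $c_{uv}^w\in\mathbb Z$ are defined by the unique expansion $\mathfrak S_u\mathfrak S_v=\sum_{w}c_{uv}^w\,\mathfrak S_w$. For a partition $\lambda$ with at most $k$ nonzero parts, $v(\lambda,k)$ is the Grassmannian permutation with $v(i)=i+\lambda_{k+1-i}$ for $i\le k$ and $v(k+1)<v(k+2)<\cdots$ (so that $\mathfrak S_{v(\lambda,k)}$ is the Schur polynomial $S_\lambda(x_1,\dots,x_k)$). The $k$-Bruhat order $\le_k$ on $\mathcal S_\infty$ is the partial order whose covers are $u\lessdot_k u(a\,b)$ with $a\le k<b$ and $\ell(u(a\,b))=\ell(u)+1$. The universal $k$-Bruhat order is defined by: $\eta\preceq\zeta$ if there are $u\in\mathcal S_\infty$ and $k$ with $u\le_k\eta u\le_k\zeta u$. For $\alpha<\beta$ let $\hat u_{\alpha\beta}$ be the linear operator on $\mathbb Q\mathcal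 S_\infty$ that sends a permutation $\zeta$ to $(\alpha\,\beta)\zeta$ if $(\alpha\,\beta)\zeta$ covers $\zeta$ in $\preceq$, and to $0$ otherwise. A $u$-reduced sequence for $\zeta$ is a sequence $(\alpha_1,\beta_1),\dots,(\alpha_n,\beta_n)$ with $\alpha_i<\beta_i$ such that $\hat u_{\alpha_n\beta_n}\cdots\hat u_{\alpha_1\beta_1}1=\zeta$. For $p=(p_1,\dots,p_r)\in\mathbb Z^r$ let $\mathcal H_p(\zeta)$ be the set of those $u$-reduced sequences for $\zeta$ of length $n=p_1+\cdots+p_r$ that satisfy $\alpha_s<\alpha_{s+1}$ whenever $s$ and $s+1$ both lie in one of the consecutive blocks $\{p_1+\cdots+p_{i-1}+1,\dots,p_1+\cdots+p_i\}$, $1\le i\le r$, if all $p_i\ge 0$; and let $\mathcal H_p(\zeta)=\emptyset$ if some $p_i<0$. For a partition $\lambda=(\lambda_1\ge\dots\ge\lambda_r\ge0)$ and $\sigma\in\mathcal S_r$ let $\lambda_\sigma\in\mathbb Z^r$ be given by $\lambda_\sigma(i)=\lambda_{\sigma(i)}+i-\sigma(i)$, and let $\epsilon(\sigma)$ be the sign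 of $\sigma$. **Theorem.** Let $\lambda=(\lambda_1,\dots,\lambda_r)$ be a partition and $\zeta\in\mathcal S_\infty$. There are $k$ and $u\le_k w$ in $\mathcal S_\infty$ with $wu^{-1}=\zeta$ such that $\lambda$ has at most $k$ nonzero parts; the sets $\mathcal H_{\lambda_\sigma}(\zeta)$ are finite; and for every such choice of $k,u,w$ the constant $c_\lambda^\zeta=c_{u\,v(\lambda,k)}^{w}$ is $$c_\lambda^\zeta=\sum_{\sigma\in\mathcal S_r}\epsilon(\sigma)\,\bigl|\mathcal H_{\lambda_\sigma}(\zeta)\bigr| .$$ In particular it depends only on $\lambda$ and $\zeta$. -/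

import Mathlib

open scoped BigOperators

noncomputable section

namespace KBruhat

/-! Positions, values and variables are indexed by `0, 1, 2, …` instead of `1, 2, 3, …`. -/

/-- The infinite symmetric group: permutations of `ℕ` that fix all but finitely many numbers. -/
def SInf : Subgroup (Equiv.Perm ℕ) where
  carrier := {w | {i | w i ≠ i}.Finite}
  one_mem' := by simp
  mul_mem' := by
    intro a b ha hb
    refine (Set.Finite.union ha hb).subset fun i hi => ?_
    by_contra h
    simp only [Set.mem_union, Set.mem_ofPred_eq, not_or, not_not] at h
    exact hi (by rw [Equiv.Perm.mul_apply, h.2, h.1])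
  inv_mem' := by
    intro a ha
    refine Set.Finite.subset ha fun i hi h => hi ?_
    rw [Equiv.Perm.inv_eq_iff_eq]
    exact h.symm

/-- The transposition `(a b)` as an element of the infinite symmetric group. -/
def transp (a b : ℕ) : SInf :=
  ⟨Equiv.swap a b, by
    refine Set.Finite.subset (Set.toFinite {a, b}) fun i hi => ?_
    by_contra h
    simp only [Set.mem_insert_iff, Set.mem_singleton_iff, not_or] at h
    exact hi (Equiv.swap_apply_of_ne_of_ne h.1 h.2)⟩

/-- The length of a permutation: its number of inversions. -/
def len (w : SInf) : ℕ :=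
  {p : ℕ × ℕ | p.1 < p.2 ∧ w.1 p.2 < w.1 p.1}.ncard

/-! ### Schubert polynomials -/

/-- The operator on polynomials that interchanges the variables `x_i` and `x_{i+1}`. -/
def swapVars (i : ℕ) (f : MvPolynomial ℕ ℤ) : MvPolynomial ℕ ℤ :=
  MvPolynomial.rename (Equiv.swap i (i + 1)) f

theorem exists_dividedDifference (i : ℕ) (f : MvPolynomial ℕ ℤ) :
    ∃ g : MvPolynomial ℕ ℤ,
      (MvPolynomial.X i - MvPolynomial.X (i + 1)) * g = f - swapVars i f := by
  unfold swapVars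
  induction f using MvPolynomial.induction_on with
  | C a => exact ⟨0, by simp⟩
  | add p q hp hq =>
    obtain ⟨g, hg⟩ := hp
    obtain ⟨h, hh⟩ := hq
    exact ⟨g + h, by rw [mul_add, hg, hh, map_add]; ring⟩
  | mul_X p n hp =>
    obtain ⟨g, hg⟩ := hp
    have key : ∃ h : MvPolynomial ℕ ℤ, (MvPolynomial.X i - MvPolynomial.X (i + 1)) * h =
        MvPolynomial.X n - MvPolynomial.X (Equiv.swap i (i + 1) n) := by
      by_cases h1 : n = i
      · subst h1
        exact ⟨1, by simp⟩
      · by_cases h2 : n = i + 1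
        · subst h2
          exact ⟨-1, by simp⟩
        · exact ⟨0, by simp [Equiv.swap_apply_of_ne_of_ne h1 h2]⟩
    obtain ⟨h, hh⟩ := key
    refine ⟨g * MvPolynomial.X n +
      MvPolynomial.rename (Equiv.swap i (i + 1)) p * h, ?_⟩
    rw [map_mul, MvPolynomial.rename_X, mul_add, ← mul_assoc, hg, mul_left_comm, hh]
    ring

/-- The divided difference `(f - s_i f) / (x_i - x_{i+1})`. -/
def dividedDifference (i : ℕ) (f : MvPolynomial ℕ ℤ) : MvPolynomial ℕ ℤ :=
  (exists_dividedDifference i f).choose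

/-- The pairs of positions below `n` that are in increasing order in `w`. -/
def noninversions (n : ℕ) (w : Equiv.Perm ℕ) : Finset (ℕ × ℕ) :=
  (Finset.range n ×ˢ Finset.range n).filter fun p => p.1 < p.2 ∧ w p.1 < w p.2

theorem card_noninversions_lt (n : ℕ) (w : Equiv.Perm ℕ) (i : ℕ) (hi : i + 1 < n)
    (h : w i < w (i + 1)) :
    (noninversions n (w * Equiv.swap i (i + 1))).card < (noninversions n w).card := by
  have hmem : (i, i + 1) ∈ noninversions n w := by
    simp only [noninversions, Finset.mem_filter, Finset.mem_product, Finset.mem_range]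
    exact ⟨⟨by omega, hi⟩, by omega, h⟩
  rw [← Finset.card_erase_add_one hmem]
  refine Nat.lt_succ_of_le (Finset.card_le_card_of_injOn
    (fun p => (Equiv.swap i (i + 1) p.1, Equiv.swap i (i + 1) p.2)) ?_ ?_)
  · rintro ⟨a, b⟩ hab
    obtain ⟨hr, hlt, hw⟩ := Finset.mem_filter.1 (Finset.mem_coe.1 hab)
    simp only [Finset.mem_product, Finset.mem_range] at hr
    simp only [Equiv.Perm.mul_apply] at hlt hw
    obtain ⟨ha, hb⟩ := hr
    have hne : ¬ (a = i ∧ b = i + 1) := by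
      rintro ⟨rfl, rfl⟩
      simp only [Equiv.swap_apply_left, Equiv.swap_apply_right] at hw
      omega
    simp only [Finset.coe_erase, Set.mem_sdiff, Finset.mem_coe, noninversions, Finset.mem_filter,
      Finset.mem_product, Finset.mem_range, Set.mem_singleton_iff, Prod.mk.injEq]
    refine ⟨⟨⟨?_, ?_⟩, ?_, hw⟩, ?_⟩ <;>
      simp only [Equiv.swap_apply_def] <;> split_ifs <;> omega
  · rintro ⟨a, b⟩ _ ⟨c, d⟩ _ hpq
    simpa using hpq

/-- The first `i` with `i + 1 < n` and `w i < w (i + 1)`; it is `0` if there is none. -/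
def firstAscent (n : ℕ) (w : Equiv.Perm ℕ) : ℕ :=
  sInf {i | i + 1 < n ∧ w i < w (i + 1)}

/-- The Schubert polynomial of a permutation `w` of the first `n` numbers, by descending
induction on length: `𝔖_{w₀} = x_0^{n-1} x_1^{n-2} ⋯ x_{n-1}^0` for the longest element `w₀`,
and `𝔖_w = ∂_i 𝔖_{w s_i}` for the first `i` with `w i < w (i + 1)` if there is one. -/
def schubertIn (n : ℕ) (w : Equiv.Perm ℕ) : MvPolynomial ℕ ℤ :=
  if _h : firstAscent n w + 1 < n ∧ w (firstAscent n w) < w (firstAscent n w + 1) then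
    dividedDifference (firstAscent n w)
      (schubertIn n (w * Equiv.swap (firstAscent n w) (firstAscent n w + 1)))
  else
    ∏ i ∈ Finset.range n, MvPolynomial.X i ^ (n - 1 - i)
termination_by (noninversions n w).card
decreasing_by
  exact card_noninversions_lt n w _ _h.1 _h.2

/-- The Schubert polynomial of `w`, computed in the smallest symmetric group containing `w`. -/
def schubert (w : SInf) : MvPolynomial ℕ ℤ :=
  schubertIn (sInf {n | ∀ i, n ≤ i → w.1 i = i}) w.1

/-- `c` lists the coefficients of the expansion of `f` in Schubert polynomials. -/
def IsSchubertExpansion (f : MvPolynomial ℕ ℤ) (c : SInf →₀ ℤ) : Prop :=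
  f = c.sum fun w a => a • schubert w

open Classical in
/-- The structure constant `c_{u v}^w`: the coefficient of `𝔖_w` in the expansion of
`𝔖_u 𝔖_v` in the Schubert basis. -/
def structConst (u v w : SInf) : ℤ :=
  if h : ∃ c, IsSchubertExpansion (schubert u * schubert v) c then h.choose w else 0

/-! ### Grassmannian permutations -/

/-- The values of the Grassmannian permutation of shape `μ` with descent at `k`: its first `k`
values are `μ_k < 1 + μ_{k-1} < ⋯ < (k - 1) + μ_1`, and the others follow in increasing order. -/
def grassFun (μ : YoungDiagram) (k i : ℕ) : ℕ :=
  if i < k then i + μ.rowLen (k - 1 - i) else i - μ.colLen (i - k)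

theorem rowLen_le_of_le (μ : YoungDiagram) (a : ℕ) : μ.rowLen a ≤ μ.rowLen 0 :=
  μ.rowLen_anti 0 a (Nat.zero_le a)

theorem colLen_eq_zero (μ : YoungDiagram) (b : ℕ) (hb : μ.rowLen 0 ≤ b) : μ.colLen b = 0 := by
  by_contra h
  have h1 : (0, b) ∈ μ := YoungDiagram.mem_iff_lt_colLen.2 (Nat.pos_of_ne_zero h)
  have h2 := YoungDiagram.mem_iff_lt_rowLen.1 h1
  omega

theorem grassFun_injective (μ : YoungDiagram) (k : ℕ) (hk : μ.colLen 0 ≤ k) :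
    Function.Injective (grassFun μ k) := by
  have low : ∀ i j, i < j → j < k → grassFun μ k i < grassFun μ k j := by
    intro i j hij hj
    have := μ.rowLen_anti (k - 1 - j) (k - 1 - i) (by omega)
    simp only [grassFun, if_pos hj, if_pos (hij.trans hj)]
    omega
  have high : ∀ i j, k ≤ i → i < j → grassFun μ k i < grassFun μ k j := by
    intro i j hi hij
    have h1 := μ.colLen_anti (i - k) (j - k) (by omega)
    have h2 := μ.colLen_anti 0 (i - k) (by omega)
    simp only [grassFun, if_neg (show ¬ i < k by omega), if_neg (show ¬ j < k by omega)]
    omega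
  have cross : ∀ i j, i < k → k ≤ j → grassFun μ k i ≠ grassFun μ k j := by
    intro i j hi hj
    have h2 := μ.colLen_anti 0 (j - k) (by omega)
    simp only [grassFun, if_pos hi, if_neg (show ¬ j < k by omega)]
    by_cases hm : (k - 1 - i, j - k) ∈ μ
    · have h3 := YoungDiagram.mem_iff_lt_rowLen.1 hm
      have h4 := YoungDiagram.mem_iff_lt_colLen.1 hm
      omega
    · have h3 := mt YoungDiagram.mem_iff_lt_rowLen.2 hm
      have h4 := mt YoungDiagram.mem_iff_lt_colLen.2 hm
      omega
  intro i j hij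
  by_contra hne
  rcases lt_or_gt_of_ne hne with h | h
  · by_cases hi : i < k
    · by_cases hj : j < k
      · exact (low i j h hj).ne hij
      · exact cross i j hi (by omega) hij
    · exact (high i j (by omega) h).ne hij
  · by_cases hj : j < k
    · by_cases hi : i < k
      · exact (low j i h hi).ne hij.symm
      · exact cross j i hj (by omega) hij.symm
    · exact (high j i (by omega) h).ne hij.symm

theorem grassFun_eq_self (μ : YoungDiagram) (k i : ℕ) (hi : k + μ.rowLen 0 ≤ i) :
    grassFun μ k i = i := by
  simp only [grassFun, if_neg (show ¬ i < k by omega)]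
  rw [colLen_eq_zero μ (i - k) (by omega), Nat.sub_zero]

theorem grassFun_bijective (μ : YoungDiagram) (k : ℕ) (hk : μ.colLen 0 ≤ k) :
    Function.Bijective (grassFun μ k) := by
  refine ⟨grassFun_injective μ k hk, fun m => ?_⟩
  by_cases hm : k + μ.rowLen 0 ≤ m
  · exact ⟨m, grassFun_eq_self μ k m hm⟩
  · have hmaps : Set.MapsTo (grassFun μ k) (Finset.range (k + μ.rowLen 0))
        (Finset.range (k + μ.rowLen 0)) := by
      intro i hi
      simp only [Finset.coe_range, Set.mem_Iio] at hi ⊢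
      by_contra hge
      have := grassFun_injective μ k hk (grassFun_eq_self μ k _ (not_lt.1 hge))
      omega
    have hsurj := Finset.surjOn_of_injOn_of_card_le _ hmaps
      (grassFun_injective μ k hk).injOn le_rfl
    obtain ⟨i, -, hi⟩ := hsurj (show m ∈ (Finset.range (k + μ.rowLen 0) : Set ℕ) by
      simp only [Finset.coe_range, Set.mem_Iio]; omega)
    exact ⟨i, hi⟩

/-- The Grassmannian permutation `v(μ, k)`, for a partition `μ` with at most `k` parts. -/
def grassmannian (μ : YoungDiagram) (k : ℕ) (hk : μ.colLen 0 ≤ k) : SInf :=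
  ⟨Equiv.ofBijective (grassFun μ k) (grassFun_bijective μ k hk), by
    refine Set.Finite.subset (Set.finite_lt_nat (k + μ.rowLen 0)) fun i hi => ?_
    by_contra h
    exact hi (grassFun_eq_self μ k i (not_lt.1 h))⟩

/-! ### The `k`-Bruhat orders and the universal `k`-Bruhat order -/

/-- The cover relation of the `k`-Bruhat order: `w = u (a b)` with `a` one of the first `k`
positions, `b` one of the others, and `ℓ(w) = ℓ(u) + 1`. -/
def KCover (k : ℕ) (u w : SInf) : Prop :=
  ∃ a b, a < k ∧ k ≤ b ∧ w = u * transp a b ∧ len w = len u + 1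

/-- The `k`-Bruhat order. -/
def KLe (k : ℕ) : SInf → SInf → Prop :=
  Relation.ReflTransGen (KCover k)

/-- The universal `k`-Bruhat order `η ⪯ ζ`. -/
def UnivLe (η ζ : SInf) : Prop :=
  ∃ (u : SInf) (k : ℕ), KLe k u (η * u) ∧ KLe k (η * u) (ζ * u)

/-- `ζ` covers `η` in the universal `k`-Bruhat order. -/
def UnivCover (η ζ : SInf) : Prop :=
  UnivLe η ζ ∧ η ≠ ζ ∧ ∀ ξ, UnivLe η ξ → UnivLe ξ ζ → ξ = η ∨ ξ = ζ

open Classical in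
/-- The linear operator `û_{αβ}` on `ℚ S_∞` that sends a permutation `ζ` to `(α β) ζ` if this
covers `ζ` in the universal `k`-Bruhat order, and to `0` otherwise. -/
def uHat (α β : ℕ) : Module.End ℚ (SInf →₀ ℚ) :=
  Finsupp.linearCombination ℚ fun ζ =>
    if UnivCover ζ (transp α β * ζ) then Finsupp.single (transp α β * ζ) 1 else 0

/-- The composition `û_{α_n β_n} ⋯ û_{α_1 β_1}` of the list `[(α_1, β_1), …, (α_n, β_n)]`. -/
def uComp (x : List (ℕ × ℕ)) : Module.End ℚ (SInf →₀ ℚ) :=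
  (x.reverse.map fun p => uHat p.1 p.2).prod

/-- The set `R(ζ)` of `u`-reduced sequences of `ζ`: the sequences `(α_1, β_1), …, (α_n, β_n)`,
`α_i < β_i`, whose composition of operators sends the identity to `ζ`. -/
def reducedSeqs (ζ : SInf) : Set (List (ℕ × ℕ)) :=
  {x | (∀ p ∈ x, p.1 < p.2) ∧ uComp x (Finsupp.single 1 1) = Finsupp.single ζ 1}

/-- The sequence `x` weakly fits `p = (p_1, …, p_r)`: all `p_i ≥ 0`, their sum is the length of
`x`, and the `α`'s increase strictly in each of the consecutive blocks of sizes `p_1, …, p_r`. -/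
def WeaklyFits {r : ℕ} (p : Fin r → ℤ) (x : List (ℕ × ℕ)) : Prop :=
  (∀ i, 0 ≤ p i) ∧ ∑ i, p i = (x.length : ℤ) ∧
    ∀ (i : Fin r) (s t : Fin x.length), s < t →
      (∑ j ∈ Finset.univ.filter (· < i), p j) ≤ (s : ℤ) →
      (t : ℤ) < (∑ j ∈ Finset.univ.filter (· < i), p j) + p i →
      (x.get s).1 < (x.get t).1

/-- The set `H_p(ζ)` of `u`-reduced sequences of `ζ` that weakly fit `p`. -/
def fitSeqs {r : ℕ} (p : Fin r → ℤ) (ζ : SInf) : Set (List (ℕ × ℕ)) :=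
  {x | x ∈ reducedSeqs ζ ∧ WeaklyFits p x}

/-- The sequence `λ_σ`, with `λ_σ(i) = λ_{σ(i)} + i - σ(i)`. -/
def permuteParts {r : ℕ} (μ : YoungDiagram) (σ : Equiv.Perm (Fin r)) (i : Fin r) : ℤ :=
  (μ.rowLen (σ i) : ℤ) + ((i : ℕ) : ℤ) - ((σ i : ℕ) : ℤ)

end KBruhat

end

/-!
# Structure constants `c_λ^ζ` as alternating sums over `u`-reduced sequences

Write the Schubert polynomial of a Grassmannian permutation as a Jacobi-Trudi determinant
`det (h_{λ_i - i + j}(x_0, …, x_{k-1}))` and expand it over permutations `σ`. The summand of `σ` is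
`±∏ i, h_{λ_σ(i)}`, and multiplying `𝔖_u` by such a product with Pieri's formula, one factor after
the other, gives one term `𝔖_w` for each saturated chain from `u` to `w` in the `k`-Bruhat order
whose smaller labels `α` increase along each block of `λ_σ`. It remains to see that the chains
from `u` to `ζ u` have the same labels for all `u` and `k`: they are the `u`-reduced sequences of
`ζ`.

Schubert polynomials enter only through their divided differences
(`divDiff_schubert_of_lt`, `divDiff_schubert_of_gt`), which are available once
`schubertIn_eq_divDiff` allows any ascent instead of the first one. Since a polynomial killed by
all divided differences is constant, identities between homogeneous polynomials are proved by
induction on the length.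

* Monk's formula, in the form of a formula for `x_p 𝔖_u` (`X_mul_schubert`), is proved in this way;
  it also shows that the Schubert polynomials span, and they form a basis
  (`existsUnique_isSchubertExpansion`).
* For Pieri's formula (`hPoly_mul_schubert`), the recursion
  `h_{m+1}(x_0, …, x_p) = h_{m+1}(x_0, …, x_{p-1}) + x_p h_m(x_0, …, x_p)` is lifted to operators on
  formal combinations of permutations (`pieriOp_succ`). The lift rests on the commutation relation
  `raiseOp_mul_monkOpFrom`.
* The Jacobi-Trudi formula (`schubert_grassmannian`) comes from a determinant whose columns have
  different numbers of variables. It is the Schubert polynomial of a permutation whose inversions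
  all start in a marked set of positions and end outside of it (`schubert_eq_flagDet`). Column
  operations make the numbers of variables equal.
* The independence of `u` and `k` follows from the criterion `kLe_iff` of Bergeron and Sottile,
  which describes the `k`-Bruhat order without chains. It implies that a relation `η ⪯ ζ` is
  witnessed by every `u` and `k` with `u ≤_k ζ u` (`KLe.transfer`), hence that `η ↦ η u`
  identifies the saturated chains from `1` to `ζ` in the universal order with those from `u` to
  `ζ u` in the `k`-Bruhat order (`mem_reducedSeqs_iff_isKChain`).
-/

noncomputable section

namespace KBruhat

/-! ### Lengths and covers -/

theorem coe_mul_apply (u v : SInf) (i : ℕ) : (u * v).1 i = u.1 (v.1 i) := rfl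

theorem mul_transp_apply (u : SInf) (a b i : ℕ) :
    (u * transp a b).1 i = u.1 (Equiv.swap a b i) := rfl

theorem mul_transp_left (u : SInf) (a b : ℕ) : (u * transp a b).1 a = u.1 b := by
  rw [mul_transp_apply, Equiv.swap_apply_left]

theorem mul_transp_right (u : SInf) (a b : ℕ) : (u * transp a b).1 b = u.1 a := by
  rw [mul_transp_apply, Equiv.swap_apply_right]

theorem mul_transp_of_ne (u : SInf) {a b i : ℕ} (ha : i ≠ a) (hb : i ≠ b) :
    (u * transp a b).1 i = u.1 i := by
  rw [mul_transp_apply, Equiv.swap_apply_of_ne_of_ne ha hb]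

theorem transp_mul_self (a b : ℕ) : transp a b * transp a b = 1 :=
  Subtype.ext (Equiv.swap_mul_self a b)

theorem mul_transp_mul_transp (u : SInf) (a b : ℕ) : u * transp a b * transp a b = u := by
  rw [mul_assoc, transp_mul_self, mul_one]

/-- `u` fixes all numbers from `n` on, that is, it lies in the symmetric group on `n` letters. -/
def FixesFrom (n : ℕ) (u : SInf) : Prop := ∀ i, n ≤ i → u.1 i = i

theorem exists_fixesFrom (u : SInf) : ∃ n, FixesFrom n u := by
  obtain ⟨n, hn⟩ := (show {i | u.1 i ≠ i}.Finite from u.2).bddAbove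
  refine ⟨n + 1, fun i hi => ?_⟩
  by_contra h
  have := hn h
  omega

theorem FixesFrom.mono {m n : ℕ} {u : SInf} (h : FixesFrom m u) (hmn : m ≤ n) :
    FixesFrom n u := fun i hi => h i (hmn.trans hi)

theorem FixesFrom.lt {n : ℕ} {u : SInf} (h : FixesFrom n u) {i : ℕ} (hi : i < n) :
    u.1 i < n := by
  by_contra hc
  have := u.1.injective (h _ (not_lt.1 hc))
  omega

theorem FixesFrom.mul_transp {n a b : ℕ} {u : SInf} (h : FixesFrom n u) (ha : a < n)
    (hb : b < n) : FixesFrom n (u * transp a b) := fun i hi => by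
  rw [mul_transp_of_ne u (by omega) (by omega), h i hi]

/-- The set of inversions of `u`. -/
def invSet (u : SInf) : Set (ℕ × ℕ) := {p | p.1 < p.2 ∧ u.1 p.2 < u.1 p.1}

theorem invSet_finite (u : SInf) : (invSet u).Finite := by
  obtain ⟨n, hn⟩ := exists_fixesFrom u
  refine Set.Finite.subset ((Set.finite_lt_nat n).prod (Set.finite_lt_nat n)) ?_
  rintro ⟨a, b⟩ ⟨h1, h2⟩
  simp only [Set.mem_prod, Set.mem_ofPred_eq] at h1 h2 ⊢
  have hb : b < n := by
    by_contra hb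
    rw [hn b (by omega)] at h2
    by_cases ha : a < n
    · have := hn.lt ha; omega
    · rw [hn a (by omega)] at h2; omega
  exact ⟨by omega, hb⟩

theorem swap_lt_swap {i p q : ℕ} (h : p < q) (hne : ¬ (p = i ∧ q = i + 1)) :
    Equiv.swap i (i + 1) p < Equiv.swap i (i + 1) q := by
  simp only [Equiv.swap_apply_def]
  split_ifs <;> omega

theorem len_mul_simple_of_lt (u : SInf) (i : ℕ) (h : u.1 i < u.1 (i + 1)) :
    len (u * transp i (i + 1)) = len u + 1 := by
  have key : invSet (u * transp i (i + 1)) = insert (i, i + 1)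
      ((fun p : ℕ × ℕ => (Equiv.swap i (i + 1) p.1, Equiv.swap i (i + 1) p.2)) '' invSet u) := by
    ext ⟨p, q⟩
    simp only [invSet, Set.mem_ofPred_eq, mul_transp_apply, Set.mem_insert_iff, Prod.mk.injEq,
      Set.mem_image, Prod.exists]
    constructor
    · rintro ⟨h1, h2⟩
      by_cases hne : p = i ∧ q = i + 1
      · exact Or.inl hne
      · exact Or.inr ⟨_, _, ⟨swap_lt_swap h1 hne, h2⟩, by simp, by simp⟩
    · rintro (⟨rfl, rfl⟩ | ⟨p', q', ⟨h1, h2⟩, rfl, rfl⟩)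
      · simpa using h
      · refine ⟨swap_lt_swap h1 ?_, by simpa using h2⟩
        rintro ⟨rfl, rfl⟩
        omega
  change (invSet (u * transp i (i + 1))).ncard = (invSet u).ncard + 1
  rw [key, Set.ncard_insert_of_notMem _ ((invSet_finite u).image _), Set.ncard_image_of_injective]
  · rintro ⟨a, b⟩ ⟨c, d⟩ hpq
    simpa using hpq
  · simp only [invSet, Set.mem_image, Set.mem_ofPred_eq, Prod.exists, Prod.mk.injEq, not_exists,
      not_and]
    rintro p q ⟨h1, h2⟩ h3 h4
    rw [Equiv.swap_apply_eq_iff, Equiv.swap_apply_left] at h3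
    rw [Equiv.swap_apply_eq_iff, Equiv.swap_apply_right] at h4
    omega

theorem len_mul_simple_of_gt (u : SInf) (i : ℕ) (h : u.1 (i + 1) < u.1 i) :
    len (u * transp i (i + 1)) + 1 = len u := by
  have := len_mul_simple_of_lt (u * transp i (i + 1)) i
    (by rwa [mul_transp_left, mul_transp_right])
  rw [mul_transp_mul_transp] at this
  exact this.symm

theorem transp_conj (u : SInf) {a b : ℕ} (hab : a + 1 < b) :
    u * transp a b = u * transp a (a + 1) * transp (a + 1) b * transp a (a + 1) := by
  apply Subtype.ext
  ext i
  simp only [coe_mul_apply, transp, Equiv.swap_apply_def]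
  congr 1
  split_ifs <;> omega

/-- The positions strictly between `a` and `b` whose values lie strictly between
those at `a` and `b`. -/
def between (u : SInf) (a b : ℕ) : Finset ℕ :=
  (Finset.Ioo a b).filter fun i => u.1 a < u.1 i ∧ u.1 i < u.1 b

theorem len_mul_transp (u : SInf) (a b : ℕ) (hab : a < b) (h : u.1 a < u.1 b) :
    len (u * transp a b) = len u + 1 + 2 * (between u a b).card := by
  obtain ⟨d, rfl⟩ : ∃ d, b = a + 1 + d := ⟨b - (a + 1), by omega⟩
  induction d generalizing a u with
  | zero => simp [between, len_mul_simple_of_lt u a h]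
  | succ d ih =>
    have e1 : a + 1 + (d + 1) = (a + 1) + 1 + d := by omega
    set b := a + 1 + (d + 1) with hb
    set u1 := u * transp a (a + 1) with hu1
    have v1 : u1.1 (a + 1) = u.1 a := mul_transp_right _ _ _
    have v0 : u1.1 a = u.1 (a + 1) := mul_transp_left _ _ _
    have vi : ∀ i, a + 1 < i → u1.1 i = u.1 i := fun i hi =>
      mul_transp_of_ne u (by omega) (by omega)
    set u2 := u1 * transp (a + 1) b with hu2
    have w1 : u2.1 (a + 1) = u.1 b := by rw [hu2, mul_transp_left, vi b (by omega)]
    have w0 : u2.1 a = u.1 (a + 1) := by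
      rw [hu2, mul_transp_of_ne _ (by omega) (by omega), v0]
    have ih' := ih u1 (a + 1) (by omega) (by rw [v1, ← e1, vi b (by omega)]; exact h)
    rw [← e1, ← hu2] at ih'
    rw [transp_conj u (show a + 1 < b by omega), ← hu1, ← hu2]
    have hI : Finset.Ioo a b = insert (a + 1) (Finset.Ioo (a + 1) b) := by
      ext i; simp only [Finset.mem_Ioo, Finset.mem_insert]; omega
    have hcard : (between u a b).card = (between u1 (a + 1) b).card +
        if u.1 a < u.1 (a + 1) ∧ u.1 (a + 1) < u.1 b then 1 else 0 := by
      have hf : (Finset.Ioo (a + 1) b).filter (fun i => u.1 a < u.1 i ∧ u.1 i < u.1 b) =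
          between u1 (a + 1) b := by
        refine Finset.filter_congr fun i hi => ?_
        rw [Finset.mem_Ioo] at hi
        rw [v1, vi i hi.1, vi b (by omega)]
      rw [between, hI, Finset.filter_insert, ← hf]
      split_ifs
      · rw [Finset.card_insert_of_notMem (by simp)]
      · rfl
    have ne1 : u.1 a ≠ u.1 (a + 1) := fun e => by have := u.1.injective e; omega
    have ne2 : u.1 b ≠ u.1 (a + 1) := fun e => by have := u.1.injective e; omega
    have s1 := len_mul_simple_of_lt u a
    have s2 := len_mul_simple_of_gt u a
    have s3 := len_mul_simple_of_lt u2 a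
    have s4 := len_mul_simple_of_gt u2 a
    rw [← hu1] at s1 s2
    rw [w0, w1] at s3 s4
    split_ifs at hcard <;> omega

/-- Interchanging the values at the positions `a < b` of `u` increases the length by one. -/
def IsCover (u : SInf) (a b : ℕ) : Prop :=
  a < b ∧ u.1 a < u.1 b ∧ ∀ i, a < i → i < b → u.1 a < u.1 i → u.1 b < u.1 i

theorem isCover_iff_len (u : SInf) {a b : ℕ} (hab : a < b) :
    IsCover u a b ↔ len (u * transp a b) = len u + 1 := by
  rcases lt_or_ge (u.1 a) (u.1 b) with h | h
  · rw [len_mul_transp u a b hab h, Nat.add_eq_left, mul_eq_zero, or_iff_right (by norm_num),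
      Finset.card_eq_zero, between, Finset.filter_eq_empty_iff]
    simp only [Finset.mem_Ioo, not_and, not_lt, and_imp, IsCover, hab, h, true_and]
    refine forall_congr' fun i => forall_congr' fun h1 => forall_congr' fun h2 =>
      forall_congr' fun h3 => ?_
    have : u.1 b ≠ u.1 i := fun e => by have := u.1.injective e; omega
    omega
  · have hne : u.1 a ≠ u.1 b := fun e => by have := u.1.injective e; omega
    have := len_mul_transp (u * transp a b) a b hab
      (by rw [mul_transp_left, mul_transp_right]; omega)
    rw [mul_transp_mul_transp] at this
    refine ⟨fun hc => ?_, fun hc => ?_⟩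
    · have := hc.2.1; omega
    · omega

theorem KCover_iff {k : ℕ} {u w : SInf} :
    KCover k u w ↔ ∃ a b, a < k ∧ k ≤ b ∧ IsCover u a b ∧ w = u * transp a b := by
  constructor
  · rintro ⟨a, b, ha, hb, rfl, hl⟩
    exact ⟨a, b, ha, hb, (isCover_iff_len u (by omega)).2 hl, rfl⟩
  · rintro ⟨a, b, ha, hb, hc, rfl⟩
    exact ⟨a, b, ha, hb, rfl, (isCover_iff_len u (by omega)).1 hc⟩

theorem transp_mul (α β : ℕ) (u : SInf) :
    transp α β * u = u * transp (u.1.symm α) (u.1.symm β) := by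
  apply Subtype.ext
  change Equiv.swap α β * u.1 = u.1 * Equiv.swap (u.1.symm α) (u.1.symm β)
  rw [Equiv.mul_swap_eq_swap_mul]
  simp

theorem transp_apply_mul (a b : ℕ) (u : SInf) :
    transp (u.1 a) (u.1 b) * u = u * transp a b := by
  rw [transp_mul]; simp

theorem len_one : len 1 = 0 := by
  have : {p : ℕ × ℕ | p.1 < p.2 ∧ (1 : SInf).1 p.2 < (1 : SInf).1 p.1} = ∅ := by
    ext ⟨a, b⟩
    simp only [OneMemClass.coe_one, Equiv.Perm.one_apply, Set.mem_ofPred_eq,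
      Set.mem_empty_iff_false, iff_false]
    omega
  rw [len, this, Set.ncard_empty]

/-- A permutation without descents is the identity. -/
theorem eq_one_of_forall_lt {u : SInf} (h : ∀ i, u.1 i < u.1 (i + 1)) : u = 1 := by
  have hm : StrictMono u.1 := strictMono_nat_of_lt_succ h
  obtain ⟨n, hn⟩ := exists_fixesFrom u
  refine Subtype.ext (Equiv.ext fun i => ?_)
  change u.1 i = i
  refine le_antisymm ?_ (hm.id_le i)
  by_contra hc
  have hgap : ∀ d, i + d < u.1 (i + d) := by
    intro d
    induction d with
    | zero => simpa using hc
    | succ d ih => have := h (i + d); rw [← add_assoc]; omega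
  have := hgap n
  rw [hn (i + n) (by omega)] at this
  omega

theorem exists_descent {u : SInf} (h : u ≠ 1) : ∃ i, u.1 (i + 1) < u.1 i := by
  by_contra! hc
  refine h (eq_one_of_forall_lt fun i => lt_of_le_of_ne (hc i) fun e => ?_)
  have := u.1.injective e
  omega

open MvPolynomial

/-! ### Divided differences -/

theorem dividedDifference_spec (i : ℕ) (f : MvPolynomial ℕ ℤ) :
    (X i - X (i + 1)) * dividedDifference i f = f - swapVars i f :=
  (exists_dividedDifference i f).choose_spec

theorem X_sub_X_ne_zero {i j : ℕ} (h : i ≠ j) : (X i - X j : MvPolynomial ℕ ℤ) ≠ 0 :=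
  sub_ne_zero.2 fun e => h (X_injective e)

theorem dividedDifference_eq_of_mul {i : ℕ} {f g : MvPolynomial ℕ ℤ}
    (h : (X i - X (i + 1)) * g = f - swapVars i f) : dividedDifference i f = g :=
  mul_left_cancel₀ (X_sub_X_ne_zero (by omega : i ≠ i + 1))
    ((dividedDifference_spec i f).trans h.symm)

theorem swapVars_add (i : ℕ) (f g : MvPolynomial ℕ ℤ) :
    swapVars i (f + g) = swapVars i f + swapVars i g := map_add _ _ _

theorem swapVars_sub (i : ℕ) (f g : MvPolynomial ℕ ℤ) :
    swapVars i (f - g) = swapVars i f - swapVars i g := map_sub _ _ _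

theorem swapVars_mul (i : ℕ) (f g : MvPolynomial ℕ ℤ) :
    swapVars i (f * g) = swapVars i f * swapVars i g := map_mul _ _ _

theorem swapVars_X (i j : ℕ) : swapVars i (X j) = X (Equiv.swap i (i + 1) j) := rename_X _ _

theorem swapVars_X_left (i : ℕ) : swapVars i (X i) = X (i + 1) := by
  rw [swapVars_X, Equiv.swap_apply_left]

theorem swapVars_X_right (i : ℕ) : swapVars i (X (i + 1)) = X i := by
  rw [swapVars_X, Equiv.swap_apply_right]

theorem swapVars_X_of_ne {i j : ℕ} (h1 : j ≠ i) (h2 : j ≠ i + 1) : swapVars i (X j) = X j := by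
  rw [swapVars_X, Equiv.swap_apply_of_ne_of_ne h1 h2]

theorem swapVars_swapVars (i : ℕ) (f : MvPolynomial ℕ ℤ) : swapVars i (swapVars i f) = f := by
  simp only [swapVars, rename_rename]
  rw [show ((Equiv.swap i (i + 1) : ℕ → ℕ) ∘ Equiv.swap i (i + 1)) = id by ext; simp, rename_id,
    AlgHom.id_apply]

theorem swapVars_comm {i j : ℕ} (h : i + 1 < j) (f : MvPolynomial ℕ ℤ) :
    swapVars i (swapVars j f) = swapVars j (swapVars i f) := by
  simp only [swapVars, rename_rename]
  congr 2
  ext n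
  simp only [Function.comp_apply, Equiv.swap_apply_def]
  split_ifs <;> omega

theorem swapVars_braid (i : ℕ) (f : MvPolynomial ℕ ℤ) :
    swapVars i (swapVars (i + 1) (swapVars i f)) =
      swapVars (i + 1) (swapVars i (swapVars (i + 1) f)) := by
  simp only [swapVars, rename_rename]
  congr 2
  ext n
  simp only [Function.comp_apply, Equiv.swap_apply_def]
  split_ifs <;> omega

theorem dividedDifference_eq_zero_iff {i : ℕ} {f : MvPolynomial ℕ ℤ} :
    dividedDifference i f = 0 ↔ swapVars i f = f := by
  constructor
  · intro h
    have := dividedDifference_spec i f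
    rw [h, mul_zero] at this
    exact (sub_eq_zero.1 this.symm).symm
  · intro h
    exact dividedDifference_eq_of_mul (by rw [h, mul_zero, sub_self])

/-- The divided difference as a linear map. -/
def divDiff (i : ℕ) : MvPolynomial ℕ ℤ →ₗ[ℤ] MvPolynomial ℕ ℤ :=
  AddMonoidHom.toIntLinearMap
    { toFun := dividedDifference i
      map_zero' := dividedDifference_eq_of_mul (by simp [swapVars])
      map_add' := fun f g => dividedDifference_eq_of_mul (by
        rw [mul_add, dividedDifference_spec, dividedDifference_spec, swapVars_add]; ring) }

theorem divDiff_spec (i : ℕ) (f : MvPolynomial ℕ ℤ) :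
    (X i - X (i + 1)) * divDiff i f = f - swapVars i f := dividedDifference_spec i f

theorem divDiff_eq_of_mul {i : ℕ} {f g : MvPolynomial ℕ ℤ}
    (h : (X i - X (i + 1)) * g = f - swapVars i f) : divDiff i f = g :=
  dividedDifference_eq_of_mul h

theorem divDiff_eq_zero_iff {i : ℕ} {f : MvPolynomial ℕ ℤ} :
    divDiff i f = 0 ↔ swapVars i f = f := dividedDifference_eq_zero_iff

theorem divDiff_mul (i : ℕ) (f g : MvPolynomial ℕ ℤ) :
    divDiff i (f * g) = divDiff i f * g + swapVars i f * divDiff i g := by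
  refine divDiff_eq_of_mul ?_
  rw [swapVars_mul]
  linear_combination g * divDiff_spec i f + swapVars i f * divDiff_spec i g

theorem divDiff_X_left (i : ℕ) : divDiff i (X i) = 1 :=
  divDiff_eq_of_mul (by rw [swapVars_X_left, mul_one])

theorem divDiff_X_right (i : ℕ) : divDiff i (X (i + 1)) = -1 :=
  divDiff_eq_of_mul (by rw [swapVars_X_right]; ring)

theorem divDiff_X_of_ne {i j : ℕ} (h1 : j ≠ i) (h2 : j ≠ i + 1) : divDiff i (X j) = 0 :=
  divDiff_eq_zero_iff.2 (swapVars_X_of_ne h1 h2)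

theorem divDiff_divDiff_self (i : ℕ) (f : MvPolynomial ℕ ℤ) : divDiff i (divDiff i f) = 0 := by
  rw [divDiff_eq_zero_iff]
  have h := congrArg (swapVars i) (divDiff_spec i f)
  rw [swapVars_mul, swapVars_sub, swapVars_sub, swapVars_swapVars, swapVars_X_left,
    swapVars_X_right] at h
  refine mul_left_cancel₀ (X_sub_X_ne_zero (by omega : i ≠ i + 1)) ?_
  linear_combination -h - divDiff_spec i f

theorem divDiff_comm_of_lt {i j : ℕ} (h : i + 1 < j) (f : MvPolynomial ℕ ℤ) :
    divDiff i (divDiff j f) = divDiff j (divDiff i f) := by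
  refine mul_left_cancel₀ (X_sub_X_ne_zero (by omega : i ≠ i + 1))
    (mul_left_cancel₀ (X_sub_X_ne_zero (by omega : j ≠ j + 1)) ?_)
  have h1 := congrArg (swapVars i) (divDiff_spec j f)
  have h2 := congrArg (swapVars j) (divDiff_spec i f)
  rw [swapVars_mul, swapVars_sub, swapVars_sub, swapVars_X_of_ne (by omega) (by omega),
    swapVars_X_of_ne (by omega) (by omega)] at h1 h2
  rw [swapVars_comm h] at h1
  linear_combination (X j - X (j + 1)) * divDiff_spec i (divDiff j f)
    - (X i - X (i + 1)) * divDiff_spec j (divDiff i f) - h1 + h2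
    + divDiff_spec j f - divDiff_spec i f

theorem divDiff_comm {i j : ℕ} (h : i + 1 < j ∨ j + 1 < i) (f : MvPolynomial ℕ ℤ) :
    divDiff i (divDiff j f) = divDiff j (divDiff i f) := by
  rcases h with h | h
  · exact divDiff_comm_of_lt h f
  · exact (divDiff_comm_of_lt h f).symm

theorem divDiff_braid (i : ℕ) (f : MvPolynomial ℕ ℤ) :
    divDiff i (divDiff (i + 1) (divDiff i f)) =
      divDiff (i + 1) (divDiff i (divDiff (i + 1) f)) := by
  refine mul_left_cancel₀ (X_sub_X_ne_zero (by omega : i ≠ i + 1))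
    (mul_left_cancel₀ (X_sub_X_ne_zero (by omega : i ≠ i + 2))
      (mul_left_cancel₀ (X_sub_X_ne_zero (by omega : i + 1 ≠ i + 2)) ?_))
  have sp := divDiff_spec i
  have tp : ∀ g, (X (i + 1) - X (i + 2)) * divDiff (i + 1) g = g - swapVars (i + 1) g :=
    divDiff_spec (i + 1)
  have ss : ∀ {g h c d : MvPolynomial ℕ ℤ}, (c - d) * g = h - swapVars (i + 1) h →
      (swapVars i c - swapVars i d) * swapVars i g =
        swapVars i h - swapVars i (swapVars (i + 1) h) := fun e => by
    rw [← swapVars_sub, ← swapVars_mul, e, swapVars_sub]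
  have st : ∀ {g h c d : MvPolynomial ℕ ℤ}, (c - d) * g = h - swapVars i h →
      (swapVars (i + 1) c - swapVars (i + 1) d) * swapVars (i + 1) g =
        swapVars (i + 1) h - swapVars (i + 1) (swapVars i h) := fun e => by
    rw [← swapVars_sub, ← swapVars_mul, e, swapVars_sub]
  have x2 : swapVars i (X (i + 2)) = X (i + 2) := swapVars_X_of_ne (by omega) (by omega)
  have y0 : swapVars (i + 1) (X i) = X i := swapVars_X_of_ne (by omega) (by omega)
  have y1 : swapVars (i + 1) (X (i + 1)) = X (i + 2) := swapVars_X_left (i + 1)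
  have fixs : swapVars i (divDiff i f) = divDiff i f :=
    divDiff_eq_zero_iff.1 (divDiff_divDiff_self i f)
  have fixt : swapVars (i + 1) (divDiff (i + 1) f) = divDiff (i + 1) f :=
    divDiff_eq_zero_iff.1 (divDiff_divDiff_self (i + 1) f)
  have a1 := sp (divDiff (i + 1) (divDiff i f))
  have a2 := tp (divDiff i f)
  have a3 := ss a2
  have a4 := sp f
  have a5 := st a4
  have a6 := congrArg (swapVars i) a5
  rw [swapVars_mul, swapVars_sub, swapVars_sub] at a6
  have b1 := tp (divDiff i (divDiff (i + 1) f))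
  have b2 := sp (divDiff (i + 1) f)
  have b3 := st b2
  have b4 := tp f
  have b5 := ss b4
  have b6 := congrArg (swapVars (i + 1)) b5
  rw [swapVars_mul, swapVars_sub, swapVars_sub] at b6
  have br := swapVars_braid i f
  simp only [swapVars_X_left, swapVars_X_right, x2, y0, y1, fixs, fixt] at a3 a5 a6 b3 b5 b6
  linear_combination (X i - X (i + 2)) * (X (i + 1) - X (i + 2)) * a1
    + (X i - X (i + 2)) * a2 - (X (i + 1) - X (i + 2)) * a3 + a4 - a5 + a6
    - ((X i - X (i + 1)) * (X i - X (i + 2)) * b1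
    + (X i - X (i + 2)) * b2 - (X i - X (i + 1)) * b3 + b4 - b5 + b6) - br

/-- A polynomial killed by all divided differences is symmetric in infinitely many variables,
hence constant. -/
theorem eq_C_of_divDiff_eq_zero {f : MvPolynomial ℕ ℤ} (h : ∀ i, divDiff i f = 0) :
    f = C (constantCoeff f) := by
  have hv : f.vars = ∅ := by
    by_contra hne
    obtain ⟨m, hm, hmax⟩ := f.vars.exists_max_image id (Finset.nonempty_iff_ne_empty.2 hne)
    have hs := divDiff_eq_zero_iff.1 (h m)
    have : m + 1 ∈ f.vars := by
      obtain ⟨j, hj, hjm⟩ := mem_vars_rename (Equiv.swap m (m + 1)) f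
        (show m ∈ (rename (Equiv.swap m (m + 1)) f).vars from (congrArg vars hs).symm ▸ hm)
      rw [Equiv.swap_apply_eq_iff, Equiv.swap_apply_left] at hjm
      exact hjm ▸ hj
    have := hmax _ this
    simp at this
  exact vars_eq_empty_iff_eq_C.1 hv

theorem eq_of_divDiff_eq {f g : MvPolynomial ℕ ℤ} (h : ∀ i, divDiff i f = divDiff i g)
    (h0 : constantCoeff f = constantCoeff g) : f = g := by
  have := eq_C_of_divDiff_eq_zero (f := f - g) fun i => by rw [map_sub, h i, sub_self]
  rw [map_sub, h0, sub_self, map_zero] at this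
  exact sub_eq_zero.1 this

theorem isHomogeneous_divDiff {i d : ℕ} {f : MvPolynomial ℕ ℤ} (hf : f.IsHomogeneous (d + 1)) :
    (divDiff i f).IsHomogeneous d := by
  set g := divDiff i f with hg
  have hL : (X i - X (i + 1) : MvPolynomial ℕ ℤ).IsHomogeneous 1 :=
    (isHomogeneous_X ℤ i).sub (isHomogeneous_X ℤ (i + 1))
  have hR : (f - swapVars i f).IsHomogeneous (d + 1) := hf.sub hf.rename_isHomogeneous
  have key : ∀ e, e ≠ d → homogeneousComponent e g = 0 := by
    intro e he
    have h1 : homogeneousComponent (e + 1) ((X i - X (i + 1)) * g) = 0 := by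
      rw [hg, divDiff_spec, homogeneousComponent_of_mem hR, if_neg (by omega)]
    have h2 : homogeneousComponent (e + 1) ((X i - X (i + 1)) * g) =
        (X i - X (i + 1)) * homogeneousComponent e g := by
      conv_lhs => rw [← sum_homogeneousComponent g, Finset.mul_sum, map_sum]
      have : ∀ j ∈ Finset.range (g.totalDegree + 1), homogeneousComponent (e + 1)
          ((X i - X (i + 1)) * homogeneousComponent j g) =
          if j = e then (X i - X (i + 1)) * homogeneousComponent e g else 0 := by
        intro j _
        have hj := hL.mul (homogeneousComponent_isHomogeneous j g)
        rw [homogeneousComponent_of_mem hj]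
        by_cases hje : j = e
        · subst hje; rw [if_pos (by omega), if_pos rfl]
        · rw [if_neg (by omega), if_neg hje]
      rw [Finset.sum_congr rfl this, Finset.sum_ite_eq']
      split_ifs with hmem
      · rfl
      · rw [homogeneousComponent_eq_zero, mul_zero]
        simpa using hmem
    rw [h2] at h1
    exact (mul_eq_zero.1 h1).resolve_left (X_sub_X_ne_zero (by omega))
  rw [← sum_homogeneousComponent g]
  refine IsHomogeneous.sum _ _ _ fun j _ => ?_
  by_cases hj : j = d
  · subst hj; exact homogeneousComponent_isHomogeneous j g
  · rw [key j hj]; exact isHomogeneous_zero _ _ _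

/-! ### Schubert polynomials -/

theorem mul_swap_apply_left (w : Equiv.Perm ℕ) (a b : ℕ) : (w * Equiv.swap a b) a = w b := by
  rw [Equiv.Perm.mul_apply, Equiv.swap_apply_left]

theorem mul_swap_apply_right (w : Equiv.Perm ℕ) (a b : ℕ) : (w * Equiv.swap a b) b = w a := by
  rw [Equiv.Perm.mul_apply, Equiv.swap_apply_right]

theorem mul_swap_apply_of_ne (w : Equiv.Perm ℕ) {a b i : ℕ} (h1 : i ≠ a) (h2 : i ≠ b) :
    (w * Equiv.swap a b) i = w i := by
  rw [Equiv.Perm.mul_apply, Equiv.swap_apply_of_ne_of_ne h1 h2]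

theorem swap_braid (p : ℕ) :
    Equiv.swap p (p + 1) * (Equiv.swap (p + 1) (p + 1 + 1) * Equiv.swap p (p + 1)) =
      Equiv.swap (p + 1) (p + 1 + 1) * (Equiv.swap p (p + 1) *
        Equiv.swap (p + 1) (p + 1 + 1)) := by
  ext q
  simp only [Equiv.Perm.mul_apply, Equiv.swap_apply_def]
  split_ifs <;> omega

theorem swap_comm_of_lt {f i : ℕ} (h : f + 1 < i) :
    Equiv.swap f (f + 1) * Equiv.swap i (i + 1) =
      Equiv.swap i (i + 1) * Equiv.swap f (f + 1) := by
  ext q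
  simp only [Equiv.Perm.mul_apply, Equiv.swap_apply_def]
  split_ifs <;> omega

theorem firstAscent_spec {n : ℕ} {w : Equiv.Perm ℕ} {i : ℕ} (hi : i + 1 < n)
    (h : w i < w (i + 1)) :
    firstAscent n w + 1 < n ∧ w (firstAscent n w) < w (firstAscent n w + 1) :=
  Nat.sInf_mem (s := {i | i + 1 < n ∧ w i < w (i + 1)}) ⟨i, hi, h⟩

theorem schubertIn_of_forall_gt {n : ℕ} {w : Equiv.Perm ℕ}
    (h : ∀ i, i + 1 < n → ¬ w i < w (i + 1)) :
    schubertIn n w = ∏ i ∈ Finset.range n, X i ^ (n - 1 - i) := by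
  rw [schubertIn, dif_neg]
  rintro ⟨h1, h2⟩
  exact h _ h1 h2

/-- The first ascent in the definition of `schubertIn` can be replaced by any other ascent: two
ascents at distance at least two commute, and adjacent ones are handled by the braid relation. -/
theorem schubertIn_eq_divDiff {n : ℕ} {w : Equiv.Perm ℕ} {i : ℕ} (hi : i + 1 < n)
    (h : w i < w (i + 1)) :
    schubertIn n w = divDiff i (schubertIn n (w * Equiv.swap i (i + 1))) := by
  induction hN : (noninversions n w).card using Nat.strong_induction_on generalizing w i with
  | _ N ih =>
  subst hN
  have step : ∀ (w' : Equiv.Perm ℕ) (j l : ℕ),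
      (noninversions n w').card < (noninversions n w).card → j + 1 < n → w' j < w' (j + 1) → j = l →
      schubertIn n w' = divDiff l (schubertIn n (w' * Equiv.swap l (l + 1))) := by
    rintro w' j _ hw' hj hlt rfl
    exact ih _ hw' hj hlt rfl
  obtain ⟨hf1, hf2⟩ := firstAscent_spec hi h
  have hdef : schubertIn n w = divDiff (firstAscent n w)
      (schubertIn n (w * Equiv.swap (firstAscent n w) (firstAscent n w + 1))) := by
    conv_lhs => rw [schubertIn, dif_pos ⟨hf1, hf2⟩]
    rfl
  rw [hdef]
  generalize firstAscent n w = f at hf1 hf2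
  have ci := card_noninversions_lt n w i hi h
  have cf := card_noninversions_lt n w f hf1 hf2
  have braid : ∀ p, p + 2 < n → w p < w (p + 1) → w (p + 1) < w (p + 2) →
      divDiff p (schubertIn n (w * Equiv.swap p (p + 1))) =
      divDiff (p + 1) (schubertIn n (w * Equiv.swap (p + 1) (p + 1 + 1))) := by
    intro p hp h1 h2
    have c1 := card_noninversions_lt n w p (by omega) h1
    have c2 := card_noninversions_lt n w (p + 1) (by omega) h2
    set w1 := w * Equiv.swap p (p + 1) with hw1
    set w2 := w * Equiv.swap (p + 1) (p + 1 + 1) with hw2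
    have a0 : w1 p = w (p + 1) := mul_swap_apply_left _ _ _
    have a1 : w1 (p + 1) = w p := mul_swap_apply_right _ _ _
    have a2 : w1 (p + 2) = w (p + 2) := mul_swap_apply_of_ne _ (by omega) (by omega)
    have b0 : w2 p = w p := mul_swap_apply_of_ne _ (by omega) (by omega)
    have b1 : w2 (p + 1) = w (p + 2) := mul_swap_apply_left _ _ _
    have b2 : w2 (p + 2) = w (p + 1) := mul_swap_apply_right _ _ _
    have e1 : w1 (p + 1) < w1 (p + 1 + 1) := by rw [a1, a2]; omega
    have e2 : w2 p < w2 (p + 1) := by rw [b0, b1]; omega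
    have d1 := card_noninversions_lt n w1 (p + 1) (by omega) e1
    have d2 := card_noninversions_lt n w2 p (by omega) e2
    rw [step w1 (p + 1) _ c1 (by omega) e1 rfl, step w2 p _ c2 (by omega) e2 rfl]
    set w3 := w1 * Equiv.swap (p + 1) (p + 1 + 1) with hw3
    set w4 := w2 * Equiv.swap p (p + 1) with hw4
    have f1 : w3 p < w3 (p + 1) := by
      have g0 : w3 p = w1 p := mul_swap_apply_of_ne w1 (by omega) (by omega)
      have g1 : w3 (p + 1) = w1 (p + 2) := mul_swap_apply_left w1 _ _
      omega
    have f2 : w4 (p + 1) < w4 (p + 1 + 1) := by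
      have g1 : w4 (p + 1) = w2 p := mul_swap_apply_right w2 _ _
      have g2 : w4 (p + 2) = w2 (p + 2) := mul_swap_apply_of_ne w2 (by omega) (by omega)
      change w4 (p + 1) < w4 (p + 2)
      omega
    rw [step w3 p _ (by omega) (by omega) f1 rfl, step w4 (p + 1) _ (by omega) (by omega) f2 rfl,
      divDiff_braid]
    rw [hw3, hw4, hw1, hw2]
    simp only [mul_assoc]
    rw [swap_braid]
  rcases lt_trichotomy f i with hlt | rfl | hlt
  · rcases Nat.lt_or_ge (f + 1) i with hfar | hnear
    · rw [step (w * Equiv.swap f (f + 1)) i i cf hi (by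
          rw [mul_swap_apply_of_ne _ (by omega) (by omega),
            mul_swap_apply_of_ne _ (by omega) (by omega)]; exact h) rfl,
        step (w * Equiv.swap i (i + 1)) f f ci hf1 (by
          rw [mul_swap_apply_of_ne _ (by omega) (by omega),
            mul_swap_apply_of_ne _ (by omega) (by omega)]; exact hf2) rfl,
        divDiff_comm (Or.inl hfar)]
      rw [mul_assoc, mul_assoc, swap_comm_of_lt (by omega)]
    · obtain rfl : i = f + 1 := by omega
      exact braid f (by omega) hf2 h
  · rfl
  · rcases Nat.lt_or_ge (i + 1) f with hfar | hnear
    · rw [step (w * Equiv.swap f (f + 1)) i i cf hi (by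
          rw [mul_swap_apply_of_ne _ (by omega) (by omega),
            mul_swap_apply_of_ne _ (by omega) (by omega)]; exact h) rfl,
        step (w * Equiv.swap i (i + 1)) f f ci hf1 (by
          rw [mul_swap_apply_of_ne _ (by omega) (by omega),
            mul_swap_apply_of_ne _ (by omega) (by omega)]; exact hf2) rfl,
        divDiff_comm (Or.inr hfar)]
      rw [mul_assoc, mul_assoc, ← swap_comm_of_lt (by omega)]
    · obtain rfl : f = i + 1 := by omega
      exact (braid i (by omega) h hf2).symm

theorem swapVars_prod_X_pow {j m : ℕ} (hj : j + 1 < m) (e : ℕ → ℕ) (he : e j = e (j + 1)) :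
    swapVars j (∏ i ∈ Finset.range m, (X i : MvPolynomial ℕ ℤ) ^ e i) =
      ∏ i ∈ Finset.range m, X i ^ e i := by
  simp only [swapVars, map_prod, map_pow, rename_X]
  refine Finset.prod_equiv (Equiv.swap j (j + 1)) ?_ ?_
  · intro i
    simp only [Finset.mem_range, Equiv.swap_apply_def]
    split_ifs <;> omega
  · intro i _
    congr 1
    simp only [Equiv.swap_apply_def]
    split_ifs with h1 h2
    · rw [h1, he]
    · rw [h2, he]
    · rfl

/-- The step from `n` to `n + 1` letters for the longest permutation: while the value `n` moves
from the first position to the last one, the staircase monomial loses one variable after the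
other. -/
theorem schubertIn_succ_staircase {n : ℕ} : ∀ j ≤ n, ∀ w : Equiv.Perm ℕ,
    (∀ i < j, w i = n - 1 - i) → w j = n → (∀ i, j < i → i ≤ n → w i = n - i) →
    schubertIn (n + 1) w =
      ∏ i ∈ Finset.range (n + 1), X i ^ (if i < j then n - 1 - i else n - i) := by
  intro j
  induction j with
  | zero =>
    intro _ w _ h0 hgt
    have h0' : ∀ i, i ≤ n → w i = n - i := by
      intro i hi
      rcases Nat.eq_zero_or_pos i with rfl | hpos
      · simpa using h0
      · exact hgt i hpos hi
    rw [schubertIn_of_forall_gt]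
    · exact Finset.prod_congr rfl fun i _ => by simp
    · intro i hi
      rw [h0' i (by omega), h0' (i + 1) (by omega)]
      omega
  | succ j ih =>
    intro hj w hlt h0 hgt
    have hwj := hlt j (by omega)
    rw [schubertIn_eq_divDiff (i := j) (by omega) (by rw [hwj, h0]; omega)]
    rw [ih (by omega) (w * Equiv.swap j (j + 1))]
    · set e : ℕ → ℕ := fun i => if i < j + 1 then n - 1 - i else n - i with he
      have hsplit : (∏ i ∈ Finset.range (n + 1), (X i : MvPolynomial ℕ ℤ) ^
          (if i < j then n - 1 - i else n - i)) =
          X j * ∏ i ∈ Finset.range (n + 1), X i ^ e i := by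
        have hjm : j ∈ Finset.range (n + 1) := Finset.mem_range.2 (by omega)
        rw [← Finset.mul_prod_erase _ _ hjm, ← Finset.mul_prod_erase _ (fun i => X i ^ e i) hjm,
          ← mul_assoc, ← pow_succ']
        congr 1
        · simp only [he, lt_irrefl, if_false, Nat.lt_succ_self, if_true]
          congr 1
          omega
        · refine Finset.prod_congr rfl fun i hi => ?_
          have := Finset.ne_of_mem_erase hi
          congr 1
          simp only [he]
          split_ifs <;> omega
      have hsym := swapVars_prod_X_pow (m := n + 1) (j := j) (by omega) e
        (by simp only [he]; split_ifs <;> omega)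
      rw [hsplit, divDiff_mul, divDiff_X_left, one_mul, divDiff_eq_zero_iff.2 hsym, mul_zero,
        add_zero]
    · intro i hi
      rw [mul_swap_apply_of_ne _ (by omega) (by omega), hlt i (by omega)]
    · rw [mul_swap_apply_left, h0]
    · intro i h1 h2
      by_cases hi : i = j + 1
      · subst hi; rw [mul_swap_apply_right, hwj]; omega
      · rw [mul_swap_apply_of_ne _ (by omega) hi, hgt i (by omega) h2]

/-- A permutation of the first `n` numbers without ascents is the reversal. -/
theorem apply_eq_of_no_ascent {n : ℕ} {w : SInf} (hn : FixesFrom n w)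
    (h : ∀ i, i + 1 < n → ¬ w.1 i < w.1 (i + 1)) : ∀ i < n, w.1 i = n - 1 - i := by
  have hstep : ∀ i, i + 1 < n → w.1 (i + 1) < w.1 i := fun i hi => by
    have h1 := h i hi
    have h2 : w.1 i ≠ w.1 (i + 1) := fun e => by have := w.1.injective e; omega
    omega
  have hup : ∀ i < n, w.1 i + i ≤ n - 1 := by
    intro i
    induction i with
    | zero => intro hi; have := hn.lt hi; omega
    | succ i ih => intro hi; have := ih (by omega); have := hstep i hi; omega
  have hlow : ∀ d < n, d ≤ w.1 (n - 1 - d) := by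
    intro d
    induction d with
    | zero => intro _; omega
    | succ d ih =>
      intro hd
      have h1 := ih (by omega)
      have h2 := hstep (n - 1 - (d + 1)) (by omega)
      rw [show n - 1 - (d + 1) + 1 = n - 1 - d by omega] at h2
      omega
  intro i hi
  have h1 := hup i hi
  have h2 := hlow (n - 1 - i) (by omega)
  rw [show n - 1 - (n - 1 - i) = i by omega] at h2
  omega

theorem schubertIn_succ {n : ℕ} {w : SInf} (hn : FixesFrom n w) :
    schubertIn (n + 1) w.1 = schubertIn n w.1 := by
  induction hN : (noninversions n w.1).card using Nat.strong_induction_on generalizing w with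
  | _ N ih =>
  subst hN
  by_cases h : ∃ i, i + 1 < n ∧ w.1 i < w.1 (i + 1)
  · obtain ⟨i, hi, hlt⟩ := h
    rw [schubertIn_eq_divDiff (n := n + 1) (by omega) hlt, schubertIn_eq_divDiff hi hlt]
    congr 1
    exact ih _ (card_noninversions_lt n w.1 i hi hlt)
      (hn.mul_transp (a := i) (b := i + 1) (by omega) hi) rfl
  · push Not at h
    have h' : ∀ i, i + 1 < n → ¬ w.1 i < w.1 (i + 1) := fun i hi => not_lt.2 (h i hi)
    rw [schubertIn_of_forall_gt h', schubertIn_succ_staircase n le_rfl w.1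
      (apply_eq_of_no_ascent hn h') (hn n le_rfl) (fun i h1 h2 => by omega),
      Finset.prod_range_succ]
    simp only [lt_irrefl, if_false, Nat.sub_self, pow_zero, mul_one]
    exact Finset.prod_congr rfl fun i hi => by rw [if_pos (Finset.mem_range.1 hi)]

theorem schubert_eq_schubertIn {n : ℕ} {w : SInf} (hn : FixesFrom n w) :
    schubert w = schubertIn n w.1 := by
  have hmem : FixesFrom (sInf {n | ∀ i, n ≤ i → w.1 i = i}) w :=
    Nat.sInf_mem (s := {n | ∀ i, n ≤ i → w.1 i = i}) (exists_fixesFrom w)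
  have hle : sInf {n | ∀ i, n ≤ i → w.1 i = i} ≤ n := Nat.sInf_le hn
  induction n, hle using Nat.le_induction with
  | base => rfl
  | succ m hm ih => rw [schubertIn_succ (hmem.mono hm), ih (hmem.mono hm)]

theorem schubert_one : schubert 1 = 1 := by
  rw [schubert_eq_schubertIn (n := 0) (fun i _ => rfl), schubertIn_of_forall_gt (by simp)]
  simp

theorem divDiff_schubert_of_lt {w : SInf} {i : ℕ} (h : w.1 i < w.1 (i + 1)) :
    divDiff i (schubert w) = 0 := by
  obtain ⟨n, hn⟩ := exists_fixesFrom w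
  rw [schubert_eq_schubertIn (hn.mono (Nat.le_add_right n (i + 2))),
    schubertIn_eq_divDiff (by omega) h, divDiff_divDiff_self]

theorem divDiff_schubert_of_gt {w : SInf} {i : ℕ} (h : w.1 (i + 1) < w.1 i) :
    divDiff i (schubert w) = schubert (w * transp i (i + 1)) := by
  obtain ⟨n, hn⟩ := exists_fixesFrom w
  have hn' := hn.mono (Nat.le_add_right n (i + 2))
  have hm : FixesFrom (n + (i + 2)) (w * transp i (i + 1)) :=
    hn'.mul_transp (by omega) (by omega)
  rw [schubert_eq_schubertIn hn', schubert_eq_schubertIn hm,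
    schubertIn_eq_divDiff (i := i) (w := (w * transp i (i + 1)).1) (by omega)
      (by rwa [mul_transp_left, mul_transp_right])]
  congr 2
  exact congrArg Subtype.val (mul_transp_mul_transp w i (i + 1)).symm

theorem isHomogeneous_schubert (w : SInf) : (schubert w).IsHomogeneous (len w) := by
  obtain ⟨n, hn⟩ := exists_fixesFrom w
  induction hN : (noninversions n w.1).card using Nat.strong_induction_on generalizing w with
  | _ N ih =>
  subst hN
  by_cases h : ∃ i, i + 1 < n ∧ w.1 i < w.1 (i + 1)
  · obtain ⟨i, hi, hlt⟩ := h
    have h1 := ih _ (card_noninversions_lt n w.1 i hi hlt) (w * transp i (i + 1))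
      (hn.mul_transp (by omega) hi) rfl
    rw [len_mul_simple_of_lt w i hlt] at h1
    have h2 := divDiff_schubert_of_gt (w := w * transp i (i + 1)) (i := i)
      (by rwa [mul_transp_left, mul_transp_right])
    rw [mul_transp_mul_transp] at h2
    rw [← h2]
    exact isHomogeneous_divDiff h1
  · push Not at h
    have h' : ∀ i, i + 1 < n → ¬ w.1 i < w.1 (i + 1) := fun i hi => not_lt.2 (h i hi)
    have hval := apply_eq_of_no_ascent hn h'
    have hset : {p : ℕ × ℕ | p.1 < p.2 ∧ w.1 p.2 < w.1 p.1} =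
        ((Finset.range n ×ˢ Finset.range n).filter fun p => p.1 < p.2 : Finset (ℕ × ℕ)) := by
      ext ⟨a, b⟩
      simp only [Set.mem_ofPred_eq, Finset.coe_filter, Finset.mem_product, Finset.mem_range]
      constructor
      · rintro ⟨h1, h2⟩
        have hb : b < n := by
          by_contra hb
          rw [hn b (by omega)] at h2
          by_cases ha : a < n
          · have := hn.lt ha; omega
          · rw [hn a (by omega)] at h2; omega
        exact ⟨⟨by omega, hb⟩, h1⟩
      · rintro ⟨⟨ha, hb⟩, h1⟩
        rw [hval a ha, hval b hb]
        omega
    have hlen : len w = ∑ i ∈ Finset.range n, (n - 1 - i) := by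
      rw [len, hset, Set.ncard_coe_finset, Finset.card_filter, Finset.sum_product]
      refine Finset.sum_congr rfl fun i hi => ?_
      rw [← Finset.card_filter,
        show (Finset.range n).filter (fun j => i < j) = Finset.Ioo i n by
          ext j; simp only [Finset.mem_filter, Finset.mem_range, Finset.mem_Ioo]; omega,
        Nat.card_Ioo]
      omega
    rw [schubert_eq_schubertIn hn, schubertIn_of_forall_gt h', hlen]
    exact IsHomogeneous.prod _ _ _ fun i _ => isHomogeneous_X_pow i _

theorem len_pos {w : SInf} (h : w ≠ 1) : 0 < len w := by
  obtain ⟨i, hi⟩ := exists_descent h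
  have := len_mul_simple_of_gt w i hi
  omega

theorem constantCoeff_schubert {w : SInf} (h : w ≠ 1) : constantCoeff (schubert w) = 0 := by
  rw [constantCoeff_eq]
  refine (isHomogeneous_schubert w).coeff_eq_zero ?_
  have := len_pos h
  simp only [map_zero]
  omega

/-! ### Monk's formula and the Schubert basis -/

/-- The linear extension of `u ↦ 𝔖_u` to formal combinations of permutations. -/
def schub : (SInf →₀ ℤ) →ₗ[ℤ] MvPolynomial ℕ ℤ := Finsupp.linearCombination ℤ schubert

theorem schub_single (u : SInf) : schub (Finsupp.single u 1) = schubert u := by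
  simp [schub]

theorem schub_single_smul (u : SInf) (a : ℤ) :
    schub (Finsupp.single u a) = a • schubert u := by
  simp [schub]

open Classical in
/-- The operator `u ↦ u (a b)` if this is a cover in Bruhat order, and `u ↦ 0` otherwise. -/
def coverOp (a b : ℕ) : Module.End ℤ (SInf →₀ ℤ) :=
  Finsupp.linearCombination ℤ fun u =>
    if IsCover u a b then Finsupp.single (u * transp a b) 1 else 0

open Classical in
theorem coverOp_single (a b : ℕ) (u : SInf) :
    coverOp a b (Finsupp.single u 1) =
      if IsCover u a b then Finsupp.single (u * transp a b) 1 else 0 := by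
  simp [coverOp]

/-- The operator on formal combinations of permutations that corresponds to the divided
difference: `u ↦ u s_i` if `u` has a descent at `i`, and `u ↦ 0` otherwise. -/
def descentOp (i : ℕ) : Module.End ℤ (SInf →₀ ℤ) :=
  Finsupp.linearCombination ℤ fun u =>
    if u.1 (i + 1) < u.1 i then Finsupp.single (u * transp i (i + 1)) 1 else 0

theorem descentOp_single (i : ℕ) (u : SInf) :
    descentOp i (Finsupp.single u 1) =
      if u.1 (i + 1) < u.1 i then Finsupp.single (u * transp i (i + 1)) 1 else 0 := by
  simp [descentOp]

theorem apply_ne (u : SInf) {a b : ℕ} (h : a ≠ b) : u.1 a ≠ u.1 b :=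
  fun e => h (u.1.injective e)

theorem divDiff_schub (i : ℕ) (v : SInf →₀ ℤ) :
    divDiff i (schub v) = schub (descentOp i v) := by
  have : (divDiff i).comp schub = schub.comp (descentOp i) := by
    refine Finsupp.lhom_ext' fun u => LinearMap.ext_ring ?_
    simp only [LinearMap.comp_apply, Finsupp.lsingle_apply, schub_single, descentOp_single]
    split_ifs with h
    · rw [divDiff_schubert_of_gt h, schub_single]
    · have := apply_ne u (show i ≠ i + 1 by omega)
      rw [divDiff_schubert_of_lt (by omega), map_zero]
  exact LinearMap.congr_fun this v

/-- The conditions of a cover at the positions `i` and `i + 1` are separated from the others, which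
an interchange of the positions `i` and `i + 1` does not affect. -/
theorem isCover_split (u : SInf) (a b i : ℕ) :
    IsCover u a b ↔ a < b ∧ u.1 a < u.1 b ∧
      (∀ j, j ≠ i → j ≠ i + 1 → a < j → j < b → u.1 a < u.1 j → u.1 b < u.1 j) ∧
      (a < i → i < b → u.1 a < u.1 i → u.1 b < u.1 i) ∧
      (a < i + 1 → i + 1 < b → u.1 a < u.1 (i + 1) → u.1 b < u.1 (i + 1)) := by
  refine and_congr_right fun _ => and_congr_right fun _ => ⟨fun h =>
    ⟨fun j _ _ => h j, h i, h (i + 1)⟩, fun h j => ?_⟩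
  by_cases h1 : j = i
  · subst h1; exact h.2.1
  · by_cases h2 : j = i + 1
    · subst h2; exact h.2.2
    · exact h.1 j h1 h2

/-- A cover `u (a b)` followed by a descent at `i` is the same as a descent of `u` at `i` followed
by the conjugate cover. -/
theorem isCover_simple_exchange (u : SInf) {a b i : ℕ} (hab : a < b)
    (hne : ¬ (a = i ∧ b = i + 1)) :
    (IsCover u a b ∧ (u * transp a b).1 (i + 1) < (u * transp a b).1 i) ↔
    (u.1 (i + 1) < u.1 i ∧ IsCover (u * transp i (i + 1)) (Equiv.swap i (i + 1) a)
      (Equiv.swap i (i + 1) b)) := by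
  have hs : ∀ j, j ≠ i → j ≠ i + 1 → Equiv.swap i (i + 1) j = j := fun j h1 h2 =>
    Equiv.swap_apply_of_ne_of_ne h1 h2
  have hQ : (∀ j, j ≠ i → j ≠ i + 1 → Equiv.swap i (i + 1) a < j → j < Equiv.swap i (i + 1) b →
      u.1 a < u.1 j → u.1 b < u.1 j) ↔
      (∀ j, j ≠ i → j ≠ i + 1 → a < j → j < b → u.1 a < u.1 j → u.1 b < u.1 j) := by
    refine forall_congr' fun j => forall_congr' fun h1 => forall_congr' fun h2 => ?_
    have e1 : Equiv.swap i (i + 1) a < j ↔ a < j := by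
      simp only [Equiv.swap_apply_def]; split_ifs <;> omega
    have e2 : j < Equiv.swap i (i + 1) b ↔ j < b := by
      simp only [Equiv.swap_apply_def]; split_ifs <;> omega
    rw [e1, e2]
  have hlt := swap_lt_swap hab hne
  rw [isCover_split u a b i, isCover_split _ _ _ i]
  have hQ' : (∀ j, j ≠ i → j ≠ i + 1 → Equiv.swap i (i + 1) a < j →
      j < Equiv.swap i (i + 1) b →
      (u * transp i (i + 1)).1 (Equiv.swap i (i + 1) a) < (u * transp i (i + 1)).1 j →
      (u * transp i (i + 1)).1 (Equiv.swap i (i + 1) b) < (u * transp i (i + 1)).1 j) ↔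
      (∀ j, j ≠ i → j ≠ i + 1 → a < j → j < b → u.1 a < u.1 j → u.1 b < u.1 j) := by
    rw [← hQ]
    refine forall_congr' fun j => forall_congr' fun h1 => forall_congr' fun h2 => ?_
    simp only [mul_transp_apply, Equiv.swap_apply_self, hs j h1 h2]
  rw [hQ']
  generalize (∀ j, j ≠ i → j ≠ i + 1 → a < j → j < b → u.1 a < u.1 j → u.1 b < u.1 j) = Q
  simp only [mul_transp_apply, Equiv.swap_apply_self, Equiv.swap_apply_left,
    Equiv.swap_apply_right, hab, hlt, true_and]
  clear hQ hQ' hs hlt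
  have hi := apply_ne u (show i ≠ i + 1 by omega)
  by_cases ai : a = i
  · subst ai
    have := apply_ne u (show b ≠ a by omega)
    have := apply_ne u (show b ≠ a + 1 by omega)
    rw [Equiv.swap_apply_left, Equiv.swap_apply_left,
      Equiv.swap_apply_of_ne_of_ne (a := a) (b := b) (x := a + 1) (by omega) (by omega),
      Equiv.swap_apply_of_ne_of_ne (a := a) (b := a + 1) (x := b) (by omega) (by omega)]
    by_cases hQ : Q <;> simp only [hQ, true_and, false_and, and_false] <;> omega
  · by_cases ai1 : a = i + 1
    · subst ai1
      have := apply_ne u (show b ≠ i by omega)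
      have := apply_ne u (show b ≠ i + 1 by omega)
      rw [Equiv.swap_apply_right, Equiv.swap_apply_left,
        Equiv.swap_apply_of_ne_of_ne (a := i + 1) (b := b) (x := i) (by omega) (by omega),
        Equiv.swap_apply_of_ne_of_ne (a := i) (b := i + 1) (x := b) (by omega) (by omega)]
      by_cases hQ : Q <;> simp only [hQ, true_and, false_and, and_false] <;> omega
    · rw [Equiv.swap_apply_of_ne_of_ne (a := i) (b := i + 1) (x := a) (by omega) (by omega)]
      by_cases bi : b = i
      · subst bi
        have := apply_ne u (show a ≠ b by omega)
        have := apply_ne u (show a ≠ b + 1 by omega)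
        rw [Equiv.swap_apply_left, Equiv.swap_apply_right,
          Equiv.swap_apply_of_ne_of_ne (a := a) (b := b) (x := b + 1) (by omega) (by omega)]
        by_cases hQ : Q <;> simp only [hQ, true_and, false_and, and_false] <;> omega
      · by_cases bi1 : b = i + 1
        · subst bi1
          have := apply_ne u (show a ≠ i by omega)
          have := apply_ne u (show a ≠ i + 1 by omega)
          rw [Equiv.swap_apply_right, Equiv.swap_apply_right,
            Equiv.swap_apply_of_ne_of_ne (a := a) (b := i + 1) (x := i) (by omega) (by omega)]
          by_cases hQ : Q <;> simp only [hQ, true_and, false_and, and_false] <;> omega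
        · rw [Equiv.swap_apply_of_ne_of_ne (a := i) (b := i + 1) (x := b) (by omega) (by omega),
            Equiv.swap_apply_of_ne_of_ne (a := a) (b := b) (x := i) (by omega) (by omega),
            Equiv.swap_apply_of_ne_of_ne (a := a) (b := b) (x := i + 1) (by omega) (by omega)]
          by_cases hQ : Q <;> simp only [hQ, true_and, false_and, and_false] <;> omega

theorem descentOp_coverOp {a b i : ℕ} (hab : a < b) (hne : ¬ (a = i ∧ b = i + 1)) :
    descentOp i * coverOp a b =
      coverOp (Equiv.swap i (i + 1) a) (Equiv.swap i (i + 1) b) * descentOp i := by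
  classical
  refine Finsupp.lhom_ext' fun u => LinearMap.ext_ring ?_
  simp only [LinearMap.comp_apply, Finsupp.lsingle_apply, Module.End.mul_apply, coverOp_single,
    descentOp_single]
  have key := isCover_simple_exchange u hab hne
  have hel : u * transp a b * transp i (i + 1) = u * transp i (i + 1) *
      transp (Equiv.swap i (i + 1) a) (Equiv.swap i (i + 1) b) := by
    rw [mul_assoc, mul_assoc]
    congr 1
    have h := transp_apply_mul (Equiv.swap i (i + 1) a) (Equiv.swap i (i + 1) b)
      (transp i (i + 1))
    simpa only [show ∀ x, (transp i (i + 1)).1 x = Equiv.swap i (i + 1) x from fun _ => rfl,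
      Equiv.swap_apply_self] using h
  rw [apply_ite (descentOp i), map_zero, descentOp_single, apply_ite (coverOp _ _), map_zero,
    coverOp_single, hel, ← ite_and, ← ite_and]
  exact if_congr key rfl rfl

theorem descentOp_coverOp_self (i : ℕ) :
    descentOp i * coverOp i (i + 1) + coverOp i (i + 1) * descentOp i = 1 := by
  refine Finsupp.lhom_ext' fun u => LinearMap.ext_ring ?_
  simp only [LinearMap.comp_apply, Finsupp.lsingle_apply, LinearMap.add_apply,
    Module.End.mul_apply, coverOp_single, descentOp_single, Module.End.one_apply]
  have hc : ∀ v : SInf, IsCover v i (i + 1) ↔ v.1 i < v.1 (i + 1) := fun v =>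
    ⟨fun h => h.2.1, fun h => ⟨by omega, h, fun j _ _ => by omega⟩⟩
  have hne := apply_ne u (show i ≠ i + 1 by omega)
  rcases lt_or_gt_of_ne hne with h | h
  · rw [if_pos ((hc u).2 h), if_neg (by omega), map_zero, add_zero, descentOp_single,
      if_pos (by rwa [mul_transp_left, mul_transp_right]), mul_transp_mul_transp]
  · rw [if_neg (mt (hc u).1 (by omega)), if_pos h, map_zero, zero_add, coverOp_single,
      if_pos ((hc _).2 (by rwa [mul_transp_left, mul_transp_right])), mul_transp_mul_transp]

/-- The cover operator of an ordered pair, antisymmetric in its two positions. -/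
def signedCoverOp (p b : ℕ) : Module.End ℤ (SInf →₀ ℤ) :=
  if p < b then coverOp p b else if b < p then -coverOp b p else 0

/-- Monk's operator for the multiplication by `x_p`, cut off at the position `N`. -/
def monkOp (N p : ℕ) : Module.End ℤ (SInf →₀ ℤ) :=
  ∑ b ∈ Finset.range N, signedCoverOp p b

theorem descentOp_signedCoverOp (p b i : ℕ) :
    descentOp i * signedCoverOp p b =
      signedCoverOp (Equiv.swap i (i + 1) p) (Equiv.swap i (i + 1) b) * descentOp i +
        ((if b = i + 1 then (if p = i then 1 else 0) else 0) -
          (if b = i then (if p = i + 1 then 1 else 0) else 0)) := by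
  by_cases h1 : p = i ∧ b = i + 1
  · obtain ⟨rfl, rfl⟩ := h1
    have := descentOp_coverOp_self p
    simp only [signedCoverOp, Equiv.swap_apply_left, Equiv.swap_apply_right, lt_add_one, if_true,
      if_neg (show ¬ p + 1 < p by omega), if_neg (show ¬ p + 1 = p by omega)]
    rw [sub_zero, ← this]
    noncomm_ring
  · by_cases h2 : p = i + 1 ∧ b = i
    · obtain ⟨rfl, rfl⟩ := h2
      have := descentOp_coverOp_self b
      simp only [signedCoverOp, Equiv.swap_apply_left, Equiv.swap_apply_right, lt_add_one,
        if_true, if_neg (show ¬ b + 1 < b by omega), if_neg (show ¬ b = b + 1 by omega)]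
      rw [zero_sub, ← this]
      noncomm_ring
    · have e1 : (if b = i + 1 then (if p = i then (1 : Module.End ℤ (SInf →₀ ℤ)) else 0)
          else 0) = 0 := by
        split_ifs <;> first | rfl | (exfalso; omega)
      have e2 : (if b = i then (if p = i + 1 then (1 : Module.End ℤ (SInf →₀ ℤ)) else 0)
          else 0) = 0 := by
        split_ifs <;> first | rfl | (exfalso; omega)
      rw [e1, e2, sub_zero, add_zero]
      rcases lt_trichotomy p b with h | rfl | h
      · have hs := swap_lt_swap (i := i) h (by omega)
        rw [signedCoverOp, if_pos h, signedCoverOp, if_pos hs, descentOp_coverOp h (by omega)]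
      · simp [signedCoverOp]
      · have hs := swap_lt_swap (i := i) h (by omega)
        rw [signedCoverOp, if_neg (by omega), if_pos h, signedCoverOp, if_neg (by omega),
          if_pos hs, mul_neg, neg_mul, descentOp_coverOp h (by omega)]

/-- The twisted Leibniz rule for the operators of multiplication by `x_p` and of the divided
difference, on the level of formal combinations of permutations. -/
theorem descentOp_monkOp {N p i : ℕ} (hi : i + 1 < N) :
    descentOp i * monkOp N p = monkOp N (Equiv.swap i (i + 1) p) * descentOp i +
      ((if p = i then 1 else 0) - (if p = i + 1 then 1 else 0)) := by
  rw [monkOp, Finset.mul_sum, Finset.sum_congr rfl fun b _ => descentOp_signedCoverOp p b i,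
    Finset.sum_add_distrib, Finset.sum_sub_distrib, Finset.sum_ite_eq', Finset.sum_ite_eq',
    if_pos (Finset.mem_range.2 hi), if_pos (Finset.mem_range.2 (by omega)), ← Finset.sum_mul]
  congr 2
  rw [monkOp]
  refine Finset.sum_equiv (Equiv.swap i (i + 1)) ?_ fun b _ => rfl
  intro b
  simp only [Finset.mem_range, Equiv.swap_apply_def]
  split_ifs <;> omega

theorem IsCover.le_of_fixesFrom {u : SInf} {a b n : ℕ} (h : IsCover u a b) (hn : FixesFrom n u)
    (ha : a < n) : b ≤ n := by
  by_contra hb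
  have h1 := hn n le_rfl
  have h2 := hn b (by omega)
  have h3 := hn.lt ha
  have := h.2.2 n ha (by omega) (by omega)
  omega

theorem monkOp_single_eq {n N p : ℕ} {u : SInf} (hn : FixesFrom n u) (hp : p < n)
    (hN : n + 1 ≤ N) :
    monkOp N p (Finsupp.single u 1) = monkOp (n + 1) p (Finsupp.single u 1) := by
  simp only [monkOp, LinearMap.sum_apply]
  refine (Finset.sum_subset (Finset.range_subset_range.2 hN) fun b _ hb => ?_).symm
  simp only [Finset.mem_range, not_lt] at hb
  rw [signedCoverOp, if_pos (by omega), coverOp_single, if_neg]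
  intro hc
  have := hc.le_of_fixesFrom hn hp
  omega

theorem constantCoeff_schub_coverOp (a b : ℕ) (u : SInf) :
    constantCoeff (schub (coverOp a b (Finsupp.single u 1))) = 0 := by
  rw [coverOp_single]
  split_ifs with h
  · rw [schub_single, constantCoeff_schubert]
    intro e
    have := (isCover_iff_len u h.1).1 h
    rw [e, len_one] at this
    omega
  · simp

theorem constantCoeff_schub_signedCoverOp (a b : ℕ) (u : SInf) :
    constantCoeff (schub (signedCoverOp a b (Finsupp.single u 1))) = 0 := by
  rw [signedCoverOp]
  split_ifs
  · exact constantCoeff_schub_coverOp a b u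
  · rw [LinearMap.neg_apply, map_neg, map_neg, constantCoeff_schub_coverOp, neg_zero]
  · simp

/-- Monk's formula: `x_p 𝔖_u = ∑_{b > p} 𝔖_{u (p b)} - ∑_{a < p} 𝔖_{u (a p)}`, the sums being
over covers. Both sides have the same divided differences by induction on the length. -/
theorem X_mul_schubert {n N p : ℕ} {u : SInf} (hn : FixesFrom n u) (hp : p < n)
    (hN : n + 1 ≤ N) :
    X p * schubert u = schub (monkOp N p (Finsupp.single u 1)) := by
  induction hl : len u using Nat.strong_induction_on generalizing u p N with
  | _ l ih =>
  subst hl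
  rw [monkOp_single_eq hn hp hN]
  refine eq_of_divDiff_eq (fun i => ?_) ?_
  · rw [← monkOp_single_eq hn hp (show n + 1 ≤ n + 2 + i by omega), divDiff_schub,
      ← Module.End.mul_apply, descentOp_monkOp (by omega), LinearMap.add_apply,
      Module.End.mul_apply, map_add, divDiff_mul, swapVars_X, add_comm]
    congr 1
    · rw [← schub_single u, divDiff_schub, descentOp_single]
      split_ifs with hd
      · have hin : i + 1 < n := by
          by_contra hc
          rcases Nat.lt_or_ge i n with h | h
          · have h1 := hn.lt h
            have h2 := hn (i + 1) (by omega)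
            omega
          · have h1 := hn i h
            have h2 := hn (i + 1) (by omega)
            omega
        rw [schub_single, ih (len (u * transp i (i + 1))) (by
            have := len_mul_simple_of_gt u i hd; omega) (hn.mul_transp (by omega) hin) ?_
            (show n + 1 ≤ n + 2 + i by omega) rfl]
        simp only [Equiv.swap_apply_def]
        split_ifs <;> omega
      · simp
    · by_cases h1 : p = i
      · subst h1
        rw [divDiff_X_left, if_pos rfl, if_neg (by omega), sub_zero, one_mul,
          Module.End.one_apply, schub_single]
      · by_cases h2 : p = i + 1
        · subst h2
          rw [divDiff_X_right, if_pos rfl, if_neg (by omega), zero_sub, LinearMap.neg_apply,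
            Module.End.one_apply, map_neg, schub_single, neg_one_mul]
        · rw [divDiff_X_of_ne h1 h2, if_neg h1, if_neg h2]
          simp
  · rw [map_mul, constantCoeff_X, zero_mul, monkOp, LinearMap.sum_apply, map_sum, map_sum]
    exact (Finset.sum_eq_zero fun b _ => constantCoeff_schub_signedCoverOp p b u).symm

theorem descentOp_apply (i : ℕ) (c : SInf →₀ ℤ) (v : SInf) :
    descentOp i c v = if v.1 i < v.1 (i + 1) then c (v * transp i (i + 1)) else 0 := by
  classical
  induction c using Finsupp.induction_linear with
  | zero => simp
  | add f g hf hg =>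
    rw [map_add, Finsupp.add_apply, hf, hg]
    split_ifs <;> simp
  | single u a =>
    rw [← mul_one a, ← smul_eq_mul, ← Finsupp.smul_single, map_smul, descentOp_single,
      Finsupp.smul_apply, Finsupp.smul_apply]
    by_cases h : u = v * transp i (i + 1)
    · subst h
      rw [mul_transp_left, mul_transp_right, mul_transp_mul_transp]
      split_ifs <;> simp
    · have h' : u * transp i (i + 1) ≠ v := by
        rintro rfl
        exact h (mul_transp_mul_transp _ _ _).symm
      rw [Finsupp.single_apply, if_neg h]
      split_ifs <;> simp [h']

/-- Linear independence of Schubert polynomials, by induction on the lengths that occur: all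
divided differences of a relation are relations between shorter permutations. -/
theorem eq_zero_of_schub_eq_zero : ∀ (d : ℕ) (c : SInf →₀ ℤ), (∀ w, d ≤ len w → c w = 0) →
    schub c = 0 → c = 0 := by
  intro d
  induction d with
  | zero =>
    intro c hc _
    ext w
    exact hc w (Nat.zero_le _)
  | succ d ih =>
    intro c hc h
    have hz : ∀ w, w ≠ 1 → c w = 0 := by
      intro w hw
      obtain ⟨i, hi⟩ := exists_descent hw
      have h0 := ih (descentOp i c) (fun v hv => by
        rw [descentOp_apply]
        split_ifs with hlt
        · exact hc _ (by rw [len_mul_simple_of_lt v i hlt]; omega)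
        · rfl) (by rw [← divDiff_schub, h, map_zero])
      have h1 := descentOp_apply i c (w * transp i (i + 1))
      rw [h0, mul_transp_left, mul_transp_right, if_pos hi, mul_transp_mul_transp] at h1
      exact h1.symm
    have hs : c = Finsupp.single 1 (c 1) := by
      classical
      ext w
      by_cases hw : w = 1
      · subst hw; simp
      · rw [hz w hw, Finsupp.single_apply, if_neg (Ne.symm hw)]
    rw [hs, schub_single_smul, schubert_one, smul_eq_zero, or_iff_left one_ne_zero] at h
    rw [hs, h, Finsupp.single_zero]

theorem schub_injective : Function.Injective schub := by
  rw [← LinearMap.ker_eq_bot, LinearMap.ker_eq_bot']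
  intro c h
  refine eq_zero_of_schub_eq_zero (c.support.sup len + 1) c (fun w hw => ?_) h
  by_contra hne
  have := Finset.le_sup (f := len) (Finsupp.mem_support_iff.2 hne)
  omega

/-- By Monk's formula, the span of the Schubert polynomials is closed under multiplication by
variables. -/
theorem schub_surjective : Function.Surjective schub := by
  intro f
  induction f using MvPolynomial.induction_on with
  | C a => exact ⟨a • Finsupp.single 1 1, by
      rw [map_smul, schub_single, schubert_one, MvPolynomial.smul_eq_C_mul, mul_one]⟩
  | add p q hp hq =>
    obtain ⟨c, rfl⟩ := hp
    obtain ⟨d, rfl⟩ := hq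
    exact ⟨c + d, map_add _ _ _⟩
  | mul_X f p hf =>
    obtain ⟨c, rfl⟩ := hf
    induction c using Finsupp.induction_linear with
    | zero => exact ⟨0, by simp⟩
    | add c d hc hd =>
      obtain ⟨c', hc'⟩ := hc
      obtain ⟨d', hd'⟩ := hd
      exact ⟨c' + d', by rw [map_add, map_add, add_mul, hc', hd']⟩
    | single u a =>
      obtain ⟨n, hn⟩ := exists_fixesFrom u
      refine ⟨a • monkOp (n + p + 2) p (Finsupp.single u 1), ?_⟩
      rw [map_smul, ← X_mul_schubert (hn.mono (show n ≤ n + p + 1 by omega)) (by omega) le_rfl]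
      rw [schub_single_smul, smul_mul_assoc, mul_comm]

theorem isSchubertExpansion_iff {f : MvPolynomial ℕ ℤ} {c : SInf →₀ ℤ} :
    IsSchubertExpansion f c ↔ schub c = f := by
  rw [IsSchubertExpansion, schub, Finsupp.linearCombination_apply]
  exact eq_comm

theorem existsUnique_isSchubertExpansion (f : MvPolynomial ℕ ℤ) :
    ∃! c, IsSchubertExpansion f c := by
  simp only [isSchubertExpansion_iff]
  exact Function.Bijective.existsUnique ⟨schub_injective, schub_surjective⟩ f

theorem structConst_eq {u v w : SInf} {c : SInf →₀ ℤ} (h : schub c = schubert u * schubert v) :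
    structConst u v w = c w := by
  have hex : ∃ c, IsSchubertExpansion (schubert u * schubert v) c :=
    ⟨c, isSchubertExpansion_iff.2 h⟩
  rw [structConst, dif_pos hex]
  congr 1
  exact schub_injective ((isSchubertExpansion_iff.1 hex.choose_spec).trans h.symm)

/-! ### Commutation relations for covers -/

theorem mul_transp_apply_ite (u : SInf) (a b i : ℕ) :
    (u * transp a b).1 i = if i = a then u.1 b else if i = b then u.1 a else u.1 i := by
  rw [mul_transp_apply, Equiv.swap_apply_def]
  split_ifs <;> rfl

theorem isCover_disjoint_comm (u : SInf) {a c p b : ℕ} (h1 : a ≠ p) (h2 : a ≠ b) (h3 : c ≠ p)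
    (h4 : c ≠ b) (h : IsCover u p b ∧ IsCover (u * transp p b) a c) :
    IsCover u a c ∧ IsCover (u * transp a c) p b := by
  have inj : ∀ i j, u.1 i = u.1 j → i = j := fun i j e => u.1.injective e
  simp only [IsCover, mul_transp_apply_ite] at *
  grind

/-- A chain of two covers that carries the value at `a` first to `p` and then to `c` has a
counterpart among the two other chains with the same end. -/
theorem isCover_three (u : SInf) {a p c : ℕ} (hap : a < p) (hpc : p < c) (hu : u.1 a < u.1 p) :
    (IsCover u a p ∧ IsCover (u * transp a p) p c) ↔
      ((IsCover u p c ∧ IsCover (u * transp p c) a c) ∨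
      (IsCover u a c ∧ IsCover (u * transp a c) a p)) := by
  have inj : ∀ i j, u.1 i = u.1 j → i = j := fun i j e => u.1.injective e
  simp only [IsCover, mul_transp_apply_ite] at *
  constructor
  · grind (splits := 40)
  · grind (splits := 40)

theorem coverOp_coverOp_of {a b c d : ℕ} {u : SInf} (h1 : IsCover u a b)
    (h2 : IsCover (u * transp a b) c d) :
    coverOp c d (coverOp a b (Finsupp.single u 1)) =
      Finsupp.single (u * transp a b * transp c d) 1 := by
  rw [coverOp_single, if_pos h1, coverOp_single, if_pos h2]

theorem coverOp_coverOp_of_not {a b c d : ℕ} {u : SInf}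
    (h : IsCover u a b → ¬ IsCover (u * transp a b) c d) :
    coverOp c d (coverOp a b (Finsupp.single u 1)) = 0 := by
  rw [coverOp_single]
  split_ifs with h1
  · rw [coverOp_single, if_neg (h h1)]
  · rw [map_zero]

/-- Cover operators on disjoint pairs of positions commute. -/
theorem coverOp_comm (u : SInf) {a c p b : ℕ} (h1 : a ≠ p) (h2 : a ≠ b) (h3 : c ≠ p)
    (h4 : c ≠ b) :
    coverOp a c (coverOp p b (Finsupp.single u 1)) =
      coverOp p b (coverOp a c (Finsupp.single u 1)) := by
  by_cases h : IsCover u p b ∧ IsCover (u * transp p b) a c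
  · have h' := isCover_disjoint_comm u h1 h2 h3 h4 h
    rw [coverOp_coverOp_of h.1 h.2, coverOp_coverOp_of h'.1 h'.2]
    congr 1
    refine Subtype.ext (Equiv.ext fun i => ?_)
    simp only [mul_transp_apply_ite]
    grind
  · have h' : ¬ (IsCover u a c ∧ IsCover (u * transp a c) p b) := fun h' =>
      h (isCover_disjoint_comm u h1.symm h3.symm h2.symm h4.symm h')
    rw [coverOp_coverOp_of_not (not_and.1 h), coverOp_coverOp_of_not (not_and.1 h')]

/-- The three-term relation between the cover operators on three positions. -/
theorem coverOp_three (u : SInf) {a p c : ℕ} (hap : a < p) (hpc : p < c)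
    (hu : u.1 a < u.1 p) :
    coverOp p c (coverOp a p (Finsupp.single u 1)) =
      coverOp a c (coverOp p c (Finsupp.single u 1)) +
        coverOp a p (coverOp a c (Finsupp.single u 1)) := by
  have key := isCover_three u hap hpc hu
  have e1 : u * transp p c * transp a c = u * transp a p * transp p c := by
    refine Subtype.ext (Equiv.ext fun i => ?_)
    simp only [mul_transp_apply_ite]
    grind
  have e2 : u * transp a c * transp a p = u * transp a p * transp p c := by
    refine Subtype.ext (Equiv.ext fun i => ?_)
    simp only [mul_transp_apply_ite]
    grind
  by_cases h2 : IsCover u p c ∧ IsCover (u * transp p c) a c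
  · have h1 := key.2 (Or.inl h2)
    have h3 : IsCover u a c → ¬ IsCover (u * transp a c) a p := fun _ h => by
      have := h.2.1
      rw [mul_transp_left, mul_transp_of_ne u (by omega) (by omega)] at this
      have := h2.1.2.1
      omega
    rw [coverOp_coverOp_of h1.1 h1.2, coverOp_coverOp_of h2.1 h2.2, coverOp_coverOp_of_not h3,
      e1, add_zero]
  · by_cases h3 : IsCover u a c ∧ IsCover (u * transp a c) a p
    · have h1 := key.2 (Or.inr h3)
      rw [coverOp_coverOp_of h1.1 h1.2, coverOp_coverOp_of h3.1 h3.2,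
        coverOp_coverOp_of_not (not_and.1 h2), e2, zero_add]
    · rw [coverOp_coverOp_of_not (not_and.1 fun h => (key.1 h).elim h2 h3),
        coverOp_coverOp_of_not (not_and.1 h2), coverOp_coverOp_of_not (not_and.1 h3), add_zero]

/-- The value `j`, if it stands among the first `k` positions, is interchanged by a cover with a
larger value at one of the positions from `k` to `N - 1`; all possibilities are summed. -/
def raiseOp (N k j : ℕ) : Module.End ℤ (SInf →₀ ℤ) :=
  Finsupp.linearCombination ℤ fun u =>
    if u.1.symm j < k then ∑ b ∈ Finset.Ico k N, coverOp (u.1.symm j) b (Finsupp.single u 1)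
    else 0

theorem raiseOp_single (N k j : ℕ) (u : SInf) :
    raiseOp N k j (Finsupp.single u 1) = if u.1.symm j < k then
      ∑ b ∈ Finset.Ico k N, coverOp (u.1.symm j) b (Finsupp.single u 1) else 0 := by
  simp [raiseOp]

/-- The part of Monk's operator in which the smaller one of the interchanged values is at
least `j`. -/
def monkOpFrom (N p j : ℕ) : Module.End ℤ (SInf →₀ ℤ) :=
  Finsupp.linearCombination ℤ fun u =>
    (if j ≤ u.1 p then ∑ b ∈ Finset.Ico (p + 1) N, coverOp p b (Finsupp.single u 1) else 0) -
      ∑ a ∈ Finset.range p, if j ≤ u.1 a then coverOp a p (Finsupp.single u 1) else 0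

theorem monkOpFrom_single (N p j : ℕ) (u : SInf) :
    monkOpFrom N p j (Finsupp.single u 1) =
    (if j ≤ u.1 p then ∑ b ∈ Finset.Ico (p + 1) N, coverOp p b (Finsupp.single u 1) else 0) -
      ∑ a ∈ Finset.range p, if j ≤ u.1 a then coverOp a p (Finsupp.single u 1) else 0 := by
  simp [monkOpFrom]

theorem raiseOp_coverOp (N k j x y : ℕ) (u : SInf) :
    raiseOp N k j (coverOp x y (Finsupp.single u 1)) =
      if Equiv.swap x y (u.1.symm j) < k then ∑ b ∈ Finset.Ico k N,
        coverOp (Equiv.swap x y (u.1.symm j)) b (coverOp x y (Finsupp.single u 1)) else 0 := by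
  rw [coverOp_single]
  by_cases h : IsCover u x y
  · rw [if_pos h, raiseOp_single]
    rfl
  · simp [h]

theorem monkOpFrom_coverOp (N p j x y : ℕ) (u : SInf) :
    monkOpFrom N p j (coverOp x y (Finsupp.single u 1)) =
    (if j ≤ u.1 (Equiv.swap x y p) then
      ∑ b ∈ Finset.Ico (p + 1) N, coverOp p b (coverOp x y (Finsupp.single u 1)) else 0) -
      ∑ a ∈ Finset.range p, if j ≤ u.1 (Equiv.swap x y a) then
        coverOp a p (coverOp x y (Finsupp.single u 1)) else 0 := by
  rw [coverOp_single]
  by_cases h : IsCover u x y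
  · rw [if_pos h, monkOpFrom_single]
    rfl
  · simp [h]

theorem coverOp_eq_zero {u : SInf} {a b : ℕ} (h : u.1 b ≤ u.1 a) :
    coverOp a b (Finsupp.single u 1) = 0 := by
  rw [coverOp_single, if_neg]
  intro hc
  have := hc.2.1
  omega

/-- The terms of Monk's operator in which the smaller one of the interchanged values is equal to
`j`. -/
theorem monkOpFrom_succ {N p : ℕ} (hp : p < N) (j : ℕ) :
    monkOpFrom N p j = monkOpFrom N p (j + 1) + (raiseOp N (p + 1) j - raiseOp N p j) := by
  refine Finsupp.lhom_ext' fun u => LinearMap.ext_ring ?_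
  simp only [LinearMap.comp_apply, Finsupp.lsingle_apply, LinearMap.add_apply,
    LinearMap.sub_apply, monkOpFrom_single, raiseOp_single]
  set a := u.1.symm j with ha
  have hua : u.1 a = j := Equiv.apply_symm_apply _ _
  have hj : ∀ i, i ≠ a → (j ≤ u.1 i ↔ j + 1 ≤ u.1 i) := fun i hi => by
    have := apply_ne u hi
    omega
  rcases lt_trichotomy a p with h | h | h
  · rw [if_congr (hj p (by omega)) rfl rfl, if_pos (show a < p + 1 by omega), if_pos h,
      Finset.sum_eq_sum_Ico_succ_bot hp]
    have hmem : a ∈ Finset.range p := Finset.mem_range.2 h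
    rw [← Finset.add_sum_erase _ _ hmem, ← Finset.add_sum_erase _ (fun a => if j + 1 ≤ u.1 a then
      coverOp a p (Finsupp.single u 1) else 0) hmem, if_pos hua.ge,
      if_neg (show ¬ j + 1 ≤ u.1 a by omega)]
    rw [Finset.sum_congr rfl fun i hi =>
      if_congr (hj i (Finset.ne_of_mem_erase hi)) rfl rfl]
    abel
  · rw [h] at hua ⊢
    rw [if_pos hua.ge, if_neg (show ¬ j + 1 ≤ u.1 p by omega), if_pos (Nat.lt_succ_self p),
      if_neg (lt_irrefl p)]
    rw [Finset.sum_congr rfl fun i hi =>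
      if_congr (hj i (by rw [h]; exact (Finset.mem_range.1 hi).ne)) rfl rfl]
    abel
  · rw [if_neg (show ¬ a < p + 1 by omega), if_neg (show ¬ a < p by omega),
      if_congr (hj p (by omega)) rfl rfl]
    rw [Finset.sum_congr rfl fun i hi =>
      if_congr (hj i (by have := Finset.mem_range.1 hi; omega)) rfl rfl]
    abel

/-- Moving a raising operator past Monk's operator lowers the number `p + 1` of active positions
by one. Everything cancels by the commutation of disjoint cover operators, except for pairs of
transpositions on three positions, where the three-term relation applies. -/
theorem raiseOp_mul_monkOpFrom {N p : ℕ} (hp : p < N) (j : ℕ) :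
    raiseOp N (p + 1) j * monkOpFrom N p j = monkOpFrom N p (j + 1) * raiseOp N p j := by
  refine Finsupp.lhom_ext' fun u => LinearMap.ext_ring ?_
  simp only [LinearMap.comp_apply, Finsupp.lsingle_apply, Module.End.mul_apply]
  rw [monkOpFrom_single, raiseOp_single, map_sub, apply_ite (raiseOp N (p + 1) j), map_zero,
    map_sum, map_sum]
  simp only [apply_ite (raiseOp N (p + 1) j), map_zero, raiseOp_coverOp]
  rw [apply_ite (monkOpFrom N p (j + 1)), map_zero, map_sum]
  simp only [monkOpFrom_coverOp]
  set a := u.1.symm j with ha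
  have hua : u.1 a = j := Equiv.apply_symm_apply _ _
  have hj : ∀ i, i ≠ a → (j ≤ u.1 i ↔ j + 1 ≤ u.1 i) := fun i hi => by
    have := apply_ne u hi
    omega
  set e : SInf →₀ ℤ := Finsupp.single u 1 with he
  by_cases h : a < p
  swap
  · -- the value `j` stands at one of the positions from `p` on, and both sides vanish
    rw [if_neg h]
    have z1 : ∀ i ∈ Finset.range p, (if j ≤ u.1 i then
        if Equiv.swap i p a < p + 1 then ∑ b ∈ Finset.Ico (p + 1) N,
          coverOp (Equiv.swap i p a) b (coverOp i p e) else 0 else 0) = 0 := by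
      intro i hi
      rw [Finset.mem_range] at hi
      split_ifs with h1 h2
      · have hap : a = p := by
          by_contra hne
          rw [Equiv.swap_apply_of_ne_of_ne (by omega) hne] at h2
          omega
        rw [he, coverOp_eq_zero (by rw [← hap, hua]; exact h1)]
        simp
      · rfl
      · rfl
    rw [Finset.sum_eq_zero z1, sub_zero]
    split_ifs with h1
    · refine Finset.sum_eq_zero fun b hb => ?_
      rw [Finset.mem_Ico] at hb
      split_ifs with h2
      · have hab : a = b := by
          by_contra hne
          rcases Nat.eq_or_lt_of_le (not_lt.1 h) with h3 | h3
          · rw [← h3, Equiv.swap_apply_left] at h2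
            omega
          · rw [Equiv.swap_apply_of_ne_of_ne (by omega) hne] at h2
            omega
        rw [he, coverOp_eq_zero (a := p) (b := b) (by rw [← hab, hua]; exact h1)]
        simp
      · rfl
    · rfl
  -- the value `j` stands at a position `a < p`
  rw [if_pos h, Finset.sum_eq_sum_Ico_succ_bot hp]
  have hmem : a ∈ Finset.range p := Finset.mem_range.2 h
  have z0 : ((if j + 1 ≤ u.1 (Equiv.swap a p p) then
      ∑ b ∈ Finset.Ico (p + 1) N, coverOp p b (coverOp a p e) else 0) -
      ∑ i ∈ Finset.range p, if j + 1 ≤ u.1 (Equiv.swap a p i) then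
        coverOp i p (coverOp a p e) else 0) = 0 := by
    rw [Equiv.swap_apply_right, hua, if_neg (by omega), zero_sub, neg_eq_zero]
    refine Finset.sum_eq_zero fun i hi => ?_
    split_ifs with h1
    · refine coverOp_coverOp_of_not fun _ hc => ?_
      have := hc.2.1
      rw [mul_transp_right, mul_transp_apply, hua] at this
      omega
    · rfl
  rw [z0, zero_add, ← Finset.add_sum_erase _ _ hmem, Equiv.swap_apply_left, if_pos hua.ge,
    if_pos (Nat.lt_succ_self p)]
  have lhs1 : (if j ≤ u.1 p then ∑ b ∈ Finset.Ico (p + 1) N, if Equiv.swap p b a < p + 1 then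
      ∑ c ∈ Finset.Ico (p + 1) N, coverOp (Equiv.swap p b a) c (coverOp p b e) else 0 else 0) =
      if j + 1 ≤ u.1 p then ∑ c ∈ Finset.Ico (p + 1) N, ∑ b ∈ Finset.Ico (p + 1) N,
        coverOp a c (coverOp p b e) else 0 := by
    refine if_congr (hj p (by omega)) ?_ rfl
    rw [Finset.sum_comm]
    refine Finset.sum_congr rfl fun b hb => ?_
    rw [Finset.mem_Ico] at hb
    rw [Equiv.swap_apply_of_ne_of_ne (by omega) (by omega), if_pos (by omega)]
  have lhs2 : (∑ i ∈ (Finset.range p).erase a, if j ≤ u.1 i then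
      if Equiv.swap i p a < p + 1 then ∑ c ∈ Finset.Ico (p + 1) N,
        coverOp (Equiv.swap i p a) c (coverOp i p e) else 0 else 0) =
      ∑ c ∈ Finset.Ico (p + 1) N, ∑ i ∈ (Finset.range p).erase a,
        if j + 1 ≤ u.1 i then coverOp a c (coverOp i p e) else 0 := by
    rw [Finset.sum_comm]
    refine Finset.sum_congr rfl fun i hi => ?_
    have hia := Finset.ne_of_mem_erase hi
    rw [if_congr (hj i hia) rfl rfl, Equiv.swap_apply_of_ne_of_ne hia.symm (by omega),
      if_pos (show a < p + 1 by omega)]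
    by_cases hi' : j + 1 ≤ u.1 i
    · simp only [if_pos hi']
    · simp only [if_neg hi', Finset.sum_const_zero]
  have rhs : ∀ c ∈ Finset.Ico (p + 1) N,
      ((if j + 1 ≤ u.1 (Equiv.swap a c p) then
        ∑ b ∈ Finset.Ico (p + 1) N, coverOp p b (coverOp a c e) else 0) -
        ∑ i ∈ Finset.range p, if j + 1 ≤ u.1 (Equiv.swap a c i) then
          coverOp i p (coverOp a c e) else 0) =
      (if j + 1 ≤ u.1 p then ∑ b ∈ Finset.Ico (p + 1) N, coverOp a c (coverOp p b e) else 0) -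
        (∑ i ∈ (Finset.range p).erase a,
          if j + 1 ≤ u.1 i then coverOp a c (coverOp i p e) else 0) -
        coverOp p c (coverOp a p e) := by
    intro c hc
    have hcm := hc
    rw [Finset.mem_Ico] at hc
    have r1 : (if j + 1 ≤ u.1 (Equiv.swap a c a) then coverOp a p (coverOp a c e) else 0) =
        coverOp a p (coverOp a c e) := by
      rw [Equiv.swap_apply_left]
      split_ifs with h1
      · rfl
      · rw [he, coverOp_eq_zero (a := a) (b := c) (by omega), map_zero]
    have r2 : ∀ i ∈ (Finset.range p).erase a,
        (if j + 1 ≤ u.1 (Equiv.swap a c i) then coverOp i p (coverOp a c e) else 0) =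
        if j + 1 ≤ u.1 i then coverOp a c (coverOp i p e) else 0 := by
      intro i hi
      have hia := Finset.ne_of_mem_erase hi
      have hip := Finset.mem_range.1 (Finset.mem_of_mem_erase hi)
      rw [Equiv.swap_apply_of_ne_of_ne hia (by omega),
        coverOp_comm u (a := i) (c := p) (p := a) (b := c) hia (by omega) (by omega) (by omega)]
    rw [← Finset.add_sum_erase _ _ hmem, r1, Finset.sum_congr rfl r2,
      Equiv.swap_apply_of_ne_of_ne (by omega) (by omega)]
    by_cases hup : j + 1 ≤ u.1 p
    · rw [if_pos hup, if_pos hup, coverOp_three u h (by omega) (by omega)]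
      have hz : coverOp p c (coverOp a c e) = 0 := coverOp_coverOp_of_not fun _ hcov => by
        have := hcov.2.1
        rw [mul_transp_right, mul_transp_of_ne u (by omega) (by omega)] at this
        omega
      rw [← Finset.add_sum_erase _ _ hcm, ← Finset.add_sum_erase _ (fun b =>
        coverOp a c (coverOp p b e)) hcm, hz]
      rw [Finset.sum_congr rfl fun b hb => (coverOp_comm u (a := p) (c := b) (p := a) (b := c)
        (by omega) (by omega)
        (by have := Finset.mem_Ico.1 (Finset.mem_of_mem_erase hb); omega)
        (Finset.ne_of_mem_erase hb))]
      abel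
    · have hne := apply_ne u (show a ≠ p by omega)
      rw [if_neg hup, if_neg hup]
      have hz1 : coverOp a p e = 0 := coverOp_eq_zero (by omega)
      have hz2 : coverOp a p (coverOp a c e) = 0 := coverOp_coverOp_of_not fun hc1 hcov => by
        have h1 := hc1.2.1
        have h2 := hcov.2.1
        rw [mul_transp_left, mul_transp_of_ne u (by omega) (by omega)] at h2
        omega
      rw [hz1, hz2, map_zero]
      abel
  rw [lhs1, lhs2, Finset.sum_congr rfl rhs, Finset.sum_sub_distrib, Finset.sum_sub_distrib]
  have hite : (∑ c ∈ Finset.Ico (p + 1) N, if j + 1 ≤ u.1 p then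
      ∑ b ∈ Finset.Ico (p + 1) N, coverOp a c (coverOp p b e) else 0) =
      if j + 1 ≤ u.1 p then ∑ c ∈ Finset.Ico (p + 1) N, ∑ b ∈ Finset.Ico (p + 1) N,
        coverOp a c (coverOp p b e) else 0 := by
    split_ifs
    · rfl
    · simp
  rw [hite]
  abel

/-! ### Pieri's formula -/

/-- The complete homogeneous symmetric polynomial of degree `m` in the first `s` variables. -/
def hPoly : ℕ → ℕ → MvPolynomial ℕ ℤ
  | _, 0 => 1
  | 0, _ + 1 => 0
  | s + 1, m + 1 => hPoly s (m + 1) + X s * hPoly (s + 1) m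

/-- The operator of Pieri's formula: `m` successive raising operators whose values increase
strictly and are at least `j`. -/
def pieriOp (N k : ℕ) : ℕ → ℕ → Module.End ℤ (SInf →₀ ℤ)
  | 0, _ => 1
  | m + 1, j => ∑ α ∈ Finset.Ico j N, pieriOp N k m (α + 1) * raiseOp N k α

/-- The formal combinations of permutations that fix all numbers from `n` on. -/
def fixed (n : ℕ) : Submodule ℤ (SInf →₀ ℤ) := Finsupp.supported ℤ ℤ {u | FixesFrom n u}

theorem single_mem_fixed {n : ℕ} {u : SInf} (h : FixesFrom n u) (a : ℤ) :
    Finsupp.single u a ∈ fixed n := Finsupp.single_mem_supported ℤ a h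

theorem map_mem_of_mem_fixed {n : ℕ} {T : Module.End ℤ (SInf →₀ ℤ)}
    {P : Submodule ℤ (SInf →₀ ℤ)} (h : ∀ u, FixesFrom n u → T (Finsupp.single u 1) ∈ P)
    {v : SInf →₀ ℤ} (hv : v ∈ fixed n) : T v ∈ P := by
  rw [fixed, Finsupp.supported_eq_span_single] at hv
  have : Submodule.span ℤ ((fun i => Finsupp.single i (1 : ℤ)) '' {u | FixesFrom n u}) ≤
      P.comap T := by
    rw [Submodule.span_le]
    rintro _ ⟨u, hu, rfl⟩
    exact h u hu
  exact this hv

theorem map_eq_of_mem_fixed {n : ℕ} {A : Type*} [AddCommGroup A]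
    {T T' : (SInf →₀ ℤ) →ₗ[ℤ] A}
    (h : ∀ u, FixesFrom n u → T (Finsupp.single u 1) = T' (Finsupp.single u 1))
    {v : SInf →₀ ℤ} (hv : v ∈ fixed n) : T v = T' v := by
  rw [fixed, Finsupp.supported_eq_span_single] at hv
  refine LinearMap.eqOn_span (s := (fun i => Finsupp.single i (1 : ℤ)) '' {u | FixesFrom n u})
    ?_ hv
  rintro _ ⟨u, hu, rfl⟩
  exact h u hu

theorem monkOpFrom_zero {N p : ℕ} (hp : p < N) : monkOpFrom N p 0 = monkOp N p := by
  refine Finsupp.lhom_ext' fun u => LinearMap.ext_ring ?_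
  simp only [LinearMap.comp_apply, Finsupp.lsingle_apply, monkOpFrom_single, Nat.zero_le,
    if_true, monkOp, LinearMap.sum_apply]
  rw [Finset.range_eq_Ico, Finset.range_eq_Ico,
    ← Finset.sum_Ico_consecutive _ (Nat.zero_le p) hp.le,
    Finset.sum_eq_sum_Ico_succ_bot hp, sub_eq_neg_add, ← Finset.sum_neg_distrib]
  congr 1
  · refine Finset.sum_congr rfl fun a ha => ?_
    have := (Finset.mem_Ico.1 ha).2
    rw [signedCoverOp, if_neg (by omega), if_pos this, LinearMap.neg_apply]
  · have hz : signedCoverOp p p = 0 := by simp [signedCoverOp]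
    rw [hz, LinearMap.zero_apply, zero_add]
    refine Finset.sum_congr rfl fun b hb => ?_
    have := (Finset.mem_Ico.1 hb).1
    rw [signedCoverOp, if_pos (by omega)]

theorem monkOpFrom_eq_zero {N p j : ℕ} (hp : p < N) (hj : N ≤ j) {v : SInf →₀ ℤ}
    (hv : v ∈ fixed N) : monkOpFrom N p j v = 0 := by
  refine map_eq_of_mem_fixed (T' := 0) (fun u hu => ?_) hv
  rw [monkOpFrom_single, if_neg (by have := hu.lt hp; omega), Finset.sum_eq_zero, sub_zero,
    LinearMap.zero_apply]
  intro a ha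
  have := hu.lt ((Finset.mem_range.1 ha).trans hp)
  rw [if_neg (by omega)]

theorem coverOp_mem_fixed {n a b : ℕ} {u : SInf} (hu : FixesFrom n u) (ha : a < n)
    (hb : b < n) : coverOp a b (Finsupp.single u 1) ∈ fixed n := by
  rw [coverOp_single]
  split_ifs
  · exact single_mem_fixed (hu.mul_transp ha hb) 1
  · exact zero_mem _

theorem raiseOp_mem_fixed {N k j : ℕ} (hk : k ≤ N) {v : SInf →₀ ℤ} (hv : v ∈ fixed N) :
    raiseOp N k j v ∈ fixed N := by
  refine map_mem_of_mem_fixed (fun u hu => ?_) hv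
  rw [raiseOp_single]
  split_ifs with h
  · refine Submodule.sum_mem _ fun b hb => coverOp_mem_fixed hu (by omega) ?_
    exact (Finset.mem_Ico.1 hb).2
  · exact zero_mem _

theorem pieriOp_of_le {N k m j : ℕ} (h : N ≤ j) : pieriOp N k (m + 1) j = 0 := by
  rw [pieriOp, Finset.Ico_eq_empty (by omega), Finset.sum_empty]

theorem pieriOp_of_lt {N k m j : ℕ} (h : j < N) : pieriOp N k (m + 1) j =
    pieriOp N k (m + 1) (j + 1) + pieriOp N k m (j + 1) * raiseOp N k j := by
  rw [pieriOp, Finset.sum_eq_sum_Ico_succ_bot h, add_comm, ← pieriOp]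

/-- The recursion `h_{m+1}(x_0, …, x_p) = h_{m+1}(x_0, …, x_{p-1}) + h_m(x_0, …, x_p) x_p` on
the level of operators. -/
theorem pieriOp_succ {N p : ℕ} (hp : p < N) (m : ℕ) : ∀ (j : ℕ) (v : SInf →₀ ℤ), v ∈ fixed N →
    pieriOp N (p + 1) (m + 1) j v =
      pieriOp N p (m + 1) j v + pieriOp N (p + 1) m j (monkOpFrom N p j v) := by
  induction m with
  | zero =>
    intro j v hv
    induction hd : N - j generalizing j with
    | zero =>
      rw [pieriOp_of_le (by omega), pieriOp_of_le (by omega),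
        monkOpFrom_eq_zero hp (by omega) hv]
      simp
    | succ d ih =>
      have hj : j < N := by omega
      rw [pieriOp_of_lt hj, pieriOp_of_lt hj, LinearMap.add_apply, LinearMap.add_apply,
        ih (j + 1) (by omega), monkOpFrom_succ hp j]
      simp only [pieriOp, one_mul, Module.End.one_apply, LinearMap.add_apply,
        LinearMap.sub_apply]
      abel
  | succ m ihm =>
    intro j v hv
    induction hd : N - j generalizing j with
    | zero =>
      rw [pieriOp_of_le (by omega), pieriOp_of_le (by omega),
        monkOpFrom_eq_zero hp (by omega) hv]
      simp
    | succ d ih =>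
      have hj : j < N := by omega
      have h1 := ih (j + 1) (by omega)
      have h2 := ihm (j + 1) (raiseOp N p j v) (raiseOp_mem_fixed hp.le hv)
      have h3 := LinearMap.congr_fun (raiseOp_mul_monkOpFrom hp j) v
      simp only [Module.End.mul_apply] at h3
      rw [pieriOp_of_lt (m := m + 1) hj, pieriOp_of_lt (m := m + 1) hj, LinearMap.add_apply,
        LinearMap.add_apply, h1, pieriOp_of_lt (m := m) (k := p + 1) hj]
      simp only [LinearMap.add_apply, Module.End.mul_apply, h3]
      rw [monkOpFrom_succ hp j]
      simp only [LinearMap.add_apply, LinearMap.sub_apply, map_add, map_sub, h2]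
      abel

theorem monkOp_mem_fixed {n N p : ℕ} (hp : p < n) (hN : n + 1 ≤ N) {v : SInf →₀ ℤ}
    (hv : v ∈ fixed n) : monkOp N p v ∈ fixed (n + 1) := by
  refine map_mem_of_mem_fixed (fun u hu => ?_) hv
  rw [monkOp_single_eq hu hp hN, monkOp, LinearMap.sum_apply]
  refine Submodule.sum_mem _ fun b hb => ?_
  have hb' := Finset.mem_range.1 hb
  have hu' := hu.mono (Nat.le_succ n)
  rw [signedCoverOp]
  split_ifs
  · exact coverOp_mem_fixed hu' (by omega) hb'
  · exact neg_mem (coverOp_mem_fixed hu' hb' (by omega))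
  · exact zero_mem _

theorem X_mul_schub {n N p : ℕ} (hp : p < n) (hN : n + 1 ≤ N) {v : SInf →₀ ℤ}
    (hv : v ∈ fixed n) : X p * schub v = schub (monkOp N p v) := by
  refine map_eq_of_mem_fixed (T := (LinearMap.mulLeft ℤ (X p)).comp schub)
    (T' := schub.comp (monkOp N p)) (fun u hu => ?_) hv
  simp only [LinearMap.comp_apply, LinearMap.mulLeft_apply]
  rw [schub_single, X_mul_schubert hu hp hN]

/-- The number `N` bounds the positions; the operator does not see this bound as long as the `m`
covers stay below it. -/
theorem schub_pieriOp {N : ℕ} : ∀ (k m n : ℕ) (v : SInf →₀ ℤ), k ≤ n → n + m + 1 ≤ N →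
    v ∈ fixed n → schub (pieriOp N k m 0 v) = hPoly k m * schub v := by
  intro k
  induction k with
  | zero =>
    intro m n v _ _ _
    cases m with
    | zero => simp [pieriOp, hPoly]
    | succ m =>
      have hz : ∀ j, raiseOp N 0 j = 0 := fun j => by
        refine Finsupp.lhom_ext' fun u => LinearMap.ext_ring ?_
        simp [raiseOp_single]
      simp [pieriOp, hPoly, hz]
  | succ k ihk =>
    intro m
    induction m with
    | zero => intro n v _ _ _; simp [pieriOp, hPoly]
    | succ m ihm =>
      intro n v hk hN hv
      have hvN : v ∈ fixed N := Finsupp.supported_mono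
        (fun u (hu : FixesFrom n u) => hu.mono (show n ≤ N by omega)) hv
      rw [pieriOp_succ (by omega) m 0 v hvN, map_add, ihk (m + 1) n v (by omega) (by omega) hv,
        monkOpFrom_zero (by omega), ihm (n + 1) _ (by omega) (by omega)
          (monkOp_mem_fixed (by omega) (by omega) hv),
        ← X_mul_schub (by omega) (by omega) hv, hPoly]
      ring

/-! ### Chains in the `k`-Bruhat order -/

/-- Left multiplication of `u` by the transposition of the pair `q` of values is a cover in the
`k`-Bruhat order. -/
def IsKStep (k : ℕ) (q : ℕ × ℕ) (u : SInf) : Prop :=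
  q.1 < q.2 ∧ KCover k u (transp q.1 q.2 * u)

/-- Successive left multiplication of `u` by the transpositions of the list is a saturated chain
in the `k`-Bruhat order. -/
def IsKChain (k : ℕ) : SInf → List (ℕ × ℕ) → Prop
  | _, [] => True
  | u, q :: x => IsKStep k q u ∧ IsKChain k (transp q.1 q.2 * u) x

/-- The product of the transpositions of a list, the first one standing on the right. -/
def listProd : List (ℕ × ℕ) → SInf
  | [] => 1
  | q :: x => listProd x * transp q.1 q.2

theorem listProd_append (x y : List (ℕ × ℕ)) : listProd (x ++ y) = listProd y * listProd x := by
  induction x with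
  | nil => simp [listProd]
  | cons q x ih => simp only [List.cons_append, listProd, ih, mul_assoc]

theorem isKChain_append {k : ℕ} (x y : List (ℕ × ℕ)) (u : SInf) :
    IsKChain k u (x ++ y) ↔ IsKChain k u x ∧ IsKChain k (listProd x * u) y := by
  induction x generalizing u with
  | nil => simp [IsKChain, listProd]
  | cons q x ih => simp only [List.cons_append, IsKChain, listProd, ih, mul_assoc, and_assoc]

theorem isKStep_iff {k α β : ℕ} {u : SInf} : IsKStep k (α, β) u ↔
    u.1.symm α < k ∧ k ≤ u.1.symm β ∧ IsCover u (u.1.symm α) (u.1.symm β) := by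
  simp only [IsKStep, KCover_iff]
  constructor
  · rintro ⟨hlt, a, b, ha, hb, hc, he⟩
    rw [transp_mul, mul_right_inj] at he
    have he' : Equiv.swap (u.1.symm α) (u.1.symm β) = Equiv.swap a b := congrArg Subtype.val he
    have h1 : Equiv.swap (u.1.symm α) (u.1.symm β) a = b := by
      rw [he', Equiv.swap_apply_left]
    have hab := hc.1
    rw [Equiv.swap_apply_def] at h1
    split_ifs at h1 with h2 h3
    · rw [← h2, h1]; exact ⟨ha, hb, hc⟩
    · exfalso
      have := hc.2.1
      rw [← h1, h3, Equiv.apply_symm_apply, Equiv.apply_symm_apply] at this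
      omega
    · omega
  · rintro ⟨ha, hb, hc⟩
    refine ⟨?_, _, _, ha, hb, hc, transp_mul α β u⟩
    have := hc.2.1
    rwa [Equiv.apply_symm_apply, Equiv.apply_symm_apply] at this

theorem FixesFrom.symm_lt {n : ℕ} {u : SInf} (h : FixesFrom n u) {i : ℕ} (hi : i < n) :
    u.1.symm i < n := by
  by_contra hc
  have := h _ (not_lt.1 hc)
  rw [Equiv.apply_symm_apply] at this
  omega

open Classical in
theorem raiseOp_single_eq_sum {N k α : ℕ} {u : SInf} (hu : FixesFrom N u) :
    raiseOp N k α (Finsupp.single u 1) =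
      ∑ β ∈ (Finset.range N).filter (fun β => IsKStep k (α, β) u),
        Finsupp.single (transp α β * u) 1 := by
  rw [raiseOp_single]
  split_ifs with h
  · simp only [coverOp_single]
    rw [← Finset.sum_filter]
    refine Finset.sum_nbij' (fun b => u.1 b) (fun β => u.1.symm β) ?_ ?_ ?_ ?_ ?_
    · intro b hb
      simp only [Finset.mem_filter, Finset.mem_Ico, Finset.mem_range, isKStep_iff,
        Equiv.symm_apply_apply] at hb ⊢
      exact ⟨hu.lt hb.1.2, h, hb.1.1, hb.2⟩
    · intro β hβ
      simp only [Finset.mem_filter, Finset.mem_Ico, Finset.mem_range, isKStep_iff] at hβ ⊢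
      exact ⟨⟨hβ.2.2.1, hu.symm_lt hβ.1⟩, hβ.2.2.2⟩
    · intro b _; exact Equiv.symm_apply_apply _ _
    · intro β _; exact Equiv.apply_symm_apply _ _
    · intro b _
      rw [transp_mul, Equiv.symm_apply_apply]
  · rw [Finset.filter_false_of_mem, Finset.sum_empty]
    intro β _ hs
    exact h (isKStep_iff.1 hs).1

theorem FixesFrom.transp_mul {n a b : ℕ} {u : SInf} (h : FixesFrom n u) (ha : a < n)
    (hb : b < n) : FixesFrom n (transp a b * u) := by
  rw [KBruhat.transp_mul]
  exact h.mul_transp (h.symm_lt ha) (h.symm_lt hb)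

open Classical in
/-- The terms of Pieri's operator are labelled by chains. -/
theorem pieriOp_single_eq_sum {N k : ℕ} (m : ℕ) : ∀ (j : ℕ) (u : SInf),
    FixesFrom N u → ∃ S : Finset (List (ℕ × ℕ)),
      (∀ x, x ∈ S ↔ x.length = m ∧ x.Pairwise (fun p q => p.1 < q.1) ∧
        (∀ q ∈ x, j ≤ q.1 ∧ q.1 < N ∧ q.2 < N) ∧ IsKChain k u x) ∧
      pieriOp N k m j (Finsupp.single u 1) = ∑ x ∈ S, Finsupp.single (listProd x * u) 1 := by
  induction m with
  | zero =>
    intro j u _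
    refine ⟨{[]}, fun x => ?_, by simp [pieriOp, listProd]⟩
    rw [Finset.mem_singleton, List.length_eq_zero_iff]
    constructor
    · rintro rfl; simp [IsKChain]
    · exact fun h => h.1
  | succ m ih =>
    intro j u hu
    choose! S hS hsum using ih
    set Q := (Finset.Ico j N ×ˢ Finset.range N).filter (fun q => IsKStep k q u) with hQ
    have hQmem : ∀ q, q ∈ Q ↔ ((j ≤ q.1 ∧ q.1 < N) ∧ q.2 < N) ∧ IsKStep k q u := fun q => by
      simp only [hQ, Finset.mem_filter, Finset.mem_product, Finset.mem_Ico, Finset.mem_range]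
    have hfix : ∀ q ∈ Q, FixesFrom N (transp q.1 q.2 * u) := fun q hq =>
      hu.transp_mul ((hQmem q).1 hq).1.1.2 ((hQmem q).1 hq).1.2
    refine ⟨Q.biUnion fun q => (S (q.1 + 1) (transp q.1 q.2 * u)).image (List.cons q),
      fun x => ?_, ?_⟩
    · rw [Finset.mem_biUnion]
      constructor
      · rintro ⟨q, hq, hx⟩
        obtain ⟨y, hy, rfl⟩ := Finset.mem_image.1 hx
        obtain ⟨h1, h2, h3, h4⟩ := (hS _ _ (hfix q hq) y).1 hy
        obtain ⟨⟨⟨g1, g2⟩, g3⟩, g4⟩ := (hQmem q).1 hq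
        refine ⟨by rw [List.length_cons, h1], List.pairwise_cons.2 ⟨fun q' hq' => ?_, h2⟩, ?_,
          g4, h4⟩
        · have := (h3 q' hq').1; omega
        · intro q' hq'
          rcases List.mem_cons.1 hq' with rfl | hq'
          · exact ⟨g1, g2, g3⟩
          · have := h3 q' hq'; exact ⟨by omega, this.2⟩
      · rintro ⟨h1, h2, h3, h4⟩
        obtain ⟨q, y, rfl⟩ := List.exists_cons_of_length_eq_add_one h1
        rw [List.pairwise_cons] at h2
        have hq := h3 q List.mem_cons_self
        have hqQ : q ∈ Q := (hQmem q).2 ⟨⟨⟨hq.1, hq.2.1⟩, hq.2.2⟩, h4.1⟩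
        refine ⟨q, hqQ, Finset.mem_image.2 ⟨y, ?_, rfl⟩⟩
        refine (hS _ _ (hfix q hqQ) y).2 ⟨by simpa using h1, h2.2, fun q' hq' => ?_, h4.2⟩
        exact ⟨h2.1 q' hq', (h3 q' (List.mem_cons_of_mem _ hq')).2⟩
    · rw [Finset.sum_biUnion]
      · rw [pieriOp, LinearMap.sum_apply, hQ, Finset.sum_filter, Finset.sum_product]
        refine Finset.sum_congr rfl fun α hα => ?_
        rw [Module.End.mul_apply, raiseOp_single_eq_sum hu, map_sum, Finset.sum_filter]
        refine Finset.sum_congr rfl fun β hβ => ?_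
        refine if_congr Iff.rfl ?_ rfl
        rw [Finset.sum_image (fun _ _ _ _ h => (List.cons.inj h).2),
          hsum _ _ (hu.transp_mul (Finset.mem_Ico.1 hα).2 (Finset.mem_range.1 hβ))]
        refine Finset.sum_congr rfl fun y _ => ?_
        rw [listProd, mul_assoc]
      · intro q _ q' _ hne
        rw [Function.onFun, Finset.disjoint_left]
        rintro x hx hx'
        obtain ⟨y, -, rfl⟩ := Finset.mem_image.1 hx
        obtain ⟨y', -, he⟩ := Finset.mem_image.1 hx'
        exact hne (List.cons.inj he).1.symm

theorem IsKChain.lt_of_fixesFrom {k : ℕ} : ∀ (x : List (ℕ × ℕ)) (n : ℕ) (u : SInf), k ≤ n →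
    FixesFrom n u → IsKChain k u x → ∀ q ∈ x, q.1 < n + x.length ∧ q.2 < n + x.length := by
  intro x
  induction x with
  | nil => intro _ _ _ _ _ q hq; simp at hq
  | cons p x ih =>
    intro n u hk hu h q hq
    obtain ⟨α, β⟩ := p
    obtain ⟨h1, h2, h3⟩ := isKStep_iff.1 h.1
    have hb := h3.le_of_fixesFrom hu (by omega)
    have hu' := hu.mono (Nat.le_succ n)
    have hβ : β < n + 1 := by
      have := hu'.lt (Nat.lt_succ_of_le hb)
      rwa [Equiv.apply_symm_apply] at this
    have hα := h.1.1
    simp only at hα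
    rw [List.length_cons]
    rcases List.mem_cons.1 hq with rfl | hq
    · exact ⟨by simp only; omega, by simp only; omega⟩
    · have := ih (n + 1) (transp α β * u) (by omega) (hu'.transp_mul (by omega) hβ) h.2 q hq
      omega

/-- Pieri's formula: multiplication of `𝔖_u` by `h_m(x_0, …, x_{k-1})` sums over the chains of
length `m` in the `k`-Bruhat order along which the smaller interchanged values increase. -/
theorem hPoly_mul_schubert (k m : ℕ) (u : SInf) : ∃ S : Finset (List (ℕ × ℕ)),
    (∀ x, x ∈ S ↔ x.length = m ∧ x.Pairwise (fun p q => p.1 < q.1) ∧ IsKChain k u x) ∧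
    hPoly k m * schubert u = ∑ x ∈ S, schubert (listProd x * u) := by
  obtain ⟨n₀, hn₀⟩ := exists_fixesFrom u
  have hn := hn₀.mono (Nat.le_add_right n₀ k)
  set n := n₀ + k
  have hN := hn.mono (show n ≤ n + m + 1 by omega)
  obtain ⟨S, hS, hsum⟩ := pieriOp_single_eq_sum (N := n + m + 1) (k := k) m 0 u hN
  refine ⟨S, fun x => ?_, ?_⟩
  · rw [hS]
    refine and_congr_right fun h1 => and_congr_right fun _ => and_iff_right_of_imp fun h q hq => ?_
    have := IsKChain.lt_of_fixesFrom x n u (by omega) hn h q hq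
    exact ⟨Nat.zero_le _, by omega, by omega⟩
  · rw [← schub_single u, ← schub_pieriOp k m n _ (by omega) le_rfl (single_mem_fixed hn 1),
      hsum, map_sum]
    exact Finset.sum_congr rfl fun x _ => schub_single _

/-! ### Products of complete homogeneous polynomials -/

/-- The complete homogeneous symmetric polynomial with an integer as its degree; it vanishes in
negative degrees. -/
def hInt (k : ℕ) (p : ℤ) : MvPolynomial ℕ ℤ := if 0 ≤ p then hPoly k p.toNat else 0

theorem sum_filter_lt_succ {r : ℕ} (p : Fin (r + 1) → ℤ) (i : Fin r) :
    ∑ j ∈ Finset.univ.filter (· < i.succ), p j =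
      p 0 + ∑ j ∈ Finset.univ.filter (· < i), p j.succ := by
  rw [Finset.sum_filter, Fin.sum_univ_succ, if_pos (Fin.succ_pos i), Finset.sum_filter]
  simp only [Fin.succ_lt_succ_iff]

theorem sum_filter_lt_zero {r : ℕ} (p : Fin (r + 1) → ℤ) :
    ∑ j ∈ Finset.univ.filter (· < (0 : Fin (r + 1))), p j = 0 := by
  rw [Finset.sum_filter]
  simp

theorem weaklyFits_iff_getD {r : ℕ} {p : Fin r → ℤ} {x : List (ℕ × ℕ)} :
    WeaklyFits p x ↔ (∀ i, 0 ≤ p i) ∧ ∑ i, p i = (x.length : ℤ) ∧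
      ∀ (i : Fin r) (s t : ℕ), s < t → t < x.length →
        (∑ j ∈ Finset.univ.filter (· < i), p j) ≤ (s : ℤ) →
        (t : ℤ) < (∑ j ∈ Finset.univ.filter (· < i), p j) + p i →
        (x.getD s 0).1 < (x.getD t 0).1 := by
  refine and_congr_right fun _ => and_congr_right fun _ => forall_congr' fun i => ?_
  constructor
  · intro h s t hst ht h1 h2
    have := h ⟨s, hst.trans ht⟩ ⟨t, ht⟩ hst h1 h2
    rwa [List.getD_eq_getElem x 0 (hst.trans ht), List.getD_eq_getElem x 0 ht]
  · intro h s t hst h1 h2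
    have := h s t hst t.2 h1 h2
    rwa [List.getD_eq_getElem x 0 s.2, List.getD_eq_getElem x 0 t.2] at this

/-- The first block of a sequence that weakly fits `p` is split off. -/
theorem weaklyFits_append {r : ℕ} {p : Fin (r + 1) → ℤ} {m : ℕ} (hm : p 0 = m)
    {x y : List (ℕ × ℕ)} (hx : x.length = m) :
    WeaklyFits p (x ++ y) ↔ x.Pairwise (fun p q => p.1 < q.1) ∧
      WeaklyFits (fun i => p i.succ) y := by
  simp only [weaklyFits_iff_getD, Fin.forall_fin_succ, Fin.sum_univ_succ, sum_filter_lt_zero,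
    sum_filter_lt_succ, hm, List.length_append, hx, zero_add, List.pairwise_iff_getElem]
  push_cast
  constructor
  · rintro ⟨⟨-, h1⟩, h2, h3, h4⟩
    refine ⟨fun s t hs ht hst => ?_, h1, by linarith, fun i s t hst ht hs1 ht1 => ?_⟩
    · have := h3 s t hst (by omega) (by positivity) (by omega)
      rw [← hx] at hs ht
      rwa [List.getD_append _ _ _ _ hs, List.getD_append _ _ _ _ ht, List.getD_eq_getElem x 0 hs,
        List.getD_eq_getElem x 0 ht] at this
    · have := h4 i (m + s) (m + t) (by omega) (by omega) (by push_cast; linarith)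
        (by push_cast; linarith)
      rwa [List.getD_append_right _ _ _ _ (by omega), List.getD_append_right _ _ _ _ (by omega),
        hx, Nat.add_sub_cancel_left, Nat.add_sub_cancel_left] at this
  · rintro ⟨h3, h1, h2, h4⟩
    refine ⟨⟨by positivity, h1⟩, by linarith, fun s t hst ht _ ht1 => ?_,
      fun i s t hst ht hs1 ht1 => ?_⟩
    · have htm : t < x.length := by omega
      have := h3 s t (by omega) (by omega) hst
      rwa [List.getD_append _ _ _ _ (hst.trans htm), List.getD_append _ _ _ _ htm,
        List.getD_eq_getElem x 0 (hst.trans htm), List.getD_eq_getElem x 0 htm]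
    · have hnn : 0 ≤ ∑ j ∈ Finset.univ.filter (· < i), p j.succ :=
        Finset.sum_nonneg fun j _ => h1 j
      have hsm : m ≤ s := by omega
      have := h4 i (s - m) (t - m) (by omega) (by omega) (by push_cast [hsm]; linarith)
        (by push_cast [show m ≤ t by omega]; linarith)
      rwa [List.getD_append_right _ _ _ _ (by omega), List.getD_append_right _ _ _ _ (by omega),
        hx]

theorem WeaklyFits.le_length {r : ℕ} {p : Fin (r + 1) → ℤ} {x : List (ℕ × ℕ)}
    (h : WeaklyFits p x) : p 0 ≤ x.length := by
  have h1 := h.2.1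
  rw [Fin.sum_univ_succ] at h1
  have := Finset.sum_nonneg (s := Finset.univ) fun (i : Fin r) _ => h.1 i.succ
  linarith

open Classical in
/-- Iterating Pieri's formula, the product of `𝔖_u` with complete homogeneous polynomials
in `x_0, …, x_{k-1}` sums over the chains in the `k`-Bruhat order that weakly fit the sequence
of degrees. -/
theorem prod_hInt_mul_schubert (k : ℕ) : ∀ (r : ℕ) (p : Fin r → ℤ) (u : SInf),
    ∃ S : Finset (List (ℕ × ℕ)), (∀ x, x ∈ S ↔ WeaklyFits p x ∧ IsKChain k u x) ∧
      (∏ i, hInt k (p i)) * schubert u = ∑ x ∈ S, schubert (listProd x * u) := by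
  intro r
  induction r with
  | zero =>
    intro p u
    refine ⟨{[]}, fun x => ?_, by simp [listProd]⟩
    rw [Finset.mem_singleton]
    constructor
    · rintro rfl
      exact ⟨⟨fun i => i.elim0, by simp, fun i => i.elim0⟩, trivial⟩
    · rintro ⟨h, -⟩
      have := h.2.1
      simpa using this.symm
  | succ r ih =>
    intro p u
    by_cases hp : 0 ≤ p 0
    · obtain ⟨m, hm⟩ := Int.eq_ofNat_of_zero_le hp
      obtain ⟨S₁, hS₁, hsum₁⟩ := hPoly_mul_schubert k m u
      choose S hS hsum using ih (fun i => p i.succ)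
      refine ⟨S₁.biUnion fun x => (S (listProd x * u)).image (x ++ ·), fun z => ?_, ?_⟩
      · rw [Finset.mem_biUnion]
        constructor
        · rintro ⟨x, hx, hz⟩
          obtain ⟨y, hy, rfl⟩ := Finset.mem_image.1 hz
          obtain ⟨h1, h2, h3⟩ := (hS₁ x).1 hx
          obtain ⟨h4, h5⟩ := (hS _ y).1 hy
          exact ⟨(weaklyFits_append hm h1).2 ⟨h2, h4⟩, (isKChain_append x y u).2 ⟨h3, h5⟩⟩
        · rintro ⟨h1, h2⟩
          have hlen : (z.take m).length = m := by
            have := h1.le_length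
            rw [List.length_take]
            omega
          rw [← List.take_append_drop m z] at h1 h2
          rw [weaklyFits_append hm hlen] at h1
          rw [isKChain_append] at h2
          exact ⟨z.take m, (hS₁ _).2 ⟨hlen, h1.1, h2.1⟩, Finset.mem_image.2 ⟨z.drop m,
            (hS _ _).2 ⟨h1.2, h2.2⟩, List.take_append_drop m z⟩⟩
      · rw [Finset.sum_biUnion]
        · rw [Fin.prod_univ_succ, hInt, if_pos hp, hm, mul_assoc, mul_left_comm,
            show ((m : ℕ) : ℤ).toNat = m from Int.toNat_natCast m, hsum₁, Finset.mul_sum]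
          refine Finset.sum_congr rfl fun x _ => ?_
          rw [Finset.sum_image (fun _ _ _ _ h => List.append_cancel_left h), hsum]
          refine Finset.sum_congr rfl fun y _ => ?_
          rw [listProd_append, mul_assoc]
        · intro x hx x' hx' hne
          rw [Function.onFun, Finset.disjoint_left]
          rintro z hz hz'
          obtain ⟨y, -, rfl⟩ := Finset.mem_image.1 hz
          obtain ⟨y', -, he⟩ := Finset.mem_image.1 hz'
          refine hne (List.append_inj he ?_).1.symm
          rw [((hS₁ x).1 hx).1, ((hS₁ x').1 hx').1]
    · refine ⟨∅, fun x => ?_, ?_⟩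
      · simp only [Finset.notMem_empty, false_iff, not_and]
        exact fun h => absurd (h.1 0) hp
      · rw [Fin.prod_univ_succ, hInt, if_neg hp, zero_mul, zero_mul, Finset.sum_empty]

/-! ### The Jacobi-Trudi formula for Grassmannian permutations -/

theorem hInt_of_neg {s : ℕ} {p : ℤ} (h : p < 0) : hInt s p = 0 := if_neg (not_le.2 h)

theorem hInt_natCast (s m : ℕ) : hInt s (m : ℤ) = hPoly s m := by
  rw [hInt, if_pos (by positivity), Int.toNat_natCast]

theorem hPoly_zero_right (s : ℕ) : hPoly s 0 = 1 := by
  cases s <;> rw [hPoly]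

theorem hInt_zero (s : ℕ) : hInt s 0 = 1 := (hInt_natCast s 0).trans (hPoly_zero_right s)

theorem hInt_succ (s : ℕ) (p : ℤ) : hInt (s + 1) p = hInt s p + X s * hInt (s + 1) (p - 1) := by
  rcases lt_trichotomy p 0 with h | rfl | h
  · rw [hInt_of_neg h, hInt_of_neg h, hInt_of_neg (by omega), mul_zero, add_zero]
  · rw [hInt_zero, hInt_zero, hInt_of_neg (by omega), mul_zero, add_zero]
  · obtain ⟨m, rfl⟩ : ∃ m : ℕ, p = (m + 1 : ℕ) := ⟨(p - 1).toNat, by omega⟩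
    rw [show ((m + 1 : ℕ) : ℤ) - 1 = (m : ℕ) by push_cast; ring, hInt_natCast, hInt_natCast,
      hInt_natCast, hPoly]

theorem constantCoeff_hInt (s : ℕ) (p : ℤ) :
    constantCoeff (hInt s p) = if p = 0 then 1 else 0 := by
  split_ifs with h
  · rw [h, hInt_zero, map_one]
  · rcases lt_or_gt_of_ne h with h | h
    · rw [hInt_of_neg h, map_zero]
    · obtain ⟨m, rfl⟩ : ∃ m : ℕ, p = (m + 1 : ℕ) := ⟨(p - 1).toNat, by omega⟩
      rw [hInt_natCast]
      clear h
      induction s with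
      | zero => rw [hPoly, map_zero]
      | succ s ih => rw [hPoly, map_add, map_mul, constantCoeff_X, zero_mul, add_zero, ih]

theorem swapVars_hInt_of_le {i s : ℕ} (h : s ≤ i) (p : ℤ) :
    swapVars i (hInt s p) = hInt s p := by
  rcases lt_or_ge p 0 with hp | hp
  · rw [hInt_of_neg hp]; exact map_zero _
  · obtain ⟨m, rfl⟩ := Int.eq_ofNat_of_zero_le hp
    rw [hInt_natCast]
    clear hp
    induction s generalizing m with
    | zero => cases m <;> rw [hPoly]; exacts [map_one _, map_zero _]
    | succ s ihs =>
      induction m with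
      | zero => rw [hPoly]; exact map_one _
      | succ m ihm =>
        rw [hPoly, swapVars_add, swapVars_mul, swapVars_X_of_ne (by omega) (by omega),
          ihs (by omega), ihm]

/-- The recursion that removes the last two variables together; it is symmetric in them. -/
theorem hInt_add_two (i : ℕ) (p : ℤ) : hInt (i + 2) p =
    hInt i p + (X i + X (i + 1)) * hInt (i + 2) (p - 1) -
      X i * X (i + 1) * hInt (i + 2) (p - 2) := by
  have h1 := hInt_succ (i + 1) p
  have h2 := hInt_succ i p
  have h3 := hInt_succ (i + 1) (p - 1)
  rw [show p - 1 - 1 = p - 2 by ring] at h3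
  linear_combination h1 + h2 - X i * h3

theorem swapVars_hInt_add_two (i : ℕ) (p : ℤ) :
    swapVars i (hInt (i + 2) p) = hInt (i + 2) p := by
  have neg : ∀ q : ℤ, q < 0 → swapVars i (hInt (i + 2) q) = hInt (i + 2) q := fun q hq => by
    rw [hInt_of_neg hq]; exact map_zero _
  rcases lt_or_ge p 0 with hp | hp
  · exact neg p hp
  · obtain ⟨m, rfl⟩ := Int.eq_ofNat_of_zero_le hp
    clear hp
    induction m using Nat.strong_induction_on with
    | _ m ih =>
    have ih' : ∀ q : ℤ, q < m → swapVars i (hInt (i + 2) q) = hInt (i + 2) q := fun q hq => by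
      rcases lt_or_ge q 0 with hq0 | hq0
      · exact neg q hq0
      · obtain ⟨m', rfl⟩ := Int.eq_ofNat_of_zero_le hq0
        exact ih m' (by exact_mod_cast hq)
    rw [hInt_add_two, swapVars_sub, swapVars_add, swapVars_mul, swapVars_mul, swapVars_mul,
      swapVars_add, swapVars_X_left, swapVars_X_right, swapVars_hInt_of_le le_rfl,
      ih' _ (by omega), ih' _ (by omega)]
    ring

/-- The complete homogeneous polynomial in `x_0, …, x_{s-1}` is symmetric in `x_i` and
`x_{i+1}` unless exactly one of the two variables occurs. -/
theorem swapVars_hInt {i s : ℕ} (h : s ≠ i + 1) (p : ℤ) :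
    swapVars i (hInt s p) = hInt s p := by
  rcases Nat.lt_or_ge i s with hs | hs
  · obtain ⟨d, rfl⟩ : ∃ d, s = i + 2 + d := ⟨s - (i + 2), by omega⟩
    clear h hs
    induction d generalizing p with
    | zero => exact swapVars_hInt_add_two i p
    | succ d ih =>
      have neg : ∀ q : ℤ, q < 0 → swapVars i (hInt (i + 2 + (d + 1)) q) =
          hInt (i + 2 + (d + 1)) q := fun q hq => by rw [hInt_of_neg hq]; exact map_zero _
      rcases lt_or_ge p 0 with hp | hp
      · exact neg p hp
      · obtain ⟨m, rfl⟩ := Int.eq_ofNat_of_zero_le hp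
        clear hp
        have step : ∀ q : ℤ, swapVars i (hInt (i + 2 + (d + 1)) (q - 1)) =
            hInt (i + 2 + (d + 1)) (q - 1) →
            swapVars i (hInt (i + 2 + (d + 1)) q) = hInt (i + 2 + (d + 1)) q := fun q hq => by
          rw [← add_assoc] at *
          rw [hInt_succ, swapVars_add, swapVars_mul, swapVars_X_of_ne (by omega) (by omega), ih,
            hq]
        induction m with
        | zero => exact step _ (neg _ (by simp))
        | succ m ihm => exact step _ (by rwa [show ((m + 1 : ℕ) : ℤ) - 1 = (m : ℕ) by
            push_cast; ring])
  · exact swapVars_hInt_of_le hs p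

theorem divDiff_hInt (i : ℕ) (p : ℤ) : divDiff i (hInt (i + 1) p) = hInt (i + 2) (p - 1) := by
  refine divDiff_eq_of_mul ?_
  have h1 := hInt_succ (i + 1) p
  have h2 := congrArg (swapVars i) h1
  rw [swapVars_add, swapVars_mul, swapVars_X_right, swapVars_hInt_add_two,
    swapVars_hInt_add_two] at h2
  linear_combination h1 - h2

theorem swapVars_det {k : ℕ} (p : ℕ) (M : Matrix (Fin k) (Fin k) (MvPolynomial ℕ ℤ)) :
    swapVars p M.det = (M.map (swapVars p)).det :=
  AlgHom.map_det (rename (Equiv.swap p (p + 1)) : MvPolynomial ℕ ℤ →ₐ[ℤ] MvPolynomial ℕ ℤ) M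

/-- The divided difference of a determinant in which a single column is not symmetric. -/
theorem divDiff_det {k : ℕ} (p : ℕ) (M : Matrix (Fin k) (Fin k) (MvPolynomial ℕ ℤ)) (j : Fin k)
    (h : ∀ i l, l ≠ j → swapVars p (M i l) = M i l) :
    divDiff p M.det = (M.updateCol j fun i => divDiff p (M i j)).det := by
  refine divDiff_eq_of_mul ?_
  have h1 : M.map (swapVars p) = M.updateCol j fun i => swapVars p (M i j) := by
    ext1 i l
    rw [Matrix.map_apply, Matrix.updateCol_apply]
    split_ifs with hl
    · rw [hl]
    · exact h i l hl
  have h2 : M.det = (M.updateCol j (((X p - X (p + 1) : MvPolynomial ℕ ℤ) •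
      fun i => divDiff p (M i j)) + fun i => swapVars p (M i j))).det := by
    congr 1
    conv_lhs => rw [← Matrix.updateCol_eq_self M j]
    congr 1
    funext i
    simp only [Pi.add_apply, Pi.smul_apply, smul_eq_mul]
    rw [divDiff_spec, sub_add_cancel]
  rw [swapVars_det, h1]
  conv_rhs => rw [h2]
  rw [Matrix.det_updateCol_add, Matrix.det_updateCol_smul]
  ring

/-- The determinant of complete homogeneous polynomials whose column `l` has the variables
`x_0, …, x_{a l}`. -/
def flagDet {k : ℕ} (L a : Fin k → ℕ) : MvPolynomial ℕ ℤ :=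
  (Matrix.of fun i l => hInt (a l + 1) ((L i : ℤ) - a l)).det

/-- Only the column `j` fails to be symmetric in the variables `x_{a j}` and `x_{a j + 1}`. -/
theorem divDiff_flagDet {k : ℕ} (L a : Fin k → ℕ) (ha : Function.Injective a) (j : Fin k) :
    divDiff (a j) (flagDet L a) = flagDet L (Function.update a j (a j + 1)) := by
  rw [flagDet, divDiff_det _ _ j, flagDet]
  · congr 1
    ext1 i l
    rw [Matrix.updateCol_apply, Matrix.of_apply, Matrix.of_apply, Matrix.of_apply]
    split_ifs with hl
    · subst hl
      rw [divDiff_hInt, Function.update_self]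
      congr 1
      push_cast
      ring
    · rw [Function.update_of_ne hl]
  · intro i l hl
    rw [Matrix.of_apply]
    exact swapVars_hInt (fun e => hl (ha (by omega))) _

theorem divDiff_flagDet_eq_zero {k : ℕ} (L a : Fin k → ℕ) {p : ℕ} (hp : p ∉ Set.range a) :
    divDiff p (flagDet L a) = 0 := by
  rw [divDiff_eq_zero_iff, flagDet, swapVars_det]
  congr 1
  ext1 i l
  rw [Matrix.map_apply, Matrix.of_apply]
  exact swapVars_hInt (fun e => hp ⟨l, by omega⟩) _

/-- A square matrix with a rectangle of zeros that reaches its diagonal with a full corner is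
singular. -/
theorem det_eq_zero_of_corner {k : ℕ} {R : Type*} [CommRing R] (M : Matrix (Fin k) (Fin k) R)
    (j : Fin k) (h : ∀ i l, i ≤ j → j ≤ l → M i l = 0) : M.det = 0 := by
  rw [Matrix.det_apply]
  refine Finset.sum_eq_zero fun σ _ => ?_
  obtain ⟨l, hl, hσ⟩ : ∃ l, j ≤ l ∧ σ l ≤ j := by
    by_contra! hc
    have := Finset.card_le_card_of_injOn (s := Finset.Ici j) (t := Finset.Ioi j) σ
      (fun l hl => by
        simp only [Finset.coe_Ici, Set.mem_Ici, Finset.coe_Ioi, Set.mem_Ioi] at hl ⊢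
        exact hc l hl) σ.injective.injOn
    rw [Fin.card_Ici, Fin.card_Ioi] at this
    omega
  have hz : ∏ i, M (σ i) i = 0 := Finset.prod_eq_zero (Finset.mem_univ l) (h _ _ hσ hl)
  rw [hz, smul_zero]

/-- If all inversions of `w` consist of a position in the set enumerated by `a` and a later one
outside of it, then `𝔖_w` is a determinant. A divided difference at a marked position `a l` moves
the mark one step to the right, in the permutation and in the column `l` alike. -/
theorem schubert_eq_flagDet {k : ℕ} (w : SInf) (a : Fin k → ℕ) (ha : StrictMono a)
    (hinv : ∀ p q, p < q → w.1 q < w.1 p → p ∈ Set.range a ∧ q ∉ Set.range a) :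
    schubert w = flagDet (fun l => w.1 (a l)) a := by
  induction hl : len w using Nat.strong_induction_on generalizing w a with
  | _ d ih =>
  subst hl
  have hL : StrictMono fun l => w.1 (a l) := by
    intro l l' hll
    have h1 := ha hll
    by_contra hc
    have h2 := apply_ne w h1.ne
    exact (hinv _ _ h1 (by simp only at hc; omega)).2 ⟨l', rfl⟩
  have hbelow : ∀ l, ∀ q < a l, w.1 q < w.1 (a l) := by
    intro l q hq
    by_contra hc
    have h2 := apply_ne w hq.ne
    exact (hinv _ _ hq (by omega)).2 ⟨l, rfl⟩
  have hle : ∀ l, a l ≤ w.1 (a l) := by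
    intro l
    have := Finset.card_le_card_of_injOn (s := Finset.range (a l))
      (t := Finset.range (w.1 (a l))) w.1 (fun q hq => by
        simp only [Finset.coe_range, Set.mem_Iio] at hq ⊢
        exact hbelow l q hq) w.1.injective.injOn
    simpa using this
  by_cases hw : w = 1
  · subst hw
    rw [schubert_one, flagDet, Matrix.det_of_isLowerTriangular]
    · refine (Finset.prod_eq_one fun i _ => ?_).symm
      rw [Matrix.of_apply, show (1 : SInf).1 (a i) = a i from rfl, sub_self, hInt_zero]
    · intro i l hil
      rw [Matrix.of_apply]
      refine hInt_of_neg ?_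
      have := ha (show i < l from hil)
      change ((a i : ℕ) : ℤ) - a l < 0
      omega
  refine eq_of_divDiff_eq (fun p => ?_) ?_
  · by_cases hp : p ∈ Set.range a
    · obtain ⟨j, rfl⟩ := hp
      rw [divDiff_flagDet _ _ ha.injective]
      have hne := apply_ne w (show a j ≠ a j + 1 by omega)
      rcases lt_or_gt_of_ne hne with hlt | hgt
      · rw [divDiff_schubert_of_lt hlt]
        symm
        by_cases hp1 : a j + 1 ∈ Set.range a
        · -- two columns coincide
          obtain ⟨j', hj'⟩ := hp1
          have hjj : j ≠ j' := fun e => by rw [e] at hj'; omega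
          refine Matrix.det_zero_of_column_eq hjj fun i => ?_
          rw [Matrix.of_apply, Matrix.of_apply, Function.update_self,
            Function.update_of_ne hjj.symm, hj']
        · -- the rows up to `j` and the columns from `j` on have negative degrees only
          have hLj : w.1 (a j) ≤ a j := by
            have := Finset.card_le_card_of_injOn (s := Finset.range (w.1 (a j)))
              (t := Finset.range (a j)) w.1.symm (fun v hv => by
                simp only [Finset.coe_range, Set.mem_Iio] at hv ⊢
                by_contra hc
                set q := w.1.symm v with hq
                have hwq : w.1 q = v := Equiv.apply_symm_apply _ _
                have h1 : q ≠ a j := fun e => by rw [e] at hwq; omega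
                have h2 : q ≠ a j + 1 := fun e => by rw [e] at hwq; omega
                exact hp1 (hinv (a j + 1) q (by omega) (by omega)).1)
              w.1.symm.injective.injOn
            simpa using this
          refine det_eq_zero_of_corner _ j fun i l hi hl => ?_
          rw [Matrix.of_apply]
          refine hInt_of_neg ?_
          have h1 : w.1 (a i) ≤ w.1 (a j) := hL.monotone hi
          change ((w.1 (a i) : ℕ) : ℤ) - (Function.update a j (a j + 1) l : ℕ) < 0
          have h2 : a j + 1 ≤ Function.update a j (a j + 1) l := by
            by_cases hlj : l = j
            · rw [hlj, Function.update_self]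
            · rw [Function.update_of_ne hlj]
              exact ha (lt_of_le_of_ne hl (Ne.symm hlj))
          omega
      · rw [divDiff_schubert_of_gt hgt]
        have hp1 := (hinv _ _ (Nat.lt_succ_self (a j)) hgt).2
        have ha' : ∀ l, Function.update a j (a j + 1) l =
            Equiv.swap (a j) (a j + 1) (a l) := by
          intro l
          by_cases hlj : l = j
          · rw [hlj, Function.update_self, Equiv.swap_apply_left]
          · rw [Function.update_of_ne hlj, Equiv.swap_apply_of_ne_of_ne
              (fun e => hlj (ha.injective e)) (fun e => hp1 ⟨l, e⟩)]
        have hmem : ∀ x, x ∈ Set.range (Function.update a j (a j + 1)) ↔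
            Equiv.swap (a j) (a j + 1) x ∈ Set.range a := by
          intro x
          constructor
          · rintro ⟨l, rfl⟩
            exact ⟨l, by rw [ha', Equiv.swap_apply_self]⟩
          · rintro ⟨l, hl⟩
            exact ⟨l, by rw [ha', hl, Equiv.swap_apply_self]⟩
        rw [ih (len (w * transp (a j) (a j + 1)))
          (by have := len_mul_simple_of_gt w (a j) hgt; omega) (w * transp (a j) (a j + 1))
          (Function.update a j (a j + 1)) ?_ ?_ rfl]
        · congr 1
          funext l
          rw [ha', mul_transp_apply, Equiv.swap_apply_self]
        · intro l l' hll
          rw [ha', ha']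
          exact swap_lt_swap (ha hll) fun e => hp1 ⟨l', e.2⟩
        · intro s t hst hlt
          rw [mul_transp_apply, mul_transp_apply] at hlt
          rw [hmem, hmem]
          refine hinv _ _ (swap_lt_swap hst ?_) hlt
          rintro ⟨rfl, rfl⟩
          rw [Equiv.swap_apply_left, Equiv.swap_apply_right] at hlt
          omega
    · have h1 : w.1 p < w.1 (p + 1) := by
        by_contra hc
        have h2 := apply_ne w (show p ≠ p + 1 by omega)
        exact hp (hinv p (p + 1) (by omega) (by omega)).1
      rw [divDiff_schubert_of_lt h1, divDiff_flagDet_eq_zero _ _ hp]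
  · -- at the origin the matrix is triangular, with a zero on its diagonal
    rw [constantCoeff_schubert hw, flagDet, RingHom.map_det]
    obtain ⟨p, hp⟩ := exists_descent hw
    obtain ⟨⟨j, rfl⟩, -⟩ := hinv p (p + 1) (by omega) hp
    rw [Matrix.det_of_isUpperTriangular]
    · refine (Finset.prod_eq_zero (Finset.mem_univ j) ?_).symm
      rw [RingHom.mapMatrix_apply, Matrix.map_apply, Matrix.of_apply, constantCoeff_hInt, if_neg]
      have := Finset.card_le_card_of_injOn (s := insert (a j + 1) (Finset.range (a j)))
        (t := Finset.range (w.1 (a j))) w.1 (fun q hq => by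
          simp only [Finset.coe_insert, Finset.coe_range, Set.mem_insert_iff, Set.mem_Iio]
            at hq ⊢
          rcases hq with rfl | hq
          · exact hp
          · exact hbelow j q hq) w.1.injective.injOn
      rw [Finset.card_insert_of_notMem (by simp), Finset.card_range, Finset.card_range] at this
      omega
    · intro i l hil
      have h1 := hL (show l < i from hil)
      have h2 := hle l
      simp only at h1
      rw [RingHom.mapMatrix_apply, Matrix.map_apply, Matrix.of_apply, constantCoeff_hInt, if_neg]
      omega

theorem grassFun_lt_of_lt {μ : YoungDiagram} {k i j : ℕ} (hij : i < j) (hj : j < k) :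
    grassFun μ k i < grassFun μ k j := by
  have := μ.rowLen_anti (k - 1 - j) (k - 1 - i) (by omega)
  simp only [grassFun, if_pos hj, if_pos (hij.trans hj)]
  omega

theorem grassFun_le_of_le {μ : YoungDiagram} {k i j : ℕ} (hi : k ≤ i) (hij : i ≤ j) :
    grassFun μ k i ≤ grassFun μ k j := by
  have h1 := μ.colLen_anti (i - k) (j - k) (by omega)
  simp only [grassFun, if_neg (show ¬ i < k by omega), if_neg (show ¬ j < k by omega)]
  omega

/-- The Jacobi-Trudi determinant of size `r` in `k` variables. -/
def jacobiTrudi (μ : YoungDiagram) (k r : ℕ) : MvPolynomial ℕ ℤ :=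
  (Matrix.of fun i j : Fin r => hInt k ((μ.rowLen i : ℤ) - (i : ℕ) + (j : ℕ))).det

theorem rowLen_eq_zero {μ : YoungDiagram} {i : ℕ} (h : μ.colLen 0 ≤ i) : μ.rowLen i = 0 := by
  by_contra hne
  have h1 : (i, 0) ∈ μ := YoungDiagram.mem_iff_lt_rowLen.2 (Nat.pos_of_ne_zero hne)
  have h2 := YoungDiagram.mem_iff_lt_colLen.1 h1
  omega

/-- An additional part `0` adds a row whose entries vanish except for the last one, which is `1`. -/
theorem jacobiTrudi_succ {μ : YoungDiagram} {k r : ℕ} (h : μ.colLen 0 ≤ r) :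
    jacobiTrudi μ k (r + 1) = jacobiTrudi μ k r := by
  rw [jacobiTrudi, Matrix.det_succ_row _ (Fin.last r), Finset.sum_eq_single (Fin.last r)]
  · rw [Matrix.of_apply, Fin.val_last, rowLen_eq_zero h]
    simp only [Nat.cast_zero, zero_sub, neg_add_cancel, hInt_zero, mul_one]
    rw [Even.neg_one_pow ⟨r, rfl⟩, one_mul, jacobiTrudi]
    congr 1
    ext1 i j
    simp
  · intro j _ hj
    have hlt : (j : ℕ) < r := by
      have := j.2
      have h2 : (j : ℕ) ≠ r := fun e => hj (Fin.ext e)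
      omega
    rw [Matrix.of_apply, Fin.val_last, rowLen_eq_zero h, hInt_of_neg (by push_cast; omega)]
    ring
  · simp

theorem jacobiTrudi_eq {μ : YoungDiagram} {k r s : ℕ} (hr : μ.colLen 0 ≤ r)
    (hs : μ.colLen 0 ≤ s) : jacobiTrudi μ k r = jacobiTrudi μ k s := by
  have key : ∀ r, μ.colLen 0 ≤ r → jacobiTrudi μ k r = jacobiTrudi μ k (μ.colLen 0) := by
    intro r hr
    induction r, hr using Nat.le_induction with
    | base => rfl
    | succ r hr ih => rw [jacobiTrudi_succ hr, ih]
  rw [key r hr, key s hs]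

/-- The determinants that interpolate between the one with `k - j` variables in column `j` and
the Jacobi-Trudi determinant: columns with fewer than `s` variables are raised to `s`. -/
def mixedDet (μ : YoungDiagram) (k s : ℕ) : MvPolynomial ℕ ℤ :=
  (Matrix.of fun i j : Fin k =>
    hInt (max (k - j) s) ((μ.rowLen i : ℤ) - (i : ℕ) + (j : ℕ))).det

theorem mixedDet_succ {μ : YoungDiagram} {k s : ℕ} (hs : s + 1 ≤ k) :
    mixedDet μ k (s + 1) = mixedDet μ k s := by
  obtain ⟨n, rfl⟩ : ∃ n, k = n + 1 := ⟨k - 1, by omega⟩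
  refine Matrix.det_eq_of_forall_col_eq_smul_add_pred
    (fun j : Fin n => if n - (j : ℕ) ≤ s then X s else 0) (fun i => ?_) fun i j => ?_
  · simp only [Matrix.of_apply]
    congr 1
    simp only [Fin.val_zero]
    omega
  · simp only [Matrix.of_apply, Fin.val_succ, Fin.val_castSucc]
    have hj := j.2
    split_ifs with h
    · rw [show max (n + 1 - ((j : ℕ) + 1)) (s + 1) = s + 1 by omega,
        show max (n + 1 - ((j : ℕ) + 1)) s = s by omega,
        show max (n + 1 - (j : ℕ)) (s + 1) = s + 1 by omega, hInt_succ]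
      congr 3
      push_cast
      ring
    · rw [zero_mul, add_zero, show max (n + 1 - ((j : ℕ) + 1)) (s + 1) =
        max (n + 1 - ((j : ℕ) + 1)) s by omega]

theorem schubert_grassmannian (μ : YoungDiagram) (k : ℕ) (hk : μ.colLen 0 ≤ k) :
    schubert (grassmannian μ k hk) = jacobiTrudi μ k k := by
  have hval : ∀ i, (grassmannian μ k hk).1 i = grassFun μ k i := fun _ => rfl
  rw [schubert_eq_flagDet (grassmannian μ k hk) (fun i : Fin k => (i : ℕ)) (fun _ _ h => h)]
  · have h1 : ∀ s ≤ k, mixedDet μ k s = mixedDet μ k 0 := by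
      intro s
      induction s with
      | zero => intro _; rfl
      | succ s ih => intro hs; rw [mixedDet_succ hs, ih (by omega)]
    have h2 : mixedDet μ k k = jacobiTrudi μ k k := by
      rw [mixedDet, jacobiTrudi]
      congr 1
      ext1 i j
      rw [Matrix.of_apply, Matrix.of_apply, max_eq_right (Nat.sub_le _ _)]
    rw [← h2, h1 k le_rfl, flagDet, mixedDet, ← Matrix.det_submatrix_equiv_self Fin.revPerm]
    congr 1
    ext1 i j
    have hi := i.2
    have hj := j.2
    simp only [Matrix.submatrix_apply, Matrix.of_apply, Fin.revPerm_apply, hval, grassFun,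
      Fin.is_lt, if_true, Fin.val_rev]
    rw [show k - 1 - (k - ((i : ℕ) + 1)) = (i : ℕ) by omega]
    congr 1
    · omega
    · push_cast [show (i : ℕ) + 1 ≤ k by omega, show (j : ℕ) + 1 ≤ k by omega]
      ring
  · intro p q hpq hlt
    simp only [hval] at hlt
    have hp : p < k := by
      by_contra hc
      have := grassFun_le_of_le (μ := μ) (not_lt.1 hc) hpq.le
      omega
    refine ⟨⟨⟨p, hp⟩, rfl⟩, ?_⟩
    rintro ⟨l, hl⟩
    have := grassFun_lt_of_lt (μ := μ) (k := k) hpq (by have := l.2; simp only at hl; omega)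
    omega

/-! ### The criterion for the `k`-Bruhat order -/

/-- The description of the `k`-Bruhat order without chains: from `u` to `w` the first `k` values do
not decrease, the others do not increase, and two values on the same side of `k` that are in
increasing order remain so. -/
structure KCriterion (k : ℕ) (u w : SInf) : Prop where
  le_left : ∀ a, a < k → u.1 a ≤ w.1 a
  le_right : ∀ b, k ≤ b → w.1 b ≤ u.1 b
  lt_of_lt : ∀ i j, i < j → (j < k ∨ k ≤ i) → u.1 i < u.1 j → w.1 i < w.1 j

theorem KCriterion.of_cover {k a b : ℕ} {u w : SInf} (ha : a < k) (hb : k ≤ b)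
    (hc : IsCover u a b) (h : KCriterion k (u * transp a b) w) : KCriterion k u w := by
  obtain ⟨h1, h2, h3⟩ := h
  have inj : ∀ i j, u.1 i = u.1 j → i = j := fun i j e => u.1.injective e
  simp only [IsCover, mul_transp_apply_ite] at *
  refine ⟨fun i hi => ?_, fun i hi => ?_, fun i j hij hs hlt => h3 i j hij hs ?_⟩
  · have := h1 i hi; grind
  · have := h2 i hi; grind
  · grind

/-- If every value among the first `k` positions agrees and the others do not increase, then the
permutations are equal. -/
theorem eq_of_forall_left_eq {k : ℕ} {u w : SInf} (h1 : ∀ a, a < k → u.1 a = w.1 a)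
    (h2 : ∀ b, k ≤ b → w.1 b ≤ u.1 b) : u = w := by
  have key : ∀ v c, w.1 c = v → u.1 c = w.1 c := by
    intro v
    induction v using Nat.strong_induction_on with
    | _ v ih =>
    rintro c rfl
    rcases Nat.lt_or_ge c k with hc | hc
    · exact h1 c hc
    · by_contra hne
      set d := u.1.symm (w.1 c) with hd
      have hud : u.1 d = w.1 c := Equiv.apply_symm_apply _ _
      have hdc : w.1 d ≠ w.1 c := fun e => by
        rw [w.1.injective e] at hud
        exact hne hud
      rcases Nat.lt_or_ge d k with hdk | hdk
      · exact hdc ((h1 d hdk).symm.trans hud)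
      · have h3 := h2 d hdk
        have := ih (w.1 d) (by omega) d rfl
        omega
  exact Subtype.ext (Equiv.ext fun c => key _ c rfl)

/-- The greedy choice of a cover below `w`: `a` is the position with the largest value that still
has to move up, and `b` the position with the smallest value for which the interchange stays
below `w`. -/
theorem KCriterion.exists_cover {k : ℕ} {u w : SInf} (h : KCriterion k u w) (hne : u ≠ w) :
    ∃ a b, a < k ∧ k ≤ b ∧ IsCover u a b ∧ KCriterion k (u * transp a b) w := by
  classical
  obtain ⟨h1, h2, h3⟩ := h
  have hex : ((Finset.range k).filter fun a => u.1 a < w.1 a).Nonempty := by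
    by_contra hc
    rw [Finset.not_nonempty_iff_eq_empty, Finset.filter_eq_empty_iff] at hc
    refine hne (eq_of_forall_left_eq (fun a ha => ?_) h2)
    have h4 := hc (Finset.mem_range.2 ha)
    have h5 := h1 a ha
    omega
  obtain ⟨a, ha, hmax⟩ := Finset.exists_max_image _ u.1 hex
  simp only [Finset.mem_filter, Finset.mem_range] at ha hmax
  obtain ⟨hak, haw⟩ := ha
  have hfix : ∀ i, i < k → u.1 a < u.1 i → w.1 i = u.1 i := fun i hi hlt => by
    by_contra hne'
    have := h1 i hi
    have := hmax i ⟨hi, by omega⟩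
    omega
  -- follow the values `w (u⁻¹ v)` down from `v = w a` until they pass below `u a`
  have hdesc : ∀ v, u.1 a < v → v ≤ w.1 a → k ≤ u.1.symm v → w.1 (u.1.symm v) < v →
      ∃ b, k ≤ b ∧ u.1 a < u.1 b ∧ u.1 b ≤ w.1 a ∧ w.1 b ≤ u.1 a := by
    intro v
    induction v using Nat.strong_induction_on with
    | _ v ih =>
    intro g1 g2 g3 g4
    have hv : u.1 (u.1.symm v) = v := Equiv.apply_symm_apply _ _
    rcases Nat.lt_or_ge (u.1 a) (w.1 (u.1.symm v)) with hlt | hge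
    · set d := u.1.symm (w.1 (u.1.symm v)) with hd
      have hud : u.1 d = w.1 (u.1.symm v) := Equiv.apply_symm_apply _ _
      have hdne : w.1 d ≠ w.1 (u.1.symm v) := fun e => by
        rw [w.1.injective e, hv] at hud
        omega
      rcases Nat.lt_or_ge d k with hdk | hdk
      · exact absurd ((hfix d hdk (by omega)).trans hud) hdne
      · have := h2 d hdk
        exact ih _ g4 hlt (by omega) hdk (by rw [← hd]; omega)
    · exact ⟨_, g3, by omega, by omega, hge⟩
  have hexb : ∃ v b, u.1 b = v ∧ k ≤ b ∧ u.1 a < u.1 b ∧ u.1 b ≤ w.1 a ∧ w.1 b ≤ u.1 a := by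
    set c := u.1.symm (w.1 a) with hc
    have huc : u.1 c = w.1 a := Equiv.apply_symm_apply _ _
    have hcne : w.1 c ≠ w.1 a := fun e => by
      rw [w.1.injective e] at huc
      omega
    rcases Nat.lt_or_ge c k with hck | hck
    · exact absurd ((hfix c hck (by omega)).trans huc) hcne
    · have := h2 c hck
      obtain ⟨b, hb⟩ := hdesc (w.1 a) haw le_rfl hck (by rw [← hc]; omega)
      exact ⟨_, b, rfl, hb⟩
  obtain ⟨b, hbv, hbk, hab, hbw, hwb⟩ := Nat.find_spec hexb
  have hmin : ∀ j, k ≤ j → u.1 a < u.1 j → u.1 j < u.1 b → u.1 a < w.1 j := fun j hj g1 g2 => by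
    by_contra hc
    exact Nat.find_min hexb (hbv ▸ g2) ⟨j, rfl, hj, g1, by omega, by omega⟩
  have hleft : ∀ i, i < k → u.1 a < u.1 i → u.1 i < u.1 b → i < a ∧ w.1 i < w.1 a := by
    intro i hi g1 g2
    have h4 := hfix i hi g1
    have h5 : i ≠ a := fun e => by rw [e] at g1; omega
    refine ⟨?_, by omega⟩
    by_contra hc
    have := h3 a i (by omega) (Or.inl hi) g1
    omega
  have hright : ∀ j, k ≤ j → u.1 a < u.1 j → u.1 j < u.1 b → b < j ∧ w.1 b < w.1 j := by
    intro j hj g1 g2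
    have h4 := hmin j hj g1 g2
    have h5 : j ≠ b := fun e => by rw [e] at g2; omega
    refine ⟨?_, by omega⟩
    by_contra hc
    have := h3 j b (by omega) (Or.inr hj) g2
    omega
  have hcov : IsCover u a b := by
    refine ⟨by omega, hab, fun i g1 g2 g3 => ?_⟩
    have hib := apply_ne u g2.ne
    by_contra hc
    rcases Nat.lt_or_ge i k with hi | hi
    · have := (hleft i hi g3 (by omega)).1; omega
    · have := (hright i hi g3 (by omega)).1; omega
  refine ⟨a, b, hak, hbk, hcov, fun i hi => ?_, fun j hj => ?_, fun i j hij hs hlt => ?_⟩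
  · have := h1 i hi
    rw [mul_transp_apply_ite]
    split_ifs with g1 g2
    · rw [g1]; exact hbw
    · omega
    · exact this
  · have := h2 j hj
    rw [mul_transp_apply_ite]
    split_ifs with g1 g2
    · omega
    · rw [g2]; exact hwb
    · exact this
  · have h4 := h3 i j hij hs
    rw [mul_transp_apply_ite, mul_transp_apply_ite] at hlt
    rcases eq_or_ne i a with rfl | hia
    · rw [if_pos rfl] at hlt
      refine h4 ?_
      split_ifs at hlt <;> omega
    rw [if_neg hia] at hlt
    rcases eq_or_ne i b with rfl | hib
    · rw [if_pos rfl, if_neg (by omega), if_neg (by omega)] at hlt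
      rcases Nat.lt_or_ge (u.1 j) (u.1 i) with hh | hh
      · exact (hright j (by omega) hlt hh).2
      · exact h4 (lt_of_le_of_ne hh (apply_ne u (by omega)))
    rw [if_neg hib] at hlt
    rcases eq_or_ne j a with rfl | hja
    · rw [if_pos rfl] at hlt
      rcases Nat.lt_or_ge (u.1 j) (u.1 i) with hh | hh
      · exact (hleft i (by omega) hh hlt).2
      · exact h4 (lt_of_le_of_ne hh (apply_ne u hia))
    rw [if_neg hja] at hlt
    refine h4 ?_
    split_ifs at hlt with hjb
    · rw [hjb]; omega
    · exact hlt

theorem KCriterion.kLe {k : ℕ} {u w : SInf} (h : KCriterion k u w) : KLe k u w := by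
  induction hn : ∑ i ∈ Finset.range k, (w.1 i - u.1 i) using Nat.strong_induction_on
    generalizing u with
  | _ n ih =>
  subst hn
  by_cases hne : u = w
  · subst hne; exact Relation.ReflTransGen.refl
  · obtain ⟨a, b, ha, hb, hc, h'⟩ := h.exists_cover hne
    refine Relation.ReflTransGen.head (KCover_iff.2 ⟨a, b, ha, hb, hc, rfl⟩) (ih _ ?_ h' rfl)
    have hle := h'.le_left a ha
    have hab := hc.2.1
    rw [mul_transp_left] at hle
    refine Finset.sum_lt_sum (fun i hi => ?_) ⟨a, Finset.mem_range.2 ha, ?_⟩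
    · rw [mul_transp_apply_ite]
      have := Finset.mem_range.1 hi
      split_ifs with g1 g2
      · subst g1; omega
      · omega
      · exact le_rfl
    · rw [mul_transp_left]; omega

theorem kLe_iff {k : ℕ} {u w : SInf} : KLe k u w ↔ KCriterion k u w := by
  refine ⟨fun h => ?_, KCriterion.kLe⟩
  induction h using Relation.ReflTransGen.head_induction_on with
  | refl => exact ⟨fun _ _ => le_rfl, fun _ _ => le_rfl, fun _ _ _ _ h => h⟩
  | head h _ ih =>
    obtain ⟨a, b, ha, hb, hc, rfl⟩ := KCover_iff.1 h
    exact ih.of_cover ha hb hc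

/-! ### Independence of the base permutation -/

theorem KCover.len_eq {k : ℕ} {u w : SInf} (h : KCover k u w) : len w = len u + 1 := by
  obtain ⟨a, b, -, -, -, h⟩ := h
  exact h

theorem KLe.eq_or_len_lt {k : ℕ} {u w : SInf} (h : KLe k u w) : u = w ∨ len u < len w := by
  induction h with
  | refl => exact Or.inl rfl
  | tail _ h ih =>
    have := h.len_eq
    rcases ih with rfl | h'
    · exact Or.inr (by omega)
    · exact Or.inr (by omega)

/-- The criterion for the `k`-Bruhat order in terms of the values of `u` instead of its
positions. -/
theorem kLe_mul_iff {k : ℕ} {x y u : SInf} : KLe k (x * u) (y * u) ↔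
    (∀ α, u.1.symm α < k → x.1 α ≤ y.1 α) ∧ (∀ α, k ≤ u.1.symm α → y.1 α ≤ x.1 α) ∧
      ∀ α β, u.1.symm α < u.1.symm β → (u.1.symm β < k ∨ k ≤ u.1.symm α) →
        x.1 α < x.1 β → y.1 α < y.1 β := by
  rw [kLe_iff]
  constructor
  · rintro ⟨h1, h2, h3⟩
    simp only [coe_mul_apply] at h1 h2 h3
    refine ⟨fun α h => ?_, fun α h => ?_, fun α β h hs hlt => ?_⟩
    · simpa using h1 _ h
    · simpa using h2 _ h
    · simpa using h3 _ _ h hs (by simpa using hlt)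
  · rintro ⟨h1, h2, h3⟩
    refine ⟨fun a h => ?_, fun a h => ?_, fun a b h hs hlt => ?_⟩ <;>
      simp only [coe_mul_apply] at *
    · exact h1 _ (by simpa using h)
    · exact h2 _ (by simpa using h)
    · exact h3 _ _ (by simpa using h) (by simpa using hs) hlt

/-- A chain `1 ⪯ η ⪯ ζ` witnessed by `v` and `l` is witnessed by every `u` and `k` for which
`ζ u` lies above `u`. -/
theorem KLe.transfer {k l : ℕ} {u v η ζ : SInf} (h1 : KLe l v (η * v))
    (h2 : KLe l (η * v) (ζ * v)) (h3 : KLe k u (ζ * u)) :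
    KLe k u (η * u) ∧ KLe k (η * u) (ζ * u) := by
  have h1' := kLe_mul_iff.1 ((one_mul v).symm ▸ h1 : KLe l (1 * v) (η * v))
  have h3' := kLe_mul_iff.1 ((one_mul u).symm ▸ h3 : KLe k (1 * u) (ζ * u))
  have h2' := kLe_mul_iff.1 h2
  suffices KLe k (1 * u) (η * u) ∧ KLe k (η * u) (ζ * u) by rwa [one_mul] at this
  simp only [kLe_mul_iff]
  have one_apply : ∀ α, (1 : SInf).1 α = α := fun _ => rfl
  simp only [one_apply] at h1' h3' ⊢
  obtain ⟨a1, a2, a3⟩ := h1'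
  obtain ⟨b1, b2, b3⟩ := h2'
  obtain ⟨c1, c2, c3⟩ := h3'
  refine ⟨⟨fun α h => ?_, fun α h => ?_, fun α β h hs hlt => ?_⟩,
    ⟨fun α h => ?_, fun α h => ?_, fun α β h hs hlt => ?_⟩⟩
  · have := c1 α h
    rcases Nat.lt_or_ge (v.1.symm α) l with hl | hl
    · exact a1 α hl
    · have := a2 α hl
      have := b2 α hl
      omega
  · have := c2 α h
    rcases Nat.lt_or_ge (v.1.symm α) l with hl | hl
    · have := a1 α hl
      have := b1 α hl
      omega
    · exact a2 α hl
  · have hζ := c3 α β h hs hlt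
    have hne : v.1.symm α ≠ v.1.symm β := fun e => hlt.ne (v.1.symm.injective e)
    have hη := apply_ne η hlt.ne
    by_contra hc
    -- the cases are the orders of the positions of `α` and `β` in `v` and their sides of `l`
    have r1 := a1 α
    have r2 := a2 α
    have r3 := a1 β
    have r4 := a2 β
    have s1 := b1 α
    have s2 := b2 α
    have s3 := b1 β
    have s4 := b2 β
    have t1 := a3 α β
    have t2 := b3 β α
    omega
  · have := c1 α h
    rcases Nat.lt_or_ge (v.1.symm α) l with hl | hl
    · exact b1 α hl
    · have := a2 α hl
      have := b2 α hl
      omega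
  · have := c2 α h
    rcases Nat.lt_or_ge (v.1.symm α) l with hl | hl
    · have := a1 α hl
      have := b1 α hl
      omega
    · exact b2 α hl
  · have hne' : α ≠ β := fun e => by rw [e] at hlt; omega
    have hne : v.1.symm α ≠ v.1.symm β := fun e => hne' (v.1.symm.injective e)
    have hζ := apply_ne ζ hne'
    by_contra hc
    have q := c3 α β h hs
    have r1 := a1 α
    have r2 := a2 α
    have r3 := a1 β
    have r4 := a2 β
    have s1 := b1 α
    have s2 := b2 α
    have s3 := b1 β
    have s4 := b2 β
    have t1 := a3 β α
    have t2 := b3 α β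
    omega

/-- Given `u` and `k` with `u ≤_k ζ u`, the relation `η ⪯ ζ` holds exactly if it is witnessed by
`u` and `k`. -/
theorem UnivLe.kLe {k : ℕ} {u η ζ : SInf} (h : UnivLe η ζ) (hu : KLe k u (ζ * u)) :
    KLe k u (η * u) ∧ KLe k (η * u) (ζ * u) := by
  obtain ⟨v, l, h1, h2⟩ := h
  exact h1.transfer h2 hu

theorem UnivCover.kCover {k : ℕ} {u η ζ : SInf} (h : UnivCover η ζ) (hu : KLe k u (ζ * u)) :
    KLe k u (η * u) ∧ KCover k (η * u) (ζ * u) := by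
  obtain ⟨hle, hne, hbet⟩ := h
  obtain ⟨h1, h2⟩ := hle.kLe hu
  refine ⟨h1, ?_⟩
  rcases h2.cases_head with e | ⟨y, hy, hy'⟩
  · exact absurd (mul_right_cancel e) hne
  · have hyu : y * u⁻¹ * u = y := inv_mul_cancel_right y u
    rcases hbet (y * u⁻¹) ⟨u, k, h1, by rw [hyu]; exact .single hy⟩
      ⟨u, k, by rw [hyu]; exact h1.tail hy, by rw [hyu]; exact hy'⟩ with e | e
    · rw [e] at hyu
      have := hy.len_eq
      rw [hyu] at this
      omega
    · rw [e] at hyu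
      rwa [hyu]

theorem KCover.univCover {k : ℕ} {u η ζ : SInf} (h : KCover k (η * u) (ζ * u))
    (hu : KLe k u (η * u)) : UnivCover η ζ := by
  have hlen := h.len_eq
  refine ⟨⟨u, k, hu, .single h⟩, fun e => by rw [e] at hlen; omega, fun ξ h1 h2 => ?_⟩
  obtain ⟨g1, g2⟩ := h2.kLe (hu.tail h)
  obtain ⟨-, g4⟩ := h1.kLe g1
  rcases g4.eq_or_len_lt with e | e
  · exact Or.inl (mul_right_cancel e).symm
  · rcases g2.eq_or_len_lt with e' | e'
    · exact Or.inr (mul_right_cancel e')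
    · omega

/-! ### Sequences of covers in the universal order -/

/-- The sequence `x` is a saturated chain in the universal `k`-Bruhat order that starts at `η`:
each pair `(α, β)` of `x` interchanges the values `α` and `β`. -/
def UChain (η : SInf) : List (ℕ × ℕ) → Prop
  | [] => True
  | q :: x => UnivCover η (transp q.1 q.2 * η) ∧ UChain (transp q.1 q.2 * η) x

open Classical in
theorem uComp_single (x : List (ℕ × ℕ)) (η : SInf) : uComp x (Finsupp.single η 1) =
    if UChain η x then Finsupp.single (listProd x * η) 1 else 0 := by
  induction x generalizing η with
  | nil => simp [uComp, UChain, listProd]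
  | cons q x ih =>
    have h : uComp (q :: x) = uComp x * uHat q.1 q.2 := by simp [uComp]
    rw [h, Module.End.mul_apply, uHat, Finsupp.linearCombination_single, one_smul]
    by_cases hc : UnivCover η (transp q.1 q.2 * η)
    · rw [if_pos hc, ih]
      simp only [UChain, hc, true_and, listProd, mul_assoc]
    · rw [if_neg hc, map_zero, if_neg fun h' => hc h'.1]

theorem mem_reducedSeqs_iff {ζ : SInf} {x : List (ℕ × ℕ)} : x ∈ reducedSeqs ζ ↔
    (∀ p ∈ x, p.1 < p.2) ∧ UChain 1 x ∧ listProd x = ζ := by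
  classical
  rw [reducedSeqs, Set.mem_ofPred_eq, uComp_single, mul_one]
  refine and_congr_right fun _ => ?_
  split_ifs with h
  · simp [h, Finsupp.single_left_inj]
  · have h0 : (0 : SInf →₀ ℚ) ≠ Finsupp.single ζ 1 :=
      (Finsupp.single_ne_zero.2 one_ne_zero).symm
    simp [h, h0]

theorem UChain.isKChain {k : ℕ} {u η : SInf} {x : List (ℕ × ℕ)} (hx : ∀ p ∈ x, p.1 < p.2)
    (h : UChain η x) (hu : KLe k u (listProd x * η * u)) :
    KLe k u (η * u) ∧ IsKChain k (η * u) x := by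
  induction x generalizing η with
  | nil => exact ⟨by simpa [listProd] using hu, trivial⟩
  | cons q x ih =>
    rw [listProd, mul_assoc (listProd x)] at hu
    obtain ⟨h1, h2⟩ := ih (fun p hp => hx p (List.mem_cons_of_mem _ hp)) h.2 hu
    obtain ⟨h3, h4⟩ := h.1.kCover h1
    rw [mul_assoc] at h4 h2
    exact ⟨h3, ⟨hx q List.mem_cons_self, h4⟩, h2⟩

theorem IsKChain.uChain {k : ℕ} {u η : SInf} {x : List (ℕ × ℕ)} (h : IsKChain k (η * u) x)
    (hu : KLe k u (η * u)) : (∀ p ∈ x, p.1 < p.2) ∧ UChain η x := by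
  induction x generalizing η with
  | nil => exact ⟨by simp, trivial⟩
  | cons q x ih =>
    obtain ⟨⟨hq, hc⟩, hx⟩ := h
    rw [← mul_assoc] at hc hx
    obtain ⟨h1, h2⟩ := ih hx (hu.tail hc)
    refine ⟨fun p hp => ?_, hc.univCover hu, h2⟩
    rcases List.mem_cons.1 hp with rfl | hp
    · exact hq
    · exact h1 p hp

/-- The `u`-reduced sequences of `ζ` are the labels of the saturated chains from `u` to `ζ u` in
the `k`-Bruhat order, whatever `u` and `k` are. -/
theorem mem_reducedSeqs_iff_isKChain {k : ℕ} {u ζ : SInf} (hu : KLe k u (ζ * u))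
    {x : List (ℕ × ℕ)} :
    x ∈ reducedSeqs ζ ↔ IsKChain k u x ∧ listProd x * u = ζ * u := by
  rw [mem_reducedSeqs_iff]
  constructor
  · rintro ⟨h1, h2, rfl⟩
    have := (h2.isKChain (u := u) h1 (by rwa [mul_one])).2
    rw [one_mul] at this
    exact ⟨this, rfl⟩
  · rintro ⟨h1, h2⟩
    rw [← one_mul u] at h1
    obtain ⟨h3, h4⟩ := h1.uChain (by rw [one_mul]; exact .refl)
    exact ⟨h3, h4, mul_right_cancel h2⟩

/-! ### Existence of a base permutation -/

/-- A finite set of `k` numbers is the set of the first `k` values of a permutation that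
increases on the first `k` positions and on the others. -/
theorem exists_increasing_on_sides (C : Finset ℕ) : ∃ w : SInf,
    (∀ i, i < C.card ↔ w.1 i ∈ C) ∧
      ∀ i j, i < j → (j < C.card ∨ C.card ≤ i) → w.1 i < w.1 j := by
  classical
  have hfin : {v | v ∈ C}.Finite := C.finite_toSet
  have hcard : hfin.toFinset.card = C.card := by congr 1; ext; simp
  have hinf : {v | v ∉ C}.Infinite := hfin.infinite_compl
  let f : ℕ → ℕ := fun i =>
    if i < C.card then Nat.nth (· ∈ C) i else Nat.nth (· ∉ C) (i - C.card)
  let g : ℕ → ℕ := fun v =>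
    if v ∈ C then Nat.count (· ∈ C) v else C.card + Nat.count (· ∉ C) v
  have hlow : ∀ i, i < C.card → f i ∈ C := fun i hi => by
    simp only [f, if_pos hi]
    exact Nat.nth_mem i fun h => by
      have : h.toFinset.card = C.card := hcard
      omega
  have hhigh : ∀ i, ¬ i < C.card → f i ∉ C := fun i hi => by
    simp only [f, if_neg hi]
    exact Nat.nth_mem_of_infinite hinf _
  have hgf : Function.LeftInverse g f := fun i => by
    by_cases hi : i < C.card
    · simp only [g, if_pos (hlow i hi)]
      simp only [f, if_pos hi]
      exact Nat.count_nth fun h => by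
        have : h.toFinset.card = C.card := hcard
        omega
    · simp only [g, if_neg (hhigh i hi)]
      simp only [f, if_neg hi]
      rw [Nat.count_nth_of_infinite hinf]
      omega
  have hcount : ∀ v, Nat.count (· ∈ C) v ≤ C.card := fun v => by
    rw [Nat.count_eq_card_filter_range]
    exact Finset.card_le_card fun i hi => (Finset.mem_filter.1 hi).2
  have hfg : Function.RightInverse g f := fun v => by
    by_cases hv : v ∈ C
    · have hlt : Nat.count (· ∈ C) v < C.card := by
        refine lt_of_lt_of_le (Nat.lt_succ_self _) (le_trans ?_ (hcount (v + 1)))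
        rw [Nat.count_succ, if_pos hv]
      simp only [g, if_pos hv, f, if_pos hlt]
      exact Nat.nth_count hv
    · simp only [g, if_neg hv, f]
      rw [if_neg (by omega), Nat.add_sub_cancel_left]
      exact Nat.nth_count hv
  refine ⟨⟨⟨f, g, hgf, hfg⟩, ?_⟩, fun i => ⟨hlow i, fun h => ?_⟩, fun i j hij hs => ?_⟩
  · refine Set.Finite.subset (Set.finite_lt_nat (C.sup id + 1)) fun v hv => ?_
    by_contra hge
    refine hv ?_
    have hvC : ∀ a ∈ C, a < v := fun a ha => by
      have : a ≤ C.sup id := Finset.le_sup (f := id) ha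
      simp only [Set.mem_ofPred_eq] at hge
      omega
    have hvn : v ∉ C := fun h => lt_irrefl _ (hvC v h)
    have h1 : ((Finset.range v).filter (· ∈ C)).card = C.card := by
      congr 1
      ext a
      simpa using hvC a
    have h2 := Finset.card_filter_add_card_filter_not (s := Finset.range v) (· ∈ C)
    have hg : g v = v := by
      simp only [g, if_neg hvn]
      rw [Nat.count_eq_card_filter_range, ← h1]
      rw [Finset.card_range] at h2
      exact h2
    have hfv := hfg v
    rw [hg] at hfv
    exact hfv
  · by_contra hc
    exact hhigh i hc h
  · show f i < f j
    rcases hs with hs | hs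
    · simp only [f, if_pos hs, if_pos (hij.trans hs)]
      exact Nat.nth_lt_nth' hij fun h => by
        have : h.toFinset.card = C.card := hcard
        omega
    · simp only [f, if_neg (show ¬ i < C.card by omega), if_neg (show ¬ j < C.card by omega)]
      exact Nat.nth_strictMono hinf (by omega)

/-- For `w` increasing on each side of `k`, with the first `k` values those that `ζ` has moved
up and some fixed points, `ζ⁻¹ w` lies below `w` in the `k`-Bruhat order. -/
theorem exists_kLe_mul (ζ : SInf) (K : ℕ) : ∃ (k : ℕ) (u : SInf), K ≤ k ∧ KLe k u (ζ * u) := by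
  obtain ⟨n, hn⟩ := exists_fixesFrom ζ
  set C := (Finset.range (n + K)).filter fun v => ζ.1.symm v < v ∨ n ≤ v with hC
  obtain ⟨w, hw, hmono⟩ := exists_increasing_on_sides C
  have happ : ∀ i, ζ.1 ((ζ⁻¹ * w).1 i) = w.1 i := fun i => by
    rw [← coe_mul_apply, mul_inv_cancel_left]
  have hfix : ∀ v, n ≤ v → ζ.1.symm v = v := fun v hv => by
    rw [Equiv.symm_apply_eq]; exact (hn v hv).symm
  have hu : ∀ i, (ζ⁻¹ * w).1 i = ζ.1.symm (w.1 i) := fun i => by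
    rw [Equiv.eq_symm_apply, happ]
  refine ⟨C.card, ζ⁻¹ * w, ?_, ?_⟩
  · have : Finset.Ico n (n + K) ⊆ C := fun v hv => by
      have := Finset.mem_Ico.1 hv
      simp only [hC, Finset.mem_filter, Finset.mem_range]
      omega
    simpa using Finset.card_le_card this
  · rw [mul_inv_cancel_left, kLe_iff]
    refine ⟨fun a ha => ?_, fun b hb => ?_, fun i j hij hs _ => hmono i j hij hs⟩
    · have := (hw a).1 ha
      simp only [hC, Finset.mem_filter, Finset.mem_range] at this
      rw [hu]
      rcases this.2 with h | h
      · exact h.le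
      · exact (hfix _ h).le
    · have := mt (hw b).2 (not_lt.2 hb)
      simp only [hC, Finset.mem_filter, Finset.mem_range, not_and, not_or] at this
      rw [hu]
      rcases Nat.lt_or_ge (w.1 b) n with h | h
      · exact not_lt.1 (this (by omega)).1
      · exact (hfix _ h).ge

/-! ### The alternating sum -/

/-- The sequences that fit `p` are, by Pieri's formula, the labels of the terms `𝔖_{ζ u}` of the
product of `𝔖_u` by the complete homogeneous polynomials of degrees `p_1, …, p_r`. -/
theorem exists_sum_and_fitSeqs_eq {k r : ℕ} {u ζ : SInf} (hu : KLe k u (ζ * u)) (p : Fin r → ℤ) :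
    ∃ c : SInf →₀ ℤ, (∏ i, hInt k (p i)) * schubert u = schub c ∧
      (fitSeqs p ζ).Finite ∧ c (ζ * u) = (fitSeqs p ζ).ncard := by
  classical
  obtain ⟨S, hS, hprod⟩ := prod_hInt_mul_schubert k r p u
  have hfit : fitSeqs p ζ = ↑(S.filter fun x => listProd x * u = ζ * u) := by
    ext x
    rw [fitSeqs, Set.mem_ofPred_eq, mem_reducedSeqs_iff_isKChain hu, Finset.mem_coe,
      Finset.mem_filter, hS]
    tauto
  refine ⟨∑ x ∈ S, Finsupp.single (listProd x * u) 1, ?_, ?_, ?_⟩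
  · rw [hprod, map_sum]
    exact Finset.sum_congr rfl fun x _ => (by rw [schub_single])
  · rw [hfit]
    exact Finset.finite_toSet _
  · rw [hfit, Set.ncard_coe_finset, Finsupp.finsetSum_apply, Finset.card_filter]
    push_cast
    exact Finset.sum_congr rfl fun x _ => Finsupp.single_apply

theorem jacobiTrudi_eq_sum_sign (μ : YoungDiagram) (k r : ℕ) : jacobiTrudi μ k r =
    ∑ σ : Equiv.Perm (Fin r), ((Equiv.Perm.sign σ : ℤˣ) : ℤ) •
      ∏ i, hInt k (permuteParts μ σ i) := by
  rw [jacobiTrudi, Matrix.det_apply']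
  refine Finset.sum_congr rfl fun σ _ => ?_
  rw [zsmul_eq_mul]
  congr 1
  refine Finset.prod_congr rfl fun i _ => ?_
  rw [Matrix.of_apply, permuteParts]
  congr 1
  ring

end KBruhat

end

theorem mainTheorem4 (lam : YoungDiagram) (r : ℕ) (hr : lam.colLen 0 ≤ r) (ζ : KBruhat.SInf) :
    (∃ (k : ℕ) (u w : KBruhat.SInf), lam.colLen 0 ≤ k ∧ KBruhat.KLe k u w ∧ w * u⁻¹ = ζ) ∧
    (∀ σ : Equiv.Perm (Fin r), (KBruhat.fitSeqs (KBruhat.permuteParts lam σ) ζ).Finite) ∧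
    ∀ (k : ℕ) (hk : lam.colLen 0 ≤ k) (u w : KBruhat.SInf),
      KBruhat.KLe k u w → w * u⁻¹ = ζ →
      (∃! c : KBruhat.SInf →₀ ℤ, KBruhat.IsSchubertExpansion
        (KBruhat.schubert u * KBruhat.schubert (KBruhat.grassmannian lam k hk)) c) ∧
      KBruhat.structConst u (KBruhat.grassmannian lam k hk) w =
        ∑ σ : Equiv.Perm (Fin r), ((Equiv.Perm.sign σ : ℤˣ) : ℤ) *
          ((KBruhat.fitSeqs (KBruhat.permuteParts lam σ) ζ).ncard : ℤ) := by
  obtain ⟨k₀, u₀, hk₀, h₀⟩ := KBruhat.exists_kLe_mul ζ (lam.colLen 0)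
  refine ⟨⟨k₀, u₀, ζ * u₀, hk₀, h₀, mul_inv_cancel_right ζ u₀⟩, fun σ => ?_,
    fun k hk u w huw hζ => ⟨KBruhat.existsUnique_isSchubertExpansion _, ?_⟩⟩
  · obtain ⟨-, -, h, -⟩ :=
      KBruhat.exists_sum_and_fitSeqs_eq h₀ (KBruhat.permuteParts lam σ)
    exact h
  · obtain rfl : w = ζ * u := mul_inv_eq_iff_eq_mul.1 hζ
    choose c hc _ hcard using fun σ : Equiv.Perm (Fin r) =>
      KBruhat.exists_sum_and_fitSeqs_eq huw (KBruhat.permuteParts lam σ)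
    have hprod : KBruhat.schub (∑ σ : Equiv.Perm (Fin r),
        ((Equiv.Perm.sign σ : ℤˣ) : ℤ) • c σ) =
        KBruhat.schubert u * KBruhat.schubert (KBruhat.grassmannian lam k hk) := by
      rw [KBruhat.schubert_grassmannian, KBruhat.jacobiTrudi_eq hk hr,
        KBruhat.jacobiTrudi_eq_sum_sign, mul_comm, Finset.sum_mul, map_sum]
      exact Finset.sum_congr rfl fun σ _ => by rw [map_zsmul, ← hc, smul_mul_assoc]
    rw [KBruhat.structConst_eq hprod, Finsupp.finsetSum_apply]
    exact Finset.sum_congr rfl fun σ _ => by rw [Finsupp.smul_apply, hcard, smul_eq_mul]
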